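/- Let $Q=(0,1)\times(0,1)$ and $\mathbb S^2=\{\xi\in\mathbb R^3:|\xi|=1\}$, and write points of $\mathbb R^3$ as $x=(x',x_3)$ with $x'\in\mathbb R^2$. Let $f_1,f_2:\mathbb R^2\to(0,+\infty)$ be Lipschitz continuous and $Q$-periodic with $f_1<f_2$, and let $\omega\subset\mathbb R^2$ be a bounded open set with Lipschitz boundary. For $\varepsilon>0$ set $$\Omega_\varepsilon=\{(x',x_3): x'\in\omega,\ f_1(x'/\varepsilon)<x_3<f_2(x'/\varepsilon)\},\qquad Q_{f_1,f_2}=\{(y',y_3): y'\in Q,\ f_1(y')<y_3<f_2(y')\}.$$ Let $H^1_\#(Q_{f_1,f_2};\mathbb R^3)$ be the space of functions in $H^1(Q_{f_1,f_2};\mathbb R^3)$ that are $Q$-periodic in $y'$ (that is, whose $Q$-periodic extension in $y'$ is weakly differentiable on $\{(y',y_3): y'\in\mathbb R^2,\ f_1(y')<y_3<f_2(y')\}$), and for a real $3\times2$ matrix $\xi$ let $$g_{\mathrm{hom}}(\xi)=\inf_{\varphi\in H^1_\#(Q_{f_1,f_2};\mathbb R^3)}\int_{Q_{f_1,f_2}}\left(|\xi+\nabla_{y'}\varphi|^2+|\partial_{y_3}\varphi|^2\right)dy,$$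 where $|\cdot|$ denotes the Frobenius norm of matrices and the Euclidean norm of vectors. For an open set $U$, $H^1(U;\mathbb S^2)$ denotes the set of $u\in H^1(U;\mathbb R^3)$ with $u(x)\in\mathbb S^2$ for almost every $x\in U$. Then for every $m_0\in H^1(\omega;\mathbb S^2)$ there exists a family $\{m_\varepsilon\}_{\varepsilon>0}$ with $m_\varepsilon\in H^1(\Omega_\varepsilon;\mathbb S^2)$ for every $\varepsilon>0$ such that $$\int_{\Omega_\varepsilon}|m_\varepsilon(x)-m_0(x')|^2\,dx\to0\quad\text{as }\varepsilon\to0^+$$ and $$\limsup_{\varepsilon\to0^+}\int_{\Omega_\varepsilon}\left(|\nabla_{x'}m_\varepsilon|^2+\frac1{\varepsilon^2}|\partial_{x_3}m_\varepsilon|^2\right)dx\le\int_\omega g_{\mathrm{hom}}(\nabla m_0)\,dx'.$$ -/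

import Mathlib

open MeasureTheory Filter Topology
open scoped ENNReal NNReal

namespace RoughFilm

/-- `ℝᵈ` with its Euclidean norm. -/
abbrev E (d : ℕ) : Type := EuclideanSpace ℝ (Fin d)

/-- The in-plane part `x' = (x₁, x₂)` of a point `x = (x', x₃)` of `ℝ³`. -/
def plane (x : E 3) : E 2 := !₂[x 0, x 1]

/-- `G` is the weak gradient of `u : U → ℝ³` on the open set `U ⊆ ℝᵈ`: for all components `i`, `j`,
`G i j` is the distributional derivative `∂ⱼ uᵢ`, tested against smooth functions with compact
support in `U`. It is used below only for locally integrable `u` and `G`. -/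
def HasWeakGradient {d : ℕ} (U : Set (E d)) (u : E d → E 3)
    (G : E d → Matrix (Fin 3) (Fin d) ℝ) : Prop :=
  ∀ ψ : E d → ℝ, ContDiff ℝ (⊤ : ℕ∞) ψ → HasCompactSupport ψ → tsupport ψ ⊆ U →
    ∀ (i : Fin 3) (j : Fin d),
      ∫ x in U, u x i * fderiv ℝ ψ x (EuclideanSpace.single j 1) = - ∫ x in U, G x i j * ψ x

/-- `u ∈ H¹(U; ℝ³)`, with weak gradient `G` (which `u` determines up to null sets). -/
structure IsH1 {d : ℕ} (U : Set (E d)) (u : E d → E 3)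
    (G : E d → Matrix (Fin 3) (Fin d) ℝ) : Prop where
  memLp : MemLp u 2 (volume.restrict U)
  memLp_grad : ∀ i j, MemLp (fun x => G x i j) 2 (volume.restrict U)
  hasWeakGradient : HasWeakGradient U u G

/-- `u ∈ H¹(U; 𝕊²)`, with weak gradient `G`. -/
structure IsH1Sphere {d : ℕ} (U : Set (E d)) (u : E d → E 3)
    (G : E d → Matrix (Fin 3) (Fin d) ℝ) : Prop extends IsH1 U u G where
  sphere : ∀ᵐ x ∂(volume.restrict U), u x ∈ Metric.sphere (0 : E 3) 1

/-- The open set `ω ⊆ ℝ²` has Lipschitz boundary: near each boundary point and in suitable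
orthonormal coordinates, `ω` is the set of points strictly above the graph of a Lipschitz function. -/
def HasLipschitzBoundary (ω : Set (E 2)) : Prop :=
  ∀ p ∈ frontier ω, ∃ (L : E 2 ≃ₗᵢ[ℝ] E 2) (γ : ℝ → ℝ) (K : ℝ≥0) (r : ℝ),
    LipschitzWith K γ ∧ 0 < r ∧
      ∀ x ∈ Metric.ball p r, x ∈ ω ↔ γ (L x 0) < L x 1

/-- `f : ℝ² → ℝ` is periodic with periodic cell `Q = (0,1) × (0,1)`. -/
def IsQPeriodic (f : E 2 → ℝ) : Prop :=
  ∀ j : Fin 2, Function.Periodic f (EuclideanSpace.single j 1)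

/-- The rescaled film `Ω_ε = {(x', x₃) : x' ∈ ω, f₁(x'/ε) < x₃ < f₂(x'/ε)}`. -/
def film (f₁ f₂ : E 2 → ℝ) (ω : Set (E 2)) (ε : ℝ) : Set (E 3) :=
  {x | plane x ∈ ω ∧ f₁ (ε⁻¹ • plane x) < x 2 ∧ x 2 < f₂ (ε⁻¹ • plane x)}

/-- The open unit square `Q = (0,1) × (0,1)`. -/
def unitSquare : Set (E 2) := {y | ∀ j, y j ∈ Set.Ioo (0 : ℝ) 1}

/-- The cell `Q_{f₁,f₂} = {(y', y₃) : y' ∈ Q, f₁(y') < y₃ < f₂(y')}`. -/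
def cell (f₁ f₂ : E 2 → ℝ) : Set (E 3) :=
  {y | plane y ∈ unitSquare ∧ f₁ (plane y) < y 2 ∧ y 2 < f₂ (plane y)}

/-- The unbounded layer `{(y', y₃) : y' ∈ ℝ², f₁(y') < y₃ < f₂(y')}`, the union (up to a null set)
of the integer horizontal translates of the cell when `f₁`, `f₂` are `Q`-periodic. -/
def layer (f₁ f₂ : E 2 → ℝ) : Set (E 3) :=
  {y | f₁ (plane y) < y 2 ∧ y 2 < f₂ (plane y)}

/-- `φ ∈ H¹_#(Q_{f₁,f₂}; ℝ³)`, with weak gradient `G`: `φ` is `Q`-periodic in `y'`, it and its weak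
gradient are square integrable on the cell, and `φ` is weakly differentiable across the lateral
faces of the cell, i.e. `G` is its weak gradient on the whole layer. (The representatives of `φ`
and `G` are taken periodic at every point.) -/
structure IsH1Periodic (f₁ f₂ : E 2 → ℝ) (φ : E 3 → E 3)
    (G : E 3 → Matrix (Fin 3) (Fin 3) ℝ) : Prop where
  periodic : ∀ j : Fin 2, Function.Periodic φ (EuclideanSpace.single j.castSucc 1)
  periodic_grad : ∀ j : Fin 2, Function.Periodic G (EuclideanSpace.single j.castSucc 1)
  memLp : MemLp φ 2 (volume.restrict (cell f₁ f₂))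
  memLp_grad : ∀ i j, MemLp (fun y => G y i j) 2 (volume.restrict (cell f₁ f₂))
  hasWeakGradient : HasWeakGradient (layer f₁ f₂) φ G

/-- The homogenized exchange density
`g_hom(ξ) = inf { ∫_{Q_{f₁,f₂}} |ξ + ∇_{y'} φ|² + |∂_{y₃} φ|² dy : φ ∈ H¹_#(Q_{f₁,f₂}; ℝ³) }`. The
norms of matrices are Frobenius norms. The value is finite, being at most the one of `φ = 0`. -/
noncomputable def gHom (f₁ f₂ : E 2 → ℝ) (ξ : Matrix (Fin 3) (Fin 2) ℝ) : ℝ≥0∞ :=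
  ⨅ (φ : E 3 → E 3) (G : E 3 → Matrix (Fin 3) (Fin 3) ℝ) (_ : IsH1Periodic f₁ f₂ φ G),
    ∫⁻ y in cell f₁ f₂, ENNReal.ofReal
      ((∑ i : Fin 3, ∑ j : Fin 2, (ξ i j + G y i j.castSucc) ^ 2) + ∑ i : Fin 3, (G y i 2) ^ 2)

/-- The rescaled exchange energy `∫_Ω |∇_{x'} m|² + ε⁻² |∂_{x₃} m|² dx`, for `m` with weak
gradient `G` on `Ω ⊆ ℝ³`. -/
noncomputable def exchangeEnergy (Ω : Set (E 3)) (ε : ℝ)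
    (G : E 3 → Matrix (Fin 3) (Fin 3) ℝ) : ℝ≥0∞ :=
  ∫⁻ x in Ω, ENNReal.ofReal
    ((∑ i : Fin 3, ∑ j : Fin 2, (G x i j.castSucc) ^ 2) + (1 / ε ^ 2) * ∑ i : Fin 3, (G x i 2) ^ 2)

end RoughFilm

open MeasureTheory Filter Topology
open scoped ENNReal NNReal

/-! The recovery fields are m_ε = π(m₀(x') + ε ∑ₖ χₖ(x'/ε, x₃) Wᵢₖ(x')), where π is the radial
projection onto the sphere, χ₀ and χ₁ are scalar periodic correctors, and W is smooth, compactly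
supported and L²-close to ∇m₀. Horizontally the factor ε cancels the 1/ε of the fast variable,
vertically it cancels the weight ε⁻² of the energy. The rescaled gradient of the unprojected field
is therefore W + ∑ₖ Wₖ ∇χₖ at the fast variable, up to ∇m₀ - W and a term of order ε
(`stretch_perturbGrad`).

Three facts make the energy converge to the right bound. First, the cell problem is quadratic and
decouples into the three rows of ξ; for one row it asks for the L² distance from a constant
horizontal vector to the space of corrector gradients. Orthogonal projection is linear, so two
correctors are almost optimal for all ξ at once (`exists_correctors`), and truncation makes them
bounded.

Second, the cell problem ignores the sphere constraint, yet projecting costs nothing in the limit.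
Bounded correctors keep the perturbed field within O(ε) of the sphere, and outside the ball of
radius r the differential of π has norm at most 1/r (`norm_fderiv_sphereProj_le`), with r as close
to 1 as desired. No tangency of the correctors is needed.

Third, an averaging inequality replaces two-scale convergence, since only an upper bound is required
(`lintegral_film_le`): translating x' by εt, with t in the unit square, lets the fast variable run
through a full period while the slow one moves by O(ε).

Passing from W back to ∇m₀ rests on a quantitative stability of g_hom (`gHom_le_add`). For a fixed
tolerance these bounds combine in `eventually_exists_competitor`; letting the tolerance vanish is
the abstract selection `exists_diagonal_family`. -/

namespace RoughFilm

/-! ### Weak gradients of scalar functions: linearity, locality, product rule. -/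

section

/-- The standard basis vectors of `ℝᵈ`. -/
noncomputable abbrev basisVec {d : ℕ} (j : Fin d) : E d := EuclideanSpace.single j 1

/-- The classical gradient of a scalar function. -/
noncomputable def classicalGrad {d : ℕ} (η : E d → ℝ) (x : E d) : E d :=
  WithLp.toLp 2 fun j => fderiv ℝ η x (basisVec j)

@[simp] lemma classicalGrad_apply {d : ℕ} (η : E d → ℝ) (x : E d) (j : Fin d) :
    classicalGrad η x j = fderiv ℝ η x (basisVec j) := rfl

lemma continuous_classicalGrad {d : ℕ} {η : E d → ℝ} (hη : ContDiff ℝ 1 η) :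
    Continuous (classicalGrad η) := by
  unfold classicalGrad
  have : Continuous fun x => fun j => fderiv ℝ η x (basisVec j) :=
    continuous_pi fun j => (hη.continuous_fderiv one_ne_zero).clm_apply continuous_const
  exact (PiLp.continuous_toLp 2 _).comp this

/-- The scalar function `u` has the weak gradient `g` on `U`; both are locally integrable. -/
structure WeakGrad {d : ℕ} (U : Set (E d)) (u : E d → ℝ) (g : E d → E d) : Prop where
  locInt : LocallyIntegrableOn u U
  locInt_grad : LocallyIntegrableOn g U
  eq : ∀ ψ : E d → ℝ, ContDiff ℝ (⊤ : ℕ∞) ψ → HasCompactSupport ψ → tsupport ψ ⊆ U →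
    ∀ j : Fin d, ∫ x, u x * fderiv ℝ ψ x (basisVec j) = - ∫ x, g x j * ψ x

/-- The integrals in `WeakGrad` run over all of ℝᵈ although nothing is assumed about u outside U.
The test function vanishes off a compact subset of U, which makes these integrals meaningful. -/
lemma integrable_mul_of_locallyIntegrableOn {d : ℕ} {U : Set (E d)} {u ψ : E d → ℝ}
    (hu : LocallyIntegrableOn u U) (hψ : Continuous ψ) (hc : HasCompactSupport ψ)
    (hs : tsupport ψ ⊆ U) : Integrable fun x => u x * ψ x := by
  have h1 : IntegrableOn (fun x => u x * ψ x) (tsupport ψ) :=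
    (hu.integrableOn_compact_subset hs hc).mul_continuousOn hψ.continuousOn hc
  rwa [integrableOn_iff_integrable_of_support_subset] at h1
  intro x hx
  apply subset_tsupport
  simp only [Function.mem_support] at hx ⊢
  exact fun h => hx (by simp [h])

lemma tsupport_fderiv_apply_subset' {d : ℕ} (ψ : E d → ℝ) (v : E d) :
    tsupport (fun x => fderiv ℝ ψ x v) ⊆ tsupport ψ :=
  tsupport_fderiv_apply_subset ℝ v

lemma _root_.MeasureTheory.LocallyIntegrableOn.coord {d : ℕ} {U : Set (E d)} {n : ℕ}
    {g : E d → E n} (hg : LocallyIntegrableOn g U) (j : Fin n) :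
    LocallyIntegrableOn (fun x => g x j) U := by
  intro x hx
  obtain ⟨s, hs, hi⟩ := hg x hx
  exact ⟨s, hs, (EuclideanSpace.proj (𝕜 := ℝ) j : E n →L[ℝ] ℝ).integrable_comp hi⟩

lemma locallyIntegrableOn_of_coord {d : ℕ} {U : Set (E d)} (hU : IsOpen U) {n : ℕ}
    {g : E d → E n} (hg : ∀ j, LocallyIntegrableOn (fun x => g x j) U) :
    LocallyIntegrableOn g U := by
  rw [locallyIntegrableOn_iff hU.isLocallyClosed]
  intro k hk hc
  have : ∀ j, IntegrableOn (fun x => g x j) k := fun j =>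
    (hg j).integrableOn_compact_subset hk hc
  have h2 : g = fun x => ∑ j, (g x j) • (basisVec j : E n) := by
    ext x i
    simp [Finset.sum_apply, Pi.single_apply]
  rw [h2]
  exact integrable_finsetSum _ fun j _ => (this j).smul_const _

namespace WeakGrad

variable {d : ℕ} {U V : Set (E d)} {u v : E d → ℝ} {g h : E d → E d}

lemma integrable_mul_fderiv (hu : WeakGrad U u g) {ψ : E d → ℝ} (hψ : ContDiff ℝ (⊤ : ℕ∞) ψ)
    (hc : HasCompactSupport ψ) (hs : tsupport ψ ⊆ U) (j : Fin d) :
    Integrable fun x => u x * fderiv ℝ ψ x (basisVec j) :=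
  integrable_mul_of_locallyIntegrableOn hu.locInt
    ((hψ.continuous_fderiv (by simp)).clm_apply continuous_const)
    (hc.fderiv_apply ℝ _) ((tsupport_fderiv_apply_subset' ψ _).trans hs)

lemma integrable_grad_mul (hu : WeakGrad U u g) {ψ : E d → ℝ} (hψ : Continuous ψ)
    (hc : HasCompactSupport ψ) (hs : tsupport ψ ⊆ U) (j : Fin d) :
    Integrable fun x => g x j * ψ x :=
  integrable_mul_of_locallyIntegrableOn (hu.locInt_grad.coord j) hψ hc hs

lemma mono (hu : WeakGrad U u g) (hV : V ⊆ U) : WeakGrad V u g :=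
  ⟨hu.locInt.mono_set hV, hu.locInt_grad.mono_set hV,
    fun ψ h1 h2 h3 => hu.eq ψ h1 h2 (h3.trans hV)⟩

lemma add (hu : WeakGrad U u g) (hv : WeakGrad U v h) :
    WeakGrad U (fun x => u x + v x) (fun x => g x + h x) := by
  refine ⟨hu.locInt.add hv.locInt, hu.locInt_grad.add hv.locInt_grad, fun ψ h1 h2 h3 j => ?_⟩
  simp only [PiLp.add_apply, add_mul]
  rw [integral_add (hu.integrable_mul_fderiv h1 h2 h3 j) (hv.integrable_mul_fderiv h1 h2 h3 j),
    integral_add (hu.integrable_grad_mul h1.continuous h2 h3 j)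
      (hv.integrable_grad_mul h1.continuous h2 h3 j), hu.eq ψ h1 h2 h3, hv.eq ψ h1 h2 h3]
  ring

lemma const_mul (hu : WeakGrad U u g) (c : ℝ) :
    WeakGrad U (fun x => c * u x) (fun x => c • g x) := by
  refine ⟨hu.locInt.smul c, hu.locInt_grad.smul c, fun ψ h1 h2 h3 j => ?_⟩
  simp only [PiLp.smul_apply, smul_eq_mul, mul_assoc]
  rw [integral_const_mul, integral_const_mul, hu.eq ψ h1 h2 h3]
  ring

lemma zero : WeakGrad U (fun _ => 0) (fun _ => 0) :=
  ⟨locallyIntegrableOn_zero, locallyIntegrableOn_zero, by simp⟩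

lemma sum {ι : Type*} (s : Finset ι) {u : ι → E d → ℝ} {g : ι → E d → E d}
    (hu : ∀ i ∈ s, WeakGrad U (u i) (g i)) :
    WeakGrad U (fun x => ∑ i ∈ s, u i x) (fun x => ∑ i ∈ s, g i x) := by
  classical
  induction s using Finset.induction_on with
  | empty => simpa using zero
  | insert a s ha ih =>
    simp only [Finset.sum_insert ha]
    exact (hu a (by simp)).add (ih fun i hi => hu i (by simp [hi]))

lemma congr_ae (hu : WeakGrad U u g) (hU : MeasurableSet U) (h1 : u =ᵐ[volume.restrict U] v)
    (h2 : g =ᵐ[volume.restrict U] h) : WeakGrad U v h := by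
  have key : ∀ {F : Type} [NormedAddCommGroup F] {a b : E d → F},
      LocallyIntegrableOn a U → a =ᵐ[volume.restrict U] b → LocallyIntegrableOn b U := by
    intro F _ a b ha hab x hx
    obtain ⟨s, hs, hi⟩ := ha x hx
    -- The two functions agree only almost everywhere on U, so the neighbourhood is cut down to U.
    refine ⟨s ∩ U, inter_mem hs self_mem_nhdsWithin, ?_⟩
    exact (hi.mono_set Set.inter_subset_left).congr
      (ae_mono (Measure.restrict_mono Set.inter_subset_right le_rfl) hab)
  rw [Filter.EventuallyEq, ae_restrict_iff' hU] at h1 h2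
  refine ⟨key hu.locInt ((ae_restrict_iff' hU).2 h1),
    key hu.locInt_grad ((ae_restrict_iff' hU).2 h2), fun ψ hψ hc hs j => ?_⟩
  have e1 : ∫ x, v x * fderiv ℝ ψ x (basisVec j) = ∫ x, u x * fderiv ℝ ψ x (basisVec j) := by
    refine integral_congr_ae (h1.mono fun x hx => ?_)
    by_cases hxU : x ∈ U
    · simp [hx hxU]
    · have : fderiv ℝ ψ x (basisVec j) = 0 :=
        image_eq_zero_of_notMem_tsupport (f := fun x => fderiv ℝ ψ x (basisVec j))
          fun h' => hxU (hs (tsupport_fderiv_apply_subset' ψ _ h'))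
      simp [this]
  have e2 : ∫ x, h x j * ψ x = ∫ x, g x j * ψ x := by
    refine integral_congr_ae (h2.mono fun x hx => ?_)
    by_cases hxU : x ∈ U
    · simp [hx hxU]
    · have : ψ x = 0 := image_eq_zero_of_notMem_tsupport fun h' => hxU (hs h')
      simp [this]
  rw [e1, e2, hu.eq ψ hψ hc hs]

/-- Testing u against η ψ and expanding the derivative gives the product rule. The factor η needs no
bounds, since ψ localizes it. -/
lemma mul_smooth (hu : WeakGrad U u g) (hU : IsOpen U) {η : E d → ℝ}
    (hη : ContDiff ℝ (⊤ : ℕ∞) η) :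
    WeakGrad U (fun x => u x * η x) (fun x => η x • g x + u x • classicalGrad η x) := by
  have hη1 : ContDiff ℝ 1 η := hη.of_le (by exact_mod_cast le_top)
  have hcg := continuous_classicalGrad hη1
  have l1 : LocallyIntegrableOn (fun x => u x * η x) U :=
    hu.locInt.mul_continuousOn hη.continuous.continuousOn hU.isLocallyClosed
  refine ⟨l1, ?_, fun ψ h1 h2 h3 j => ?_⟩
  · refine LocallyIntegrableOn.add ?_ ?_
    · exact hu.locInt_grad.continuousOn_smul hU.isLocallyClosed hη.continuous.continuousOn
    · exact hu.locInt.smul_continuousOn hU.isLocallyClosed hcg.continuousOn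
  · have hs' : tsupport (fun x => η x * ψ x) ⊆ tsupport ψ := tsupport_mul_subset_right
    have hc' : HasCompactSupport (fun x => η x * ψ x) := h2.mul_left
    have key := hu.eq (fun x => η x * ψ x) (hη.mul h1) hc' (hs'.trans h3) j
    have hd : ∀ x, fderiv ℝ (fun x => η x * ψ x) x (basisVec j)
        = η x * fderiv ℝ ψ x (basisVec j) + ψ x * fderiv ℝ η x (basisVec j) := by
      intro x
      rw [fderiv_fun_mul (hη1.differentiable one_ne_zero x)
        (h1.differentiable (by simp) x)]
      simp
    simp only [hd, mul_add] at key
    have i1 : Integrable fun x => u x * (η x * fderiv ℝ ψ x (basisVec j)) := by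
      refine integrable_mul_of_locallyIntegrableOn hu.locInt (hη.continuous.mul
        ((h1.continuous_fderiv (by simp)).clm_apply continuous_const))
        (hc := (h2.fderiv_apply ℝ _).mul_left) ?_
      exact (tsupport_mul_subset_right.trans (tsupport_fderiv_apply_subset' ψ _)).trans h3
    have i2 : Integrable fun x => u x * (ψ x * fderiv ℝ η x (basisVec j)) := by
      refine integrable_mul_of_locallyIntegrableOn hu.locInt (h1.continuous.mul
        ((hη.continuous_fderiv (by simp)).clm_apply continuous_const))
        (hc := h2.mul_right) ?_
      exact tsupport_mul_subset_left.trans h3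
    have i3 : Integrable fun x => g x j * (η x * ψ x) :=
      hu.integrable_grad_mul (hη.continuous.mul h1.continuous) hc' (hs'.trans h3) j
    rw [integral_add i1 i2] at key
    have e1 : ∫ x, u x * η x * fderiv ℝ ψ x (basisVec j)
        = ∫ x, u x * (η x * fderiv ℝ ψ x (basisVec j)) := by simp only [mul_assoc]
    have e2 : ∫ x, (η x • g x + u x • classicalGrad η x) j * ψ x
        = (∫ x, g x j * (η x * ψ x)) + ∫ x, u x * (ψ x * fderiv ℝ η x (basisVec j)) := by
      rw [← integral_add i3 i2]
      congr 1
      ext x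
      simp
      ring
    rw [e1, e2]
    linarith

end WeakGrad

/-- The row `i` of a matrix as a vector. -/
def rowVec {n d : ℕ} (G : E d → Matrix (Fin 3) (Fin n) ℝ) (i : Fin 3) (x : E d) : E n :=
  WithLp.toLp 2 (G x i)

@[simp] lemma rowVec_apply {n d : ℕ} (G : E d → Matrix (Fin 3) (Fin n) ℝ) (i : Fin 3) (x : E d)
    (j : Fin n) : rowVec G i x j = G x i j := rfl

lemma setIntegral_eq_integral_of_tsupport {d : ℕ} {U : Set (E d)} {ψ : E d → ℝ}
    (hs : tsupport ψ ⊆ U) (a : E d → ℝ) : ∫ x in U, a x * ψ x = ∫ x, a x * ψ x := by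
  refine setIntegral_eq_integral_of_forall_compl_eq_zero fun x hx => ?_
  rw [image_eq_zero_of_notMem_tsupport fun h => hx (hs h), mul_zero]

lemma WeakGrad.hasWeakGradient {d : ℕ} {U : Set (E d)} {u : E d → E 3}
    {G : E d → Matrix (Fin 3) (Fin d) ℝ} (h : ∀ i, WeakGrad U (fun x => u x i) (rowVec G i)) :
    HasWeakGradient U u G := by
  intro ψ h1 h2 h3 i j
  rw [setIntegral_eq_integral_of_tsupport h3, setIntegral_eq_integral_of_tsupport
    ((tsupport_fderiv_apply_subset' ψ _).trans h3)]
  exact (h i).eq ψ h1 h2 h3 j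

lemma HasWeakGradient.weakGrad {d : ℕ} {U : Set (E d)} {u : E d → E 3}
    {G : E d → Matrix (Fin 3) (Fin d) ℝ} (h : HasWeakGradient U u G) (i : Fin 3)
    (hu : LocallyIntegrableOn (fun x => u x i) U) (hG : LocallyIntegrableOn (rowVec G i) U) :
    WeakGrad U (fun x => u x i) (rowVec G i) := by
  refine ⟨hu, hG, fun ψ h1 h2 h3 j => ?_⟩
  have := h ψ h1 h2 h3 i j
  rwa [setIntegral_eq_integral_of_tsupport h3, setIntegral_eq_integral_of_tsupport
    ((tsupport_fderiv_apply_subset' ψ _).trans h3)] at this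

end

/-! ### Continuity of translations in L¹ and mollification. -/

section

/-- Translation is continuous in `L¹`. -/
lemma exists_lintegral_translate_le {d : ℕ} {f : E d → ℝ} (hf : Integrable f) {δ : ℝ≥0∞}
    (hδ : δ ≠ 0) :
    ∃ r : ℝ, 0 < r ∧ ∀ t : E d, ‖t‖ < r → ∫⁻ x, ‖f (x - t) - f x‖ₑ ≤ δ := by
  wlog hfin : δ ≠ ∞ generalizing δ
  · obtain ⟨r, hr, h⟩ := this one_ne_zero ENNReal.one_ne_top
    exact ⟨r, hr, fun t ht => (h t ht).trans (by simp at hfin; simp [hfin])⟩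
  have h3 : δ / 3 ≠ 0 := by simp [hδ]
  obtain ⟨g, hgc, hgapp, hg, -⟩ := (memLp_one_iff_integrable.2 hf).exists_hasCompactSupport_eLpNorm_sub_le
    ENNReal.one_ne_top h3
  rw [eLpNorm_one_eq_lintegral_enorm] at hgapp
  have huc : UniformContinuous g := hgc.uniformContinuous_of_continuous hg
  set K := Metric.cthickening 1 (tsupport g)
  have hK : IsCompact K := hgc.isCompact.cthickening
  have hm : volume K ≠ ∞ := hK.measure_lt_top.ne
  obtain ⟨c, hc0, hc⟩ : ∃ c : ℝ≥0, 0 < c ∧ c * volume K ≤ δ / 3 := by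
    obtain ⟨c, hc0, hc⟩ := ENNReal.exists_nnreal_pos_mul_lt hm h3
    exact ⟨c, hc0, hc.le⟩
  obtain ⟨r, hr, h⟩ := Metric.uniformContinuous_iff.1 huc c (by exact_mod_cast hc0)
  -- Shifts shorter than 1 keep the support of g inside K, a set of finite volume on which uniform
  -- continuity yields an integral bound.
  refine ⟨min r 1, by positivity, fun t ht => ?_⟩
  have hr1 : ‖t‖ < r := ht.trans_le (min_le_left _ _)
  have ht1 : ‖t‖ < 1 := ht.trans_le (min_le_right _ _)
  have hgt : ∫⁻ x, ‖g (x - t) - g x‖ₑ ≤ δ / 3 := by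
    refine le_trans ?_ hc
    rw [← setLIntegral_const]
    rw [← lintegral_indicator hK.measurableSet]
    refine lintegral_mono fun x => ?_
    by_cases hx : x ∈ K
    · simp only [Set.indicator_of_mem hx]
      have := h (a := x - t) (b := x) (by simpa [dist_eq_norm] using hr1)
      rw [dist_eq_norm] at this
      rw [← ofReal_norm, ← ENNReal.ofReal_coe_nnreal]
      exact ENNReal.ofReal_le_ofReal this.le
    · have h1 : g x = 0 := image_eq_zero_of_notMem_tsupport fun h' =>
        hx (Metric.self_subset_cthickening _ h')
      have h2 : g (x - t) = 0 := image_eq_zero_of_notMem_tsupport fun h' =>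
        hx (Metric.mem_cthickening_of_dist_le x (x - t) 1 _ h' (by
          simpa [dist_eq_norm] using ht1.le))
      simp [h1, h2]
  have hmg : AEMeasurable (fun x => ‖(f - g) x‖ₑ) :=
    (hf.aestronglyMeasurable.sub hg.aestronglyMeasurable).enorm
  have htr : ∫⁻ x, ‖(f - g) (x - t)‖ₑ ≤ δ / 3 := by
    rw [lintegral_sub_right_eq_self (fun x => ‖(f - g) x‖ₑ) t]
    exact hgapp
  calc ∫⁻ x, ‖f (x - t) - f x‖ₑ
      ≤ ∫⁻ x, (‖(f - g) (x - t)‖ₑ + ‖g (x - t) - g x‖ₑ) + ‖(f - g) x‖ₑ := by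
        refine lintegral_mono fun x => ?_
        have : f (x - t) - f x = ((f - g) (x - t) + (g (x - t) - g x)) - (f - g) x := by
          simp only [Pi.sub_apply]; ring
        rw [this]
        exact (enorm_sub_le).trans (add_le_add_left (enorm_add_le _ _) _)
    _ = (∫⁻ x, ‖(f - g) (x - t)‖ₑ + ‖g (x - t) - g x‖ₑ) + ∫⁻ x, ‖(f - g) x‖ₑ :=
        lintegral_add_right' _ hmg
    _ = ((∫⁻ x, ‖(f - g) (x - t)‖ₑ) + ∫⁻ x, ‖g (x - t) - g x‖ₑ) + ∫⁻ x, ‖(f - g) x‖ₑ := by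
        rw [lintegral_add_right]
        exact ((hg.comp (continuous_id.sub continuous_const)).sub hg).enorm.measurable
    _ ≤ (δ / 3 + δ / 3) + δ / 3 := by gcongr
    _ = δ := ENNReal.add_thirds δ

/-- A fixed sequence of bump functions shrinking to the origin. -/
noncomputable def bumpSeq (d n : ℕ) : ContDiffBump (0 : E d) :=
  -- The fixed ratio 2 of the radii is what the almost everywhere convergence in
  -- `ae_tendsto_mollify` relies on.
  ⟨1 / (n + 1) / 2, 1 / (n + 1), by positivity, half_lt_self (by positivity)⟩

lemma tendsto_bumpSeq_rOut (d : ℕ) : Tendsto (fun n => (bumpSeq d n).rOut) atTop (𝓝 0) :=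
  tendsto_one_div_add_atTop_nhds_zero_nat

/-- Mollification of a scalar function. -/
noncomputable def mollify {d : ℕ} (n : ℕ) (f : E d → ℝ) : E d → ℝ :=
  convolution ((bumpSeq d n).normed volume) f (ContinuousLinearMap.lsmul ℝ ℝ) volume

lemma mollify_apply {d : ℕ} (n : ℕ) (f : E d → ℝ) (x : E d) :
    mollify n f x = ∫ t, (bumpSeq d n).normed volume t * f (x - t) := rfl

lemma contDiff_mollify {d : ℕ} (n : ℕ) {f : E d → ℝ} (hf : LocallyIntegrable f) :
    ContDiff ℝ (⊤ : ℕ∞) (mollify n f) :=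
  (bumpSeq d n).hasCompactSupport_normed.contDiff_convolution_left _
    (bumpSeq d n).contDiff_normed hf

lemma ae_tendsto_mollify {d : ℕ} {f : E d → ℝ} (hf : LocallyIntegrable f) :
    ∀ᵐ x, Tendsto (fun n => mollify n f x) atTop (𝓝 (f x)) := by
  refine ContDiffBump.ae_convolution_tendsto_right_of_locallyIntegrable (K := 2)
    (tendsto_bumpSeq_rOut d) (Eventually.of_forall fun n => ?_) hf
  simp only [bumpSeq]
  linarith

/-- A mollification is an average of translates by short vectors. By Tonelli its L¹ error is at most
the average of the translation errors. -/
lemma tendsto_lintegral_mollify_sub {d : ℕ} {f : E d → ℝ} (hf : Integrable f) :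
    Tendsto (fun n => ∫⁻ x, ‖mollify n f x - f x‖ₑ) atTop (𝓝 0) := by
  rw [ENNReal.tendsto_nhds_zero]
  intro δ hδ
  obtain ⟨r, hr, h⟩ := exists_lintegral_translate_le hf hδ.ne'
  filter_upwards [(tendsto_bumpSeq_rOut d).eventually_lt_const hr] with n hn
  set ρ := (bumpSeq d n).normed (volume : Measure (E d)) with hρ
  have hρc : Continuous ρ := (bumpSeq d n).continuous_normed
  have hρ0 : ∀ t, 0 ≤ ρ t := (bumpSeq d n).nonneg_normed
  have hρi : ∫ t, ρ t = 1 := (bumpSeq d n).integral_normed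
  have hρint : Integrable ρ := (bumpSeq d n).integrable_normed
  have hρl : ∫⁻ t, ‖ρ t‖ₑ = 1 := by
    rw [← ofReal_integral_norm_eq_lintegral_enorm hρint]
    simp only [Real.norm_of_nonneg (hρ0 _), hρi, ENNReal.ofReal_one]
  have hconv : ∀ x, Integrable fun t => ρ t * f (x - t) := fun x =>
    ((bumpSeq d n).hasCompactSupport_normed).convolutionExists_left
      (ContinuousLinearMap.lsmul ℝ ℝ) hρc hf.locallyIntegrable x
  have hmeas : AEMeasurable (Function.uncurry fun (x t : E d) => ‖ρ t‖ₑ * ‖f (x - t) - f x‖ₑ)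
      (volume.prod volume) := by
    have a1 : AEStronglyMeasurable (fun p : E d × E d => f (p.1 - p.2)) (volume.prod volume) :=
      hf.aestronglyMeasurable.comp_quasiMeasurePreserving
        (quasiMeasurePreserving_sub_of_right_invariant volume volume)
    have a2 : AEStronglyMeasurable (fun p : E d × E d => f p.1) (volume.prod volume) :=
      hf.aestronglyMeasurable.comp_fst
    exact ((hρc.comp continuous_snd).enorm.measurable.aemeasurable).mul (a1.sub a2).enorm
  calc ∫⁻ x, ‖mollify n f x - f x‖ₑ
      ≤ ∫⁻ x, ∫⁻ t, ‖ρ t‖ₑ * ‖f (x - t) - f x‖ₑ := by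
        refine lintegral_mono fun x => ?_
        have e : mollify n f x - f x = ∫ t, ρ t * (f (x - t) - f x) := by
          simp only [mul_sub]
          rw [integral_sub (hconv x) (hρint.mul_const _), integral_mul_const, hρi, one_mul,
            mollify_apply]
        rw [e]
        refine (enorm_integral_le_lintegral_enorm _).trans (le_of_eq ?_)
        simp only [enorm_mul]
    _ = ∫⁻ t, ∫⁻ x, ‖ρ t‖ₑ * ‖f (x - t) - f x‖ₑ := lintegral_lintegral_swap hmeas
    _ = ∫⁻ t, ‖ρ t‖ₑ * ∫⁻ x, ‖f (x - t) - f x‖ₑ := by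
        refine lintegral_congr fun t => lintegral_const_mul' _ _ (by simp)
    _ ≤ ∫⁻ t, ‖ρ t‖ₑ * δ := by
        refine lintegral_mono fun t => ?_
        by_cases ht : ‖t‖ < r
        · have := h t ht
          gcongr
        · have : ρ t = 0 := by
            by_contra h0
            have : t ∈ Function.support ρ := h0
            rw [hρ, ContDiffBump.support_normed_eq] at this
            exact ht ((mem_ball_zero_iff.1 this).trans hn)
          simp [this]
    _ = δ := by rw [lintegral_mul_const _ hρc.enorm.measurable, hρl, one_mul]

end

/-! ### The chain rule for weak gradients. -/

section

/-- Put the derivative on the kernel: y ↦ ρ(x - y) is a test function supported in K as soon as the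
ball around x lies in K, so the definition of the weak gradient applies to it. The indicator of K
makes u globally integrable and is invisible to this kernel. -/
lemma fderiv_mollify_apply {d : ℕ} {U K : Set (E d)} {u : E d → ℝ} {g : E d → E d}
    (hu : WeakGrad U u g) (hK : IsCompact K) (hKU : K ⊆ U) (n : ℕ) {x : E d}
    (hx : Metric.closedBall x (bumpSeq d n).rOut ⊆ K) (j : Fin d) :
    fderiv ℝ (mollify n (K.indicator u)) x (basisVec j)
      = mollify n (K.indicator fun y => g y j) x := by
  set ρ := (bumpSeq d n).normed (volume : Measure (E d)) with hρ
  have hρs : ContDiff ℝ (⊤ : ℕ∞) ρ := (bumpSeq d n).contDiff_normed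
  have hρ1 : ContDiff ℝ 1 ρ := hρs.of_le (by exact_mod_cast le_top)
  have hρc : HasCompactSupport ρ := (bumpSeq d n).hasCompactSupport_normed
  have hli : LocallyIntegrable (K.indicator u) :=
    ((integrable_indicator_iff hK.measurableSet).2
      (hu.locInt.integrableOn_compact_subset hKU hK)).locallyIntegrable
  have hsupp : ∀ y, y ∉ K → x - y ∉ tsupport ρ := by
    intro y hy h
    rw [hρ, (bumpSeq d n).tsupport_normed_eq, mem_closedBall_zero_iff] at h
    exact hy (hx (by rwa [Metric.mem_closedBall, dist_comm, dist_eq_norm]))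
  have h1 : fderiv ℝ (mollify n (K.indicator u)) x (basisVec j)
      = ∫ t, fderiv ℝ ρ t (basisVec j) * K.indicator u (x - t) := by
    rw [mollify, (hρc.hasFDerivAt_convolution_left (ContinuousLinearMap.lsmul ℝ ℝ) hρ1 hli x).fderiv,
      convolution_def]
    rw [ContinuousLinearMap.integral_apply]
    · simp [ContinuousLinearMap.precompL_apply]
    · exact (hρc.fderiv ℝ).convolutionExists_left _ (hρ1.continuous_fderiv one_ne_zero) hli x
  set ψ : E d → ℝ := fun y => ρ (x - y) with hψ
  have hψs : ContDiff ℝ (⊤ : ℕ∞) ψ := hρs.comp (contDiff_const.sub contDiff_id)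
  have hψt : tsupport ψ ⊆ K := by
    refine closure_minimal (fun y hy => ?_) hK.isClosed
    by_contra hyK
    exact hy (image_eq_zero_of_notMem_tsupport (f := ρ) (hsupp y hyK))
  have hψc : HasCompactSupport ψ := HasCompactSupport.of_support_subset_isCompact hK
    ((subset_tsupport _).trans hψt)
  have hψd : ∀ y, fderiv ℝ ψ y (basisVec j) = - fderiv ℝ ρ (x - y) (basisVec j) := by
    intro y
    have : HasFDerivAt ψ ((fderiv ℝ ρ (x - y)).comp (-ContinuousLinearMap.id ℝ (E d))) y := by
      refine (hρ1.differentiable one_ne_zero (x - y)).hasFDerivAt.comp y ?_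
      exact (hasFDerivAt_id y).const_sub x
    rw [this.fderiv]
    simp
  have key := hu.eq ψ hψs hψc (hψt.trans hKU) j
  have h2 : ∫ t, fderiv ℝ ρ t (basisVec j) * K.indicator u (x - t)
      = ∫ y, fderiv ℝ ρ (x - y) (basisVec j) * K.indicator u y := by
    rw [← integral_sub_left_eq_self _ volume x]
    simp
  have h3 : mollify n (K.indicator fun y => g y j) x
      = ∫ y, ρ (x - y) * K.indicator (fun y => g y j) y := by
    rw [mollify_apply, ← integral_sub_left_eq_self _ volume x]
    simp [hρ]
  rw [h1, h2, h3]
  have e1 : ∀ y, fderiv ℝ ρ (x - y) (basisVec j) * K.indicator u y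
      = - (u y * fderiv ℝ ψ y (basisVec j)) := by
    intro y
    rw [hψd]
    by_cases hy : y ∈ K
    · simp [hy]; ring
    · have : fderiv ℝ ρ (x - y) (basisVec j) = 0 :=
        image_eq_zero_of_notMem_tsupport (f := fun x => fderiv ℝ ρ x (basisVec j))
          fun h' => hsupp y hy (tsupport_fderiv_apply_subset' _ _ h')
      simp [this]
  have e2 : ∀ y, ρ (x - y) * K.indicator (fun y => g y j) y = g y j * ψ y := by
    intro y
    by_cases hy : y ∈ K
    · simp [hy, hψ]; ring
    · have : ρ (x - y) = 0 := image_eq_zero_of_notMem_tsupport (hsupp y hy)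
      simp [this, hψ]
  simp only [e1, e2, integral_neg, key, neg_neg]

/-- Write aₙbₙ = aₙb₀ + aₙ(bₙ - b₀): dominated convergence handles the first term, the uniform bound
on aₙ the second. -/
lemma tendsto_integral_mul_of_bounded {α : Type*} [MeasurableSpace α] {μ : Measure α}
    {a : ℕ → α → ℝ} {a₀ : α → ℝ} {b : ℕ → α → ℝ} {b₀ : α → ℝ} {C : ℝ}
    (ham : ∀ n, AEStronglyMeasurable (a n) μ) (ha : ∀ n x, ‖a n x‖ ≤ C)
    (hlim : ∀ᵐ x ∂μ, Tendsto (fun n => a n x) atTop (𝓝 (a₀ x)))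
    (hb : ∀ n, Integrable (b n) μ) (hb₀ : Integrable b₀ μ)
    (hbl : Tendsto (fun n => ∫⁻ x, ‖b n x - b₀ x‖ₑ ∂μ) atTop (𝓝 0)) :
    Tendsto (fun n => ∫ x, a n x * b n x ∂μ) atTop (𝓝 (∫ x, a₀ x * b₀ x ∂μ)) := by
  have h1 : Tendsto (fun n => ∫ x, a n x * b₀ x ∂μ) atTop (𝓝 (∫ x, a₀ x * b₀ x ∂μ)) := by
    refine tendsto_integral_of_dominated_convergence (fun x => C * ‖b₀ x‖)
      (fun n => (ham n).mul hb₀.aestronglyMeasurable) (hb₀.norm.const_mul C) (fun n => ?_) ?_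
    · refine Eventually.of_forall fun x => ?_
      rw [norm_mul]
      exact mul_le_mul_of_nonneg_right (ha n x) (norm_nonneg _)
    · filter_upwards [hlim] with x hx using hx.mul_const _
  have hab : ∀ n (c : α → ℝ), Integrable c μ → Integrable (fun x => a n x * c x) μ :=
    fun n c hc => hc.bdd_mul (ham n) (Eventually.of_forall (ha n))
  have h2 : Tendsto (fun n => ∫ x, a n x * (b n x - b₀ x) ∂μ) atTop (𝓝 0) := by
    have : (0 : ℝ) = ∫ x, (fun _ => (0 : ℝ)) x ∂μ := by simp
    rw [this]
    refine tendsto_integral_of_L1 _ (by fun_prop)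
      (Eventually.of_forall fun n => hab n _ ((hb n).sub hb₀)) ?_
    have h0 : Tendsto (fun n => ENNReal.ofReal C * ∫⁻ x, ‖b n x - b₀ x‖ₑ ∂μ) atTop (𝓝 0) := by
      simpa using ENNReal.Tendsto.const_mul hbl (Or.inr ENNReal.ofReal_ne_top)
    refine tendsto_of_tendsto_of_tendsto_of_le_of_le tendsto_const_nhds h0 (fun n => zero_le)
      fun n => ?_
    simp only
    rw [← lintegral_const_mul' _ _ ENNReal.ofReal_ne_top]
    refine lintegral_mono fun x => ?_
    simp only [sub_zero, enorm_mul]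
    gcongr
    rw [← ofReal_norm]
    exact ENNReal.ofReal_le_ofReal (ha n x)
  have := h1.add h2
  rw [add_zero] at this
  refine this.congr fun n => ?_
  have h3 : Integrable (fun x => a n x * (b n x - b₀ x)) μ := hab n _ ((hb n).sub hb₀)
  rw [← integral_add (hab n _ hb₀) h3]
  congr 1
  ext x
  ring

/-- Chain rule for weak gradients, for outer functions of class `C¹` with bounded derivative. -/
lemma WeakGrad.comp {d n : ℕ} {U : Set (E d)} (hU : IsOpen U) {u : E d → E n}
    {g : Fin n → E d → E d} (hu : ∀ k, WeakGrad U (fun x => u x k) (g k)) {F : E n → ℝ}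
    (hF : ContDiff ℝ 1 F) {C : ℝ≥0} (hC : ∀ z, ‖fderiv ℝ F z‖ ≤ C) :
    WeakGrad U (fun x => F (u x)) (fun x => ∑ k, fderiv ℝ F (u x) (basisVec k) • g k x) := by
  have hLip : LipschitzWith C F :=
    lipschitzWith_of_nnnorm_fderiv_le (hF.differentiable one_ne_zero) fun z => hC z
  have huv : LocallyIntegrableOn u U := locallyIntegrableOn_of_coord hU fun k => (hu k).locInt
  have hdF : Continuous (fderiv ℝ F) := hF.continuous_fderiv one_ne_zero
  have hdFk : ∀ k : Fin n, Continuous fun z => fderiv ℝ F z (basisVec k) := fun k =>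
    hdF.clm_apply continuous_const
  have hbd : ∀ (k : Fin n) z, ‖fderiv ℝ F z (basisVec k)‖ ≤ C := fun k z =>
    ((fderiv ℝ F z).le_opNorm _).trans (by simpa using hC z)
  refine ⟨?_, ?_, fun ψ hψ hc hs j => ?_⟩
  · rw [locallyIntegrableOn_iff hU.isLocallyClosed] at huv ⊢
    intro K hK hKc
    have h := huv K hK hKc
    have : IntegrableOn (fun x => ‖F 0‖ + C * ‖u x‖) K :=
      (integrableOn_const hKc.measure_lt_top.ne).add (h.norm.const_mul _)
    refine this.mono' (hF.continuous.comp_aestronglyMeasurable h.aestronglyMeasurable)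
      (Eventually.of_forall fun x => ?_)
    have := hLip.dist_le_mul (u x) 0
    rw [dist_eq_norm, dist_zero_right] at this
    calc ‖F (u x)‖ = ‖F 0 + (F (u x) - F 0)‖ := by ring_nf
      _ ≤ _ := (norm_add_le _ _).trans (by gcongr)
  · rw [locallyIntegrableOn_iff hU.isLocallyClosed] at huv ⊢
    intro K hK hKc
    refine integrable_finsetSum _ fun k _ => ?_
    exact (((hu k).locInt_grad.integrableOn_compact_subset hK hKc)).bdd_smul (C : ℝ)
      ((hdFk k).comp_aestronglyMeasurable (huv K hK hKc).aestronglyMeasurable)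
      (Eventually.of_forall fun x => hbd k (u x))
  -- Everything takes place near the support of ψ. Cutting u and its gradient off outside a compact
  -- neighbourhood K permits global mollification without changing anything near that support, once
  -- the mollification radius is below r.
  · obtain ⟨r, hr, hrU⟩ := hc.isCompact.exists_cthickening_subset_open hU hs
    set K := Metric.cthickening r (tsupport ψ) with hKdef
    have hK : IsCompact K := hc.isCompact.cthickening
    have hψK : tsupport ψ ⊆ K := Metric.self_subset_cthickening _
    have hψcont := hψ.continuous
    have hdψ : Continuous fun x => fderiv ℝ ψ x (basisVec j) :=
      (hψ.continuous_fderiv (by simp)).clm_apply continuous_const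
    have hdψc : HasCompactSupport fun x => fderiv ℝ ψ x (basisVec j) := hc.fderiv_apply ℝ _
    have hdψs := tsupport_fderiv_apply_subset' ψ (basisVec j)
    set w : Fin n → E d → ℝ := fun k => K.indicator fun x => u x k with hw
    set γ : Fin n → E d → ℝ := fun k => K.indicator fun x => g k x j with hγ
    have hwi : ∀ k, Integrable (w k) := fun k => (integrable_indicator_iff hK.measurableSet).2
      ((hu k).locInt.integrableOn_compact_subset hrU hK)
    have hγi : ∀ k, Integrable (γ k) := fun k => (integrable_indicator_iff hK.measurableSet).2
      (((hu k).locInt_grad.coord j).integrableOn_compact_subset hrU hK)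
    set W : E d → E n := fun x => WithLp.toLp 2 fun k => w k x with hW
    set um : ℕ → E d → E n := fun m x => WithLp.toLp 2 fun k => mollify m (w k) x with hum
    have hums : ∀ m, ContDiff ℝ (⊤ : ℕ∞) (um m) := fun m =>
      contDiff_euclidean.2 fun k => contDiff_mollify m (hwi k).locallyIntegrable
    have hlimW : ∀ᵐ x, Tendsto (fun m => um m x) atTop (𝓝 (W x)) := by
      filter_upwards [ae_all_iff.2 fun k => ae_tendsto_mollify (hwi k).locallyIntegrable] with x hx
      exact ((PiLp.continuous_toLp 2 _).tendsto _).comp (tendsto_pi_nhds.2 hx)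
    have hWu : ∀ x ∈ K, W x = u x := by
      intro x hx
      ext k
      simp [hW, hw, hx]
    have hmollint : ∀ m (f : E d → ℝ), Integrable f → Integrable (mollify m f) := fun m f hf =>
      Integrable.integrable_convolution _ (bumpSeq d m).integrable_normed hf
    obtain ⟨Mψ, hMψ⟩ := hψcont.bounded_above_of_compact_support hc
    obtain ⟨Mdψ, hMdψ⟩ := hdψ.bounded_above_of_compact_support hdψc
    -- convergence of the left-hand sides
    have hL : Tendsto (fun m => ∫ x, F (um m x) * fderiv ℝ ψ x (basisVec j)) atTop
        (𝓝 (∫ x, F (W x) * fderiv ℝ ψ x (basisVec j))) := by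
      have hWm : AEStronglyMeasurable W volume := by
        refine (PiLp.continuous_toLp 2 _).comp_aestronglyMeasurable ?_
        exact (aemeasurable_pi_lambda _ fun k => (hwi k).aestronglyMeasurable.aemeasurable).aestronglyMeasurable
      refine tendsto_integral_of_L1 _ ((hF.continuous.comp_aestronglyMeasurable hWm).mul
        hdψ.aestronglyMeasurable) (Eventually.of_forall fun m => ?_) ?_
      · exact ((hF.continuous.comp (hums m).continuous).mul hdψ).integrable_of_hasCompactSupport
          hdψc.mul_left
      · have hb : ∀ m, ∫⁻ x, ‖F (um m x) * fderiv ℝ ψ x (basisVec j)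
            - F (W x) * fderiv ℝ ψ x (basisVec j)‖ₑ
            ≤ ENNReal.ofReal (C * Mdψ) * ∑ k, ∫⁻ x, ‖mollify m (w k) x - w k x‖ₑ := by
          intro m
          rw [← lintegral_finsetSum', ← lintegral_const_mul' _ _ ENNReal.ofReal_ne_top]
          · refine lintegral_mono fun x => ?_
            have h1 : ‖F (um m x) * fderiv ℝ ψ x (basisVec j)
              - F (W x) * fderiv ℝ ψ x (basisVec j)‖
                ≤ (C * Mdψ) * ∑ k, ‖mollify m (w k) x - w k x‖ := by
              rw [← sub_mul, norm_mul]
              have h2 := hLip.dist_le_mul (um m x) (W x)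
              rw [dist_eq_norm, dist_eq_norm] at h2
              have h3 : ‖um m x - W x‖ ≤ ∑ k, ‖mollify m (w k) x - w k x‖ := by
                have : um m x - W x
                    = ∑ k, (mollify m (w k) x - w k x) • (basisVec k : E n) := by
                  ext i
                  simp [hum, hW, Finset.sum_apply, Pi.single_apply]
                rw [this]
                refine (norm_sum_le _ _).trans (Finset.sum_le_sum fun k _ => ?_)
                simp [norm_smul]
              calc _ ≤ (C * ∑ k, ‖mollify m (w k) x - w k x‖) * Mdψ := by
                    gcongr
                    · exact h2.trans (by gcongr)
                    · exact hMdψ x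
                _ = _ := by ring
            have hM0 : 0 ≤ C * Mdψ := mul_nonneg C.2 ((norm_nonneg _).trans (hMdψ 0))
            calc _ = ENNReal.ofReal ‖F (um m x) * fderiv ℝ ψ x (basisVec j)
                  - F (W x) * fderiv ℝ ψ x (basisVec j)‖ := (ofReal_norm _).symm
              _ ≤ ENNReal.ofReal ((C * Mdψ) * ∑ k, ‖mollify m (w k) x - w k x‖) :=
                ENNReal.ofReal_le_ofReal h1
              _ = _ := by
                rw [ENNReal.ofReal_mul hM0, ENNReal.ofReal_sum_of_nonneg fun _ _ => norm_nonneg _]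
                simp only [ofReal_norm]
          · intro k _
            exact ((hmollint m _ (hwi k)).sub (hwi k)).aestronglyMeasurable.enorm
        refine tendsto_of_tendsto_of_tendsto_of_le_of_le tendsto_const_nhds ?_
          (fun n => zero_le) hb
        have : Tendsto (fun m => ∑ k, ∫⁻ x, ‖mollify m (w k) x - w k x‖ₑ) atTop
            (𝓝 (∑ k : Fin n, 0)) :=
          tendsto_finsetSum _ fun k _ => tendsto_lintegral_mollify_sub (hwi k)
        simpa only [Finset.sum_const_zero, mul_zero] using
          ENNReal.Tendsto.const_mul this (Or.inr (ENNReal.ofReal_ne_top (r := C * Mdψ)))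
    -- The derivatives of F are bounded and converge almost everywhere, the mollified gradients
    -- converge in L¹; neither factor alone would suffice.
    have hR : Tendsto (fun m => - ∑ k, ∫ x, (fderiv ℝ F (um m x) (basisVec k) * ψ x)
          * mollify m (γ k) x) atTop
        (𝓝 (- ∑ k, ∫ x, (fderiv ℝ F (W x) (basisVec k) * ψ x) * γ k x)) := by
      refine (tendsto_finsetSum _ fun k _ => ?_).neg
      refine tendsto_integral_mul_of_bounded (C := C * Mψ)
        (fun m => (((hdFk k).comp (hums m).continuous).mul hψcont).aestronglyMeasurable)
        (fun m x => ?_) ?_ (fun m => hmollint m _ (hγi k)) (hγi k)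
        (tendsto_lintegral_mollify_sub (hγi k))
      · rw [norm_mul]
        exact mul_le_mul (hbd _ _) (hMψ x) (norm_nonneg _) C.2
      · filter_upwards [hlimW] with x hx
        exact (((hdFk k).tendsto _).comp hx).mul_const _
    -- For the smooth approximations this is classical integration by parts together with the
    -- classical chain rule.
    have hLR : ∀ᶠ m in atTop, ∫ x, F (um m x) * fderiv ℝ ψ x (basisVec j)
        = - ∑ k, ∫ x, (fderiv ℝ F (um m x) (basisVec k) * ψ x) * mollify m (γ k) x := by
      filter_upwards [(tendsto_bumpSeq_rOut d).eventually_lt_const hr] with m hm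
      have hFu : ContDiff ℝ 1 fun x => F (um m x) :=
        hF.comp ((hums m).of_le (by exact_mod_cast le_top))
      have hdiff := hFu.differentiable one_ne_zero
      have ibp := integral_mul_fderiv_eq_neg_fderiv_mul_of_integrable (μ := (volume : Measure (E d)))
        (f := fun x => F (um m x)) (g := ψ) (v := basisVec j)
        (((hFu.continuous_fderiv one_ne_zero).clm_apply
          continuous_const).mul hψcont |>.integrable_of_hasCompactSupport hc.mul_left)
        ((hFu.continuous.mul hdψ).integrable_of_hasCompactSupport hdψc.mul_left)
        ((hFu.continuous.mul hψcont).integrable_of_hasCompactSupport hc.mul_left)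
        (fun x _ => hdiff x) (fun x _ => hψ.differentiable (by simp) x)
      rw [ibp, ← integral_finsetSum]
      · congr 2
        ext x
        by_cases hx : x ∈ tsupport ψ
        · have hball : Metric.closedBall x (bumpSeq d m).rOut ⊆ K := fun y hy =>
            Metric.mem_cthickening_of_dist_le y x r _ hx ((Metric.mem_closedBall.1 hy).trans hm.le)
          have h1 : HasFDerivAt (fun x => F (um m x))
              ((fderiv ℝ F (um m x)).comp (fderiv ℝ (um m) x)) x :=
            (hF.differentiable one_ne_zero _).hasFDerivAt.comp x
              ((hums m).differentiable (by simp) x).hasFDerivAt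
          have h2 : fderiv ℝ (um m) x (basisVec j)
              = ∑ k, mollify m (γ k) x • (basisVec k : E n) := by
            ext i
            have h3 : fderiv ℝ (um m) x (basisVec j) i
                = fderiv ℝ (mollify m (w i)) x (basisVec j) := by
              have h4 : HasFDerivAt (fun y => um m y i)
                  ((EuclideanSpace.proj (𝕜 := ℝ) i : E n →L[ℝ] ℝ).comp (fderiv ℝ (um m) x)) x :=
                (EuclideanSpace.proj (𝕜 := ℝ) i : E n →L[ℝ] ℝ).hasFDerivAt.comp x
                  ((hums m).differentiable (by simp) x).hasFDerivAt
              have h5 : (fun y => um m y i) = mollify m (w i) := rfl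
              rw [← h5, h4.fderiv]
              rfl
            rw [h3, hw, fderiv_mollify_apply (hu i) hK hrU m hball j]
            simp [hγ, Finset.sum_apply, Pi.single_apply]
          rw [h1.fderiv, ContinuousLinearMap.comp_apply, h2, map_sum, Finset.sum_mul]
          refine Finset.sum_congr rfl fun k _ => ?_
          simp only [map_smul, smul_eq_mul]
          ring
        · simp [image_eq_zero_of_notMem_tsupport hx]
      · intro k _
        refine (hmollint m _ (hγi k)).bdd_mul (c := C * Mψ)
          (((hdFk k).comp (hums m).continuous).mul hψcont).aestronglyMeasurable
          (Eventually.of_forall fun x => ?_)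
        rw [norm_mul]
        exact mul_le_mul (hbd _ _) (hMψ x) (norm_nonneg _) C.2
    have hfin := tendsto_nhds_unique (hL.congr' hLR) hR
    have e1 : ∫ x, F (u x) * fderiv ℝ ψ x (basisVec j)
        = ∫ x, F (W x) * fderiv ℝ ψ x (basisVec j) := by
      congr 1
      ext x
      by_cases hx : x ∈ tsupport ψ
      · rw [hWu x (hψK hx)]
      · rw [image_eq_zero_of_notMem_tsupport (f := fun x => fderiv ℝ ψ x (basisVec j))
          fun h => hx (hdψs h)]
        simp
    rw [e1, hfin, ← integral_finsetSum]
    · congr 2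
      ext x
      by_cases hx : x ∈ tsupport ψ
      · rw [hWu x (hψK hx)]
        simp [hγ, hψK hx, Finset.sum_mul]
        refine Finset.sum_congr rfl fun k _ => ?_
        ring
      · simp [image_eq_zero_of_notMem_tsupport hx]
    · intro k _
      have hWm : AEStronglyMeasurable W volume := by
        refine (PiLp.continuous_toLp 2 _).comp_aestronglyMeasurable ?_
        exact (aemeasurable_pi_lambda _ fun k => (hwi k).aestronglyMeasurable.aemeasurable).aestronglyMeasurable
      refine (hγi k).bdd_mul (c := C * Mψ) (((hdFk k).comp_aestronglyMeasurable hWm).mul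
        hψcont.aestronglyMeasurable) (Eventually.of_forall fun x => ?_)
      rw [norm_mul]
      exact mul_le_mul (hbd _ _) (hMψ x) (norm_nonneg _) C.2

end

/-! ### The splitting ℝ³ = ℝ² × ℝ, functions of x' alone, diagonal changes of variables. -/

section

/-- The point `(x', s)` of `ℝ³`. -/
noncomputable def join (x : E 2) (s : ℝ) : E 3 := !₂[x 0, x 1, s]

@[simp] lemma join_zero (x : E 2) (s : ℝ) : join x s 0 = x 0 := rfl
@[simp] lemma join_one (x : E 2) (s : ℝ) : join x s 1 = x 1 := rfl
@[simp] lemma join_two (x : E 2) (s : ℝ) : join x s 2 = s := rfl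
@[simp] lemma plane_zero (x : E 3) : plane x 0 = x 0 := rfl
@[simp] lemma plane_one (x : E 3) : plane x 1 = x 1 := rfl

@[simp] lemma plane_join (x : E 2) (s : ℝ) : plane (join x s) = x := by
  ext i; fin_cases i <;> rfl

@[simp] lemma join_plane (x : E 3) : join (plane x) (x 2) = x := by
  ext i; fin_cases i <;> rfl

lemma join_castSucc (x : E 2) (s : ℝ) (j : Fin 2) : join x s j.castSucc = x j := by
  fin_cases j <;> rfl

lemma plane_apply (x : E 3) (j : Fin 2) : plane x j = x j.castSucc := by
  fin_cases j <;> rfl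

lemma plane_add (x y : E 3) : plane (x + y) = plane x + plane y := by
  ext i; fin_cases i <;> rfl

lemma plane_smul (c : ℝ) (x : E 3) : plane (c • x) = c • plane x := by
  ext i; fin_cases i <;> rfl

lemma join_add (x y : E 2) (s t : ℝ) : join (x + y) (s + t) = join x s + join y t := by
  ext i; fin_cases i <;> rfl

lemma join_smul (c : ℝ) (x : E 2) (s : ℝ) : join (c • x) (c * s) = c • join x s := by
  ext i; fin_cases i <;> rfl

lemma plane_single (j : Fin 2) : plane (basisVec j.castSucc) = basisVec j := by
  ext i; fin_cases i <;> fin_cases j <;> simp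

lemma join_basisVec (j : Fin 2) : join (basisVec j) 0 = basisVec j.castSucc := by
  ext i; fin_cases i <;> fin_cases j <;> simp

lemma norm_sq_join (x : E 2) (s : ℝ) : ‖join x s‖ ^ 2 = ‖x‖ ^ 2 + s ^ 2 := by
  simp [EuclideanSpace.norm_sq_eq, Fin.sum_univ_three, Fin.sum_univ_two]

/-- The embedding of `ℝ²` in `ℝ³` as a continuous linear map. -/
noncomputable def joinL : E 2 →L[ℝ] E 3 :=
  LinearMap.toContinuousLinearMap
    { toFun := fun x => join x 0
      map_add' := fun x y => by rw [← join_add, add_zero]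
      map_smul' := fun c x => by rw [RingHom.id_apply, ← join_smul, mul_zero] }

@[simp] lemma joinL_apply (x : E 2) : joinL x = join x 0 := rfl

/-- The projection `x ↦ x'` as a continuous linear map. -/
noncomputable def planeL : E 3 →L[ℝ] E 2 :=
  LinearMap.toContinuousLinearMap
    { toFun := plane
      map_add' := plane_add
      map_smul' := plane_smul }

@[simp] lemma planeL_apply (x : E 3) : planeL x = plane x := rfl

lemma join_eq (x : E 2) (s : ℝ) : join x s = joinL x + s • (basisVec 2 : E 3) := by
  ext i; fin_cases i <;> simp

@[fun_prop] lemma continuous_plane : Continuous plane := planeL.continuous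

lemma contDiff_plane {n : ℕ∞} : ContDiff ℝ n plane := planeL.contDiff

@[fun_prop] lemma continuous_join : Continuous fun p : E 2 × ℝ => join p.1 p.2 := by
  simp only [join_eq]
  fun_prop

@[fun_prop] lemma measurable_plane : Measurable plane := continuous_plane.measurable

lemma contDiff_join_left {n : ℕ∞} (s : ℝ) : ContDiff ℝ n fun x => join x s := by
  simp only [join_eq]
  exact joinL.contDiff.add contDiff_const

/-- The decomposition `ℝ³ = ℝ² × ℝ`. -/
noncomputable def splitEquiv : E 3 ≃ᵐ E 2 × ℝ where
  toFun x := (plane x, x 2)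
  invFun p := join p.1 p.2
  left_inv x := join_plane x
  right_inv p := by simp
  measurable_toFun := by
    apply Measurable.prodMk measurable_plane
    exact (EuclideanSpace.proj (𝕜 := ℝ) (2 : Fin 3)).continuous.measurable
  measurable_invFun := continuous_join.measurable

@[simp] lemma splitEquiv_apply (x : E 3) : splitEquiv x = (plane x, x 2) := rfl
@[simp] lemma splitEquiv_symm_apply (p : E 2 × ℝ) : splitEquiv.symm p = join p.1 p.2 := rfl

lemma measurePreserving_splitEquiv : MeasurePreserving splitEquiv := by
  have h1 := EuclideanSpace.volume_preserving_symm_measurableEquiv_toLp (Fin 3)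
  have h2 := volume_preserving_piFinSuccAbove (fun _ : Fin 3 => ℝ) (Fin.last 2)
  have h3 : MeasurePreserving (Prod.swap : ℝ × (Fin 2 → ℝ) → (Fin 2 → ℝ) × ℝ) :=
    Measure.measurePreserving_swap
  have h4 := (EuclideanSpace.volume_preserving_symm_measurableEquiv_toLp (Fin 2)).symm
  have h5 := h4.prod (MeasurePreserving.id (volume : Measure ℝ))
  have h6 := h5.comp (h3.comp (h2.comp h1))
  convert h6 using 1
  · ext x i
    · fin_cases i <;> rfl
    · rfl
  · rfl

lemma lintegral_split {f : E 3 → ℝ≥0∞} (hf : Measurable f) :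
    ∫⁻ x, f x = ∫⁻ x' : E 2, ∫⁻ s : ℝ, f (join x' s) := by
  rw [← (measurePreserving_splitEquiv.symm).lintegral_comp hf]
  rw [show (volume : Measure (E 2 × ℝ)) = volume.prod volume from rfl, lintegral_prod]
  · rfl
  · exact (hf.comp splitEquiv.symm.measurable).aemeasurable

lemma integrable_comp_join {f : E 3 → ℝ} (hf : Integrable f) :
    Integrable (fun p : E 2 × ℝ => f (join p.1 p.2)) (volume.prod volume) :=
  (measurePreserving_splitEquiv.symm.integrable_comp_emb
    splitEquiv.symm.measurableEmbedding).2 hf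

lemma integral_split {f : E 3 → ℝ} (hf : Integrable f) :
    ∫ x, f x = ∫ x' : E 2, ∫ s : ℝ, f (join x' s) := by
  rw [← (measurePreserving_splitEquiv.symm).integral_comp splitEquiv.symm.measurableEmbedding]
  exact integral_prod _ (integrable_comp_join hf)

lemma integral_split_symm {f : E 3 → ℝ} (hf : Integrable f) :
    ∫ x, f x = ∫ s : ℝ, ∫ x' : E 2, f (join x' s) := by
  rw [← (measurePreserving_splitEquiv.symm).integral_comp splitEquiv.symm.measurableEmbedding]
  exact integral_prod_symm _ (integrable_comp_join hf)

/-- Fibres of the projection have infinite length, so measure is not preserved, but preimages of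
null sets are null. This carries almost everywhere statements on ω over to the film. -/
lemma quasiMeasurePreserving_plane : Measure.QuasiMeasurePreserving plane :=
  Measure.quasiMeasurePreserving_fst.comp measurePreserving_splitEquiv.quasiMeasurePreserving

lemma locallyIntegrableOn_comp_plane {F : Type*} [NormedAddCommGroup F] {ω : Set (E 2)}
    (hω : IsOpen ω) {u : E 2 → F} (hu : LocallyIntegrableOn u ω) :
    LocallyIntegrableOn (fun x => u (plane x)) (plane ⁻¹' ω) := by
  rw [locallyIntegrableOn_iff (hω.preimage continuous_plane).isLocallyClosed]
  intro K hK hKc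
  have h1 : IsCompact (plane '' K) := hKc.image continuous_plane
  have h2 : plane '' K ⊆ ω := by rintro _ ⟨x, hx, rfl⟩; exact hK hx
  -- A compact set lies in the product of its projection with a bounded interval, where
  -- integrability of u suffices.
  obtain ⟨R, hR⟩ := hKc.isBounded.subset_closedBall 0
  have h3 : IntegrableOn (fun p : E 2 × ℝ => u p.1) ((plane '' K) ×ˢ Set.Icc (-R) R)
      (volume.prod volume) := by
    rw [IntegrableOn, ← Measure.prod_restrict]
    have : IsFiniteMeasure (volume.restrict (Set.Icc (-R) R)) := inferInstance
    exact (hu.integrableOn_compact_subset h2 h1).comp_fst _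
  have h4 : IntegrableOn (fun x => u (plane x)) (splitEquiv ⁻¹' ((plane '' K) ×ˢ Set.Icc (-R) R)) :=
    (measurePreserving_splitEquiv.integrableOn_comp_preimage
      splitEquiv.measurableEmbedding).2 h3
  refine h4.mono_set fun x hx => ?_
  refine ⟨⟨x, hx, rfl⟩, ?_⟩
  have := hR hx
  rw [mem_closedBall_zero_iff] at this
  exact abs_le.1 ((PiLp.norm_apply_le x 2).trans this)

/-- A function of `x'` alone, seen as a function on a cylinder. -/
lemma WeakGrad.comp_plane {ω : Set (E 2)} (hω : IsOpen ω) {u : E 2 → ℝ} {g : E 2 → E 2}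
    (hu : WeakGrad ω u g) :
    WeakGrad (plane ⁻¹' ω) (fun x => u (plane x)) (fun x => join (g (plane x)) 0) := by
  have hl1 := locallyIntegrableOn_comp_plane hω hu.locInt
  have hl2 : LocallyIntegrableOn (fun x => join (g (plane x)) 0) (plane ⁻¹' ω) := by
    intro x hx
    obtain ⟨s, hs, hi⟩ := locallyIntegrableOn_comp_plane hω hu.locInt_grad x hx
    exact ⟨s, hs, joinL.integrable_comp hi⟩
  refine ⟨hl1, hl2, fun ψ hψ hc hs j => ?_⟩
  have i1 : Integrable fun x => u (plane x) * fderiv ℝ ψ x (basisVec j) :=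
    integrable_mul_of_locallyIntegrableOn hl1
      ((hψ.continuous_fderiv (by simp)).clm_apply continuous_const)
      (hc.fderiv_apply ℝ _) ((tsupport_fderiv_apply_subset' ψ _).trans hs)
  have i2 : Integrable fun x => join (g (plane x)) 0 j * ψ x :=
    integrable_mul_of_locallyIntegrableOn (hl2.coord j) hψ.continuous hc hs
  have hψdiff : Differentiable ℝ ψ := hψ.differentiable (by simp)
  -- Horizontal derivatives: at each fixed height the slice of ψ is a test function on ω. Vertical
  -- derivative: u is constant along vertical lines, and ∂₃ψ integrates to zero along each of them.
  rcases Fin.eq_castSucc_or_eq_last j with ⟨k, rfl⟩ | rfl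
  · rw [integral_split_symm i1, integral_split_symm i2, ← integral_neg]
    congr 1
    ext s
    simp only [plane_join, join_castSucc]
    have hcl : tsupport (fun x' => ψ (join x' s)) ⊆ (fun x' => join x' s) ⁻¹' tsupport ψ :=
      closure_minimal (fun x hx => subset_tsupport ψ hx)
        ((isClosed_tsupport ψ).preimage (contDiff_join_left (n := 0) s).continuous)
    have hsub : tsupport (fun x' => ψ (join x' s)) ⊆ ω := fun x hx => by
      simpa using hs (hcl hx)
    have hcs : HasCompactSupport fun x' => ψ (join x' s) := by
      refine HasCompactSupport.of_support_subset_isCompact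
        (hc.isCompact.image continuous_plane) fun x hx => ?_
      exact ⟨join x s, subset_tsupport ψ hx, by simp⟩
    have key := hu.eq (fun x' => ψ (join x' s)) (hψ.comp (contDiff_join_left s)) hcs hsub k
    rw [← key]
    congr 1
    ext x
    have : HasFDerivAt (fun x' => ψ (join x' s)) ((fderiv ℝ ψ (join x s)).comp joinL) x := by
      refine (hψdiff _).hasFDerivAt.comp x ?_
      simp only [join_eq]
      exact joinL.hasFDerivAt.add_const _
    rw [this.fderiv]
    simp [join_basisVec]
  · rw [integral_split i1]
    have h0 : ∀ x, join (g (plane x)) 0 (Fin.last 2) * ψ x = 0 := fun x => by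
      rw [show (Fin.last 2 : Fin 3) = 2 from rfl, join_two, zero_mul]
    simp only [h0, integral_zero, neg_zero, plane_join]
    refine integral_eq_zero_of_ae (Eventually.of_forall fun x => ?_)
    change ∫ s, u x * _ = (0 : ℝ)
    rw [integral_const_mul]
    have hd : ∀ s, HasDerivAt (fun s => ψ (join x s)) (fderiv ℝ ψ (join x s) (basisVec 2)) s := by
      intro s
      have h1 : HasDerivAt (fun s => join x s) (basisVec 2) s := by
        have : HasDerivAt (fun s : ℝ => joinL x + s • (basisVec 2 : E 3))
            ((1 : ℝ) • (basisVec 2 : E 3)) s :=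
          ((hasDerivAt_id' s).smul_const (basisVec 2 : E 3)).const_add (joinL x)
        rw [one_smul] at this
        exact this.congr_of_eventuallyEq (Eventually.of_forall fun t => join_eq x t)
      exact (hψdiff (join x s)).hasFDerivAt.comp_hasDerivAt s h1
    have hjc : Continuous fun s => join x s :=
      continuous_join.comp (f := fun s => (x, s)) (by fun_prop)
    have hsupp : ∀ f : E 3 → ℝ, HasCompactSupport f → HasCompactSupport fun s => f (join x s) := by
      intro f hf
      refine HasCompactSupport.of_support_subset_isCompact (hf.isCompact.image
        (f := fun y : E 3 => y 2) (by fun_prop)) fun s hs' => ?_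
      exact ⟨join x s, subset_tsupport f hs', rfl⟩
    have hdc : Continuous fun y => fderiv ℝ ψ y (basisVec 2) :=
      (hψ.continuous_fderiv (by simp)).clm_apply continuous_const
    have hi1 : Integrable fun s => fderiv ℝ ψ (join x s) (basisVec 2) :=
      (hdc.comp hjc).integrable_of_hasCompactSupport
        (hsupp (fun y => fderiv ℝ ψ y (basisVec 2)) (hc.fderiv_apply ℝ _))
    have hi2 : Integrable fun s => ψ (join x s) :=
      (hψ.continuous.comp hjc).integrable_of_hasCompactSupport (hsupp ψ hc)
    have := integral_eq_zero_of_hasDerivAt_of_integrable hd hi1 hi2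
    rw [show (Fin.last 2 : Fin 3) = 2 from rfl, this, mul_zero]

/-- Weak gradients under a diagonal change of variables. -/
lemma WeakGrad.comp_diagonal {d : ℕ} {U : Set (E d)} {u : E d → ℝ} {g : E d → E d}
    (hu : WeakGrad U u g) (S : E d ≃L[ℝ] E d) {c : Fin d → ℝ}
    (hS : ∀ j, S (basisVec j) = c j • basisVec j) :
    WeakGrad (S ⁻¹' U) (fun x => u (S x))
      (fun x => WithLp.toLp 2 fun j => c j * g (S x) j) := by
  have hmp : Measure.map S (volume : Measure (E d))
      = ENNReal.ofReal |(LinearMap.det (S : E d →ₗ[ℝ] E d))⁻¹| • volume :=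
    Measure.map_linearMap_addHaar_eq_smul_addHaar _ S.toLinearEquiv.isUnit_det'.ne_zero
  have hme : MeasurableEmbedding S := S.toHomeomorph.measurableEmbedding
  -- The Jacobian is a constant that appears on both sides of the identity defining the weak
  -- gradient, so its value is irrelevant.
  have hint : ∀ f : E d → ℝ, ∫ x, f (S x)
      = |(LinearMap.det (S : E d →ₗ[ℝ] E d))⁻¹| * ∫ y, f y := by
    intro f
    rw [← hme.integral_map, hmp, integral_smul_measure, ENNReal.toReal_ofReal (abs_nonneg _),
      smul_eq_mul]
  have hloc : ∀ {F : Type} [NormedAddCommGroup F] {f : E d → F}, LocallyIntegrableOn f U →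
      LocallyIntegrableOn (fun x => f (S x)) (S ⁻¹' U) := by
    intro F _ f hf x hx
    obtain ⟨s, hs, hi⟩ := hf (S x) hx
    refine ⟨S ⁻¹' s, ?_, ?_⟩
    · exact S.continuous.continuousWithinAt.preimage_mem_nhdsWithin' (by
        refine nhdsWithin_mono _ ?_ hs
        rintro _ ⟨y, hy, rfl⟩
        exact hy)
    · refine (hme.integrableOn_map_iff).1 ?_
      rw [hmp, IntegrableOn, Measure.restrict_smul]
      exact hi.smul_measure ENNReal.ofReal_ne_top
  have hdiagL : ∃ D : E d →L[ℝ] E d, ∀ z j, D z j = c j * z j := by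
    refine ⟨LinearMap.toContinuousLinearMap
      { toFun := fun z => WithLp.toLp 2 fun j => c j * z j
        map_add' := fun x y => by ext j; simp [mul_add]
        map_smul' := fun a x => by ext j; simp; ring }, fun z j => rfl⟩
  obtain ⟨D, hD⟩ := hdiagL
  refine ⟨hloc hu.locInt, ?_, fun ψ hψ hc hs j => ?_⟩
  · intro x hx
    obtain ⟨s, hs, hi⟩ := hloc hu.locInt_grad x hx
    refine ⟨s, hs, ?_⟩
    have := D.integrable_comp hi
    refine this.congr (Eventually.of_forall fun x => ?_)
    ext j
    exact hD _ j
  · set θ : E d → ℝ := fun y => ψ (S.symm y) with hθ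
    have hθs : ContDiff ℝ (⊤ : ℕ∞) θ := hψ.comp S.symm.contDiff
    have hθt : tsupport θ ⊆ S '' tsupport ψ := by
      refine closure_minimal (fun y hy => ⟨S.symm y, subset_tsupport ψ hy, by simp⟩) ?_
      exact S.toHomeomorph.isClosedMap _ (isClosed_tsupport ψ)
    have hθc : HasCompactSupport θ := HasCompactSupport.of_support_subset_isCompact
      (hc.isCompact.image S.continuous) ((subset_tsupport _).trans hθt)
    have hθU : tsupport θ ⊆ U := hθt.trans (by rintro _ ⟨x, hx, rfl⟩; exact hs hx)
    have key := hu.eq θ hθs hθc hθU j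
    have hd : ∀ x, fderiv ℝ ψ x (basisVec j) = c j * fderiv ℝ θ (S x) (basisVec j) := by
      intro x
      have h1 : HasFDerivAt (fun x => θ (S x))
          ((fderiv ℝ θ (S x)).comp (S : E d →L[ℝ] E d)) x :=
        (hθs.differentiable (by simp) (S x)).hasFDerivAt.comp x S.hasFDerivAt
      have h2 : (fun x => θ (S x)) = ψ := by ext x; simp [hθ]
      rw [h2] at h1
      rw [h1.fderiv]
      simp [hS]
    have e1 : ∀ x, u (S x) * fderiv ℝ ψ x (basisVec j)
        = (fun y => c j * (u y * fderiv ℝ θ y (basisVec j))) (S x) := by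
      intro x; rw [hd]; ring
    have e2 : ∀ x, (WithLp.toLp 2 fun j => c j * g (S x) j : E d) j * ψ x
        = (fun y => c j * (g y j * θ y)) (S x) := by
      intro x; simp [hθ]; ring
    rw [integral_congr_ae (Eventually.of_forall e1), integral_congr_ae (Eventually.of_forall e2)]
    rw [hint fun y => c j * (u y * fderiv ℝ θ y (basisVec j)),
      hint fun y => c j * (g y j * θ y), integral_const_mul, integral_const_mul, key]
    ring

end

/-! ### Periodicity: passing between the cell and the layer. -/

section

open scoped Pointwise

/-- The vector of `ℝ²` with the given integer coordinates. -/
noncomputable def intVec (n : Fin 2 → ℤ) : E 2 := WithLp.toLp 2 fun j => (n j : ℝ)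

@[simp] lemma intVec_apply (n : Fin 2 → ℤ) (j : Fin 2) : intVec n j = n j := rfl

lemma intVec_eq (n : Fin 2 → ℤ) : intVec n = n 0 • (basisVec 0 : E 2) + n 1 • (basisVec 1 : E 2) := by
  ext i; fin_cases i <;> simp

lemma join_intVec_eq (n : Fin 2 → ℤ) :
    join (intVec n) 0 = n 0 • (basisVec (Fin.castSucc 0) : E 3)
      + n 1 • (basisVec (Fin.castSucc 1) : E 3) := by
  ext i; fin_cases i <;> simp

/-- Functions of `y ∈ ℝ³` that are `Q`-periodic in `y'`. -/
def HPeriodic {β : Type*} (f : E 3 → β) : Prop := ∀ y n, f (y + join (intVec n) 0) = f y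

lemma hPeriodic_of_basis {β : Type*} {f : E 3 → β}
    (h : ∀ j : Fin 2, Function.Periodic f (EuclideanSpace.single j.castSucc 1)) : HPeriodic f := by
  intro y n
  rw [join_intVec_eq, ← add_assoc, (h 1).zsmul (n 1), (h 0).zsmul (n 0)]

lemma IsQPeriodic.add_intVec {f : E 2 → ℝ} (h : IsQPeriodic f) (y : E 2) (n : Fin 2 → ℤ) :
    f (y + intVec n) = f y := by
  rw [intVec_eq, ← add_assoc, (h 1).zsmul (n 1), (h 0).zsmul (n 0)]

/-- The integer part of `y'`. -/
noncomputable def floorVec (y : E 2) : Fin 2 → ℤ := fun j => ⌊y j⌋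

/-- The fractional part of `y` in the horizontal directions. -/
noncomputable def hFract (y : E 3) : E 3 := y + join (intVec (-floorVec (plane y))) 0

lemma hFract_add (y : E 3) (n : Fin 2 → ℤ) : hFract (y + join (intVec n) 0) = hFract y := by
  ext i
  fin_cases i <;> simp [hFract, floorVec]

lemma hFract_eq (y : E 3) : hFract y = !₂[Int.fract (y 0), Int.fract (y 1), y 2] := by
  ext i
  fin_cases i <;> simp [hFract, floorVec, Int.fract, sub_eq_add_neg]

lemma measurable_hFract : Measurable hFract := by
  have : hFract = fun y : E 3 => (WithLp.toLp 2 ![Int.fract (y 0), Int.fract (y 1), y 2] : E 3) :=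
    funext hFract_eq
  rw [this]
  refine (PiLp.continuous_toLp 2 _).measurable.comp (measurable_pi_lambda _ fun i => ?_)
  fin_cases i
  · exact measurable_fract.comp (EuclideanSpace.proj (𝕜 := ℝ) (0 : Fin 3)).continuous.measurable
  · exact measurable_fract.comp (EuclideanSpace.proj (𝕜 := ℝ) (1 : Fin 3)).continuous.measurable
  · exact (EuclideanSpace.proj (𝕜 := ℝ) (2 : Fin 3)).continuous.measurable

lemma volume_coord_eq {d : ℕ} (i : Fin d) (c : ℝ) : volume {y : E d | y i = c} = 0 := by
  have h := (EuclideanSpace.volume_preserving_symm_measurableEquiv_toLp (Fin d)).measure_preimage_equiv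
    {f | f i = c}
  have h2 : volume {f : Fin d → ℝ | f i = c} = 0 := by
    rw [volume_pi]
    exact Measure.pi_hyperplane (α := fun _ : Fin d => ℝ) (fun _ => volume) i c
  rw [h2] at h
  exact h

/-- Away from these countably many hyperplanes, taking fractional parts lands in the open unit
square, so cell boundaries can be ignored. -/
lemma ae_coord_ne_int {d : ℕ} : ∀ᵐ y : E d, ∀ i : Fin d, ∀ n : ℤ, y i ≠ n := by
  rw [ae_all_iff]; intro i
  rw [ae_all_iff]; intro n
  rw [ae_iff]
  simpa using volume_coord_eq i (n : ℝ)

lemma isOpen_unitSquare : IsOpen unitSquare := by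
  simp only [unitSquare, Set.ofPred_forall]
  exact isOpen_iInter_of_finite fun j => isOpen_Ioo.preimage
    (EuclideanSpace.proj (𝕜 := ℝ) j).continuous

lemma plane_hFract_mem {y : E 3} (hy : ∀ i : Fin 3, ∀ n : ℤ, y i ≠ n) :
    plane (hFract y) ∈ unitSquare := by
  rw [hFract_eq]
  have key : ∀ i : Fin 3, Int.fract (y i) ∈ Set.Ioo (0 : ℝ) 1 := fun i =>
    ⟨lt_of_le_of_ne (Int.fract_nonneg _) fun h => hy i ⌊y i⌋ (by
      have := Int.floor_add_fract (y i); rw [← h, add_zero] at this; exact this.symm),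
      Int.fract_lt_one _⟩
  intro j
  fin_cases j
  · exact key 0
  · exact key 1

section Layer

variable {f₁ f₂ : E 2 → ℝ}

lemma isOpen_layer (c₁ : Continuous f₁) (c₂ : Continuous f₂) : IsOpen (layer f₁ f₂) := by
  refine (isOpen_lt (c₁.comp continuous_plane) ?_).inter (isOpen_lt ?_ (c₂.comp continuous_plane))
  all_goals exact (EuclideanSpace.proj (𝕜 := ℝ) (2 : Fin 3)).continuous

lemma isOpen_cell (c₁ : Continuous f₁) (c₂ : Continuous f₂) : IsOpen (cell f₁ f₂) :=
  (isOpen_unitSquare.preimage continuous_plane).inter (isOpen_layer c₁ c₂)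

lemma add_mem_layer_iff (p₁ : IsQPeriodic f₁) (p₂ : IsQPeriodic f₂) (y : E 3) (n : Fin 2 → ℤ) :
    y + join (intVec n) 0 ∈ layer f₁ f₂ ↔ y ∈ layer f₁ f₂ := by
  simp only [layer, Set.mem_ofPred_eq, plane_add, plane_join, p₁.add_intVec, p₂.add_intVec,
    PiLp.add_apply, join_two, add_zero]

/-- Countably many integer translates of the cell cover the layer up to a null set, and P does not
see the translation. -/
lemma ae_layer_of_ae_cell (c₁ : Continuous f₁) (c₂ : Continuous f₂) (p₁ : IsQPeriodic f₁)
    (p₂ : IsQPeriodic f₂) {P : E 3 → Prop} (hP : HPeriodic P)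
    (h : ∀ᵐ y ∂volume.restrict (cell f₁ f₂), P y) :
    ∀ᵐ y ∂volume.restrict (layer f₁ f₂), P y := by
  rw [ae_restrict_iff' (isOpen_cell c₁ c₂).measurableSet] at h
  rw [ae_restrict_iff' (isOpen_layer c₁ c₂).measurableSet]
  have h2 : ∀ᵐ y : E 3, ∀ n : Fin 2 → ℤ, y + join (intVec n) 0 ∈ cell f₁ f₂ →
      P (y + join (intVec n) 0) := by
    rw [ae_all_iff]
    intro n
    exact (measurePreserving_add_right volume (join (intVec n) 0)).quasiMeasurePreserving.ae h
  filter_upwards [h2, ae_coord_ne_int] with y hy hi hl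
  have := hy (-floorVec (plane y)) ⟨plane_hFract_mem hi,
    (add_mem_layer_iff p₁ p₂ y _).2 hl⟩
  rwa [hP] at this

lemma exists_bound_of_periodic {f : E 2 → ℝ} (c : Continuous f) (p : IsQPeriodic f) :
    ∃ M : ℝ, 0 < M ∧ ∀ y, |f y| ≤ M := by
  obtain ⟨M, hM⟩ := (isCompact_closedBall (0 : E 2) 2).exists_bound_of_continuousOn c.continuousOn
  refine ⟨max M 1, by positivity, fun y => ?_⟩
  rw [← p.add_intVec y (-floorVec y)]
  refine (hM _ ?_).trans (le_max_left _ _)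
  rw [mem_closedBall_zero_iff]
  have key : ∀ j : Fin 2, |(y + intVec (-floorVec y)) j| ≤ 1 := by
    intro j
    have h1 := Int.floor_le (y j)
    have h2 := Int.lt_floor_add_one (y j)
    simp only [PiLp.add_apply, intVec_apply, floorVec, Pi.neg_apply, Int.cast_neg]
    rw [abs_le]
    constructor <;> linarith
  refine le_of_sq_le_sq ?_ (by norm_num)
  rw [EuclideanSpace.norm_sq_eq, Fin.sum_univ_two]
  have h0 := key 0
  have h1 := key 1
  simp only [Real.norm_eq_abs]
  nlinarith [abs_nonneg ((y + intVec (-floorVec y)) 0), abs_nonneg ((y + intVec (-floorVec y)) 1)]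

lemma integrableOn_translate {F : Type*} [NormedAddCommGroup F] {f : E 3 → F} (hf : HPeriodic f)
    {s : Set (E 3)} (h : IntegrableOn f s) (n : Fin 2 → ℤ) :
    IntegrableOn f ((fun y => y + join (intVec n) 0) ⁻¹' s) := by
  have := ((measurePreserving_add_right volume (join (intVec n) 0)).integrableOn_comp_preimage
    (measurableEmbedding_addRight _)).2 h
  refine this.congr (Eventually.of_forall fun y => ?_)
  exact hf y n

lemma locallyIntegrableOn_layer (p₁ : IsQPeriodic f₁) (p₂ : IsQPeriodic f₂) {F : Type*} [NormedAddCommGroup F] {f : E 3 → F} (hf : HPeriodic f)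
    (h : IntegrableOn f (cell f₁ f₂)) : LocallyIntegrableOn f (layer f₁ f₂) := by
  intro y hy
  refine ⟨Metric.ball y 1 ∩ layer f₁ f₂, inter_mem
    (mem_nhdsWithin_of_mem_nhds (Metric.ball_mem_nhds y one_pos)) self_mem_nhdsWithin, ?_⟩
  -- A unit ball meets only finitely many translated cells: its points have coordinates of size at
  -- most ‖y‖ + 1, and taking the integer part loses at most 1 more.
  obtain ⟨N, hN⟩ := exists_nat_gt (‖y‖ + 2)
  set S : Set (Fin 2 → ℤ) := Set.Icc (fun _ => -N) (fun _ => N)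
  have hS : S.Finite := Set.finite_Icc _ _
  have h1 : IntegrableOn f (⋃ n ∈ S, (fun y => y + join (intVec n) 0) ⁻¹' cell f₁ f₂) :=
    (integrableOn_finite_biUnion hS).2 fun n _ => integrableOn_translate hf h n
  refine h1.mono_set_ae ?_
  filter_upwards [ae_coord_ne_int] with z hz hzm
  change z ∈ ⋃ n ∈ S, (fun y => y + join (intVec n) 0) ⁻¹' cell f₁ f₂
  simp only [Set.mem_iUnion]
  refine ⟨-floorVec (plane z), ?_, plane_hFract_mem hz, (add_mem_layer_iff p₁ p₂ z _).2 hzm.2⟩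
  have hzn : ‖z‖ ≤ ‖y‖ + 1 := by
    have := norm_sub_norm_le z y
    have h3 := Metric.mem_ball.1 hzm.1
    rw [dist_eq_norm] at h3
    linarith
  have key : ∀ j : Fin 2, |plane z j| ≤ ‖y‖ + 1 := fun j => by
    rw [plane_apply]
    exact (PiLp.norm_apply_le z _).trans hzn
  constructor <;> intro j <;> simp only [Pi.neg_apply, floorVec]
  · have := (abs_le.1 (key j)).2
    have h4 := Int.floor_le (plane z j)
    have : (⌊plane z j⌋ : ℝ) ≤ N := by linarith
    have : ⌊plane z j⌋ ≤ (N : ℤ) := by exact_mod_cast this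
    linarith
  · have := (abs_le.1 (key j)).1
    have h4 := Int.lt_floor_add_one (plane z j)
    have : (-N : ℝ) ≤ (⌊plane z j⌋ : ℝ) := by linarith
    have : -(N : ℤ) ≤ ⌊plane z j⌋ := by exact_mod_cast this
    linarith

/-- Composing a measurable representative on the cell with the fractional part gives one that is
measurable and periodic at every point, as required by `lintegral_film_le`. -/
lemma exists_measurable_periodic (c₁ : Continuous f₁) (c₂ : Continuous f₂) (p₁ : IsQPeriodic f₁)
    (p₂ : IsQPeriodic f₂) {F : Type*} [NormedAddCommGroup F] {f : E 3 → F} (hf : HPeriodic f)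
    (h : AEStronglyMeasurable f (volume.restrict (cell f₁ f₂))) :
    ∃ f' : E 3 → F, StronglyMeasurable f' ∧ HPeriodic f' ∧
      f =ᵐ[volume.restrict (layer f₁ f₂)] f' := by
  refine ⟨fun y => h.mk f (hFract y), h.stronglyMeasurable_mk.comp_measurable measurable_hFract,
    fun y n => by simp only [hFract_add], ?_⟩
  refine ae_layer_of_ae_cell c₁ c₂ p₁ p₂ (P := fun y => f y = h.mk f (hFract y)) ?_ ?_
  · intro y n
    simp only [hFract_add, hf y n]
  · filter_upwards [h.ae_eq_mk, ae_restrict_mem (isOpen_cell c₁ c₂).measurableSet] with y hy hm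
    have : hFract y = y := by
      have h0 : Int.fract (y 0) = y 0 := Int.fract_eq_self.2 ⟨(hm.1 0).1.le, (hm.1 0).2⟩
      have h1 : Int.fract (y 1) = y 1 := Int.fract_eq_self.2 ⟨(hm.1 1).1.le, (hm.1 1).2⟩
      rw [hFract_eq, h0, h1]
      exact join_plane y
    rw [this, hy]

end Layer

/-- Periodic functions of `y'` have the same integral over all translates of the unit square. -/
lemma lintegral_unitSquare_add {k : E 2 → ℝ≥0∞} (hk : ∀ y n, k (y + intVec n) = k y) (y : E 2) :
    ∫⁻ t in unitSquare, k (y + t) = ∫⁻ t in unitSquare, k t := by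
  set b := (EuclideanSpace.basisFun (Fin 2) ℝ).toBasis with hb
  have hD : IsAddFundamentalDomain (Submodule.span ℤ (Set.range b)).toAddSubgroup
      (ZSpan.fundamentalDomain b) (volume : Measure (E 2)) := ZSpan.isAddFundamentalDomain' b _
  have hmem : ∀ x, x ∈ ZSpan.fundamentalDomain b ↔ ∀ j, x j ∈ Set.Ico (0 : ℝ) 1 := by
    intro x
    simp [ZSpan.mem_fundamentalDomain, hb]
  have hae : (ZSpan.fundamentalDomain b : Set (E 2)) =ᵐ[volume] unitSquare := by
    filter_upwards [ae_coord_ne_int] with x hx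
    refine propext ⟨fun h j => ?_, fun h => ?_⟩
    · have := (hmem x).1 h j
      exact ⟨lt_of_le_of_ne this.1 fun h0 => hx j 0 (by simpa using h0.symm), this.2⟩
    · exact (hmem x).2 fun j => ⟨(h j).1.le, (h j).2⟩
  have hinv : ∀ (g : (Submodule.span ℤ (Set.range b)).toAddSubgroup) (x : E 2),
      k (g +ᵥ x) = k x := by
    rintro ⟨g, hg⟩ x
    have hg' : g ∈ Submodule.span ℤ (Set.range b) := hg
    have hgi : ∃ n : Fin 2 → ℤ, g = intVec n := by
      have := (b.mem_span_iff_repr_mem ℤ g).1 hg'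
      choose n hn using this
      refine ⟨n, ?_⟩
      ext j
      have := hn j
      simp [hb] at this
      simp [← this]
    obtain ⟨n, rfl⟩ := hgi
    change k (intVec n + x) = k x
    rw [add_comm, hk]
  have : Countable (Submodule.span ℤ (Set.range b)).toAddSubgroup :=
    inferInstanceAs (Countable (Submodule.span ℤ (Set.range b)))
  -- The unit square is, up to a null set, a fundamental domain of ℤ², and so is its translate by y.
  -- An invariant function has the same integral over both.
  have hD2 := hD.vadd_of_comm (G' := E 2) y
  have h2 := hD2.setLIntegral_eq hD k hinv
  rw [← setLIntegral_congr hae, ← setLIntegral_congr hae, ← h2]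
  have h3 := (measurePreserving_add_left (volume : Measure (E 2)) y).setLIntegral_comp_preimage_emb
    (measurableEmbedding_addLeft y) k (y +ᵥ ZSpan.fundamentalDomain b)
  rw [← h3]
  congr 2
  ext x
  simp [Set.mem_vadd_set]

end

/-! ### Integrals over the film and the averaging inequality. -/

section

/-- The map `x ↦ (x'/ε, x₃)`. -/
noncomputable def rescale (ε : ℝ) (x : E 3) : E 3 := join (ε⁻¹ • plane x) (x 2)

lemma measurable_rescale (ε : ℝ) : Measurable (rescale ε) := by
  have : rescale ε = fun x => join (ε⁻¹ • plane x) (x 2) := rfl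
  rw [this]
  exact (continuous_join.comp (f := fun x : E 3 => (ε⁻¹ • plane x, x 2))
    (by fun_prop)).measurable

lemma film_eq (f₁ f₂ : E 2 → ℝ) (ω : Set (E 2)) (ε : ℝ) :
    film f₁ f₂ ω ε = plane ⁻¹' ω ∩ rescale ε ⁻¹' layer f₁ f₂ := by
  ext x
  simp [film, layer, rescale]

variable {f₁ f₂ : E 2 → ℝ}

lemma measurableSet_film (c₁ : Continuous f₁) (c₂ : Continuous f₂) {ω : Set (E 2)}
    (hω : MeasurableSet ω) (ε : ℝ) : MeasurableSet (film f₁ f₂ ω ε) := by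
  rw [film_eq]
  exact (measurable_plane hω).inter (measurable_rescale ε (isOpen_layer c₁ c₂).measurableSet)

lemma isOpen_film (c₁ : Continuous f₁) (c₂ : Continuous f₂) {ω : Set (E 2)}
    (hω : IsOpen ω) (ε : ℝ) : IsOpen (film f₁ f₂ ω ε) := by
  rw [film_eq]
  refine (hω.preimage continuous_plane).inter ((isOpen_layer c₁ c₂).preimage ?_)
  exact continuous_join.comp (f := fun x : E 3 => (ε⁻¹ • plane x, x 2)) (by fun_prop)

/-- Integrals of functions of the fast variable are controlled by cell integrals: this is proved by
averaging over the translates of the periodic structure. -/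
lemma lintegral_film_le (c₁ : Continuous f₁) (c₂ : Continuous f₂) (p₁ : IsQPeriodic f₁)
    (p₂ : IsQPeriodic f₂) (ω : Set (E 2)) {ε : ℝ} (hε : 0 < ε) {h H : E 2 → E 3 → ℝ≥0∞}
    (hm : Measurable (Function.uncurry h)) (Hm : Measurable (Function.uncurry H))
    (Hp : ∀ x, HPeriodic (H x))
    (hH : ∀ x, ∀ t ∈ unitSquare, ∀ y, h (x + ε • t) y ≤ H x y) :
    ∫⁻ x in film f₁ f₂ ω ε, h (plane x) (rescale ε x)
      ≤ ∫⁻ x' : E 2, ∫⁻ y in cell f₁ f₂, H x' y := by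
  classical
  have hL : MeasurableSet (layer f₁ f₂) := (isOpen_layer c₁ c₂).measurableSet
  -- vertical integrals
  let k : (E 2 → E 3 → ℝ≥0∞) → E 2 → E 2 → ℝ≥0∞ := fun h x y =>
    ∫⁻ s : ℝ, (layer f₁ f₂).indicator (h x) (join y s)
  have hind : ∀ g : E 2 → E 3 → ℝ≥0∞, Measurable (Function.uncurry g) →
      Measurable fun q : E 2 × E 3 => (layer f₁ f₂).indicator (g q.1) q.2 := by
    intro g hg
    have : (fun q : E 2 × E 3 => (layer f₁ f₂).indicator (g q.1) q.2)
        = (Prod.snd ⁻¹' layer f₁ f₂).indicator (Function.uncurry g) := by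
      ext q
      by_cases hq : q.2 ∈ layer f₁ f₂ <;> simp [hq, Function.uncurry]
    rw [this]
    exact hg.indicator (measurable_snd hL)
  have hkm : ∀ g : E 2 → E 3 → ℝ≥0∞, Measurable (Function.uncurry g) →
      Measurable fun p : E 2 × E 2 => k g p.1 p.2 := by
    intro g hg
    refine Measurable.lintegral_prod_right' (f := fun q : (E 2 × E 2) × ℝ =>
      (layer f₁ f₂).indicator (g q.1.1) (join q.1.2 q.2)) ?_
    exact (hind g hg).comp (f := fun q : (E 2 × E 2) × ℝ => (q.1.1, join q.1.2 q.2)) (by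
      refine (measurable_fst.comp measurable_fst).prodMk ?_
      exact continuous_join.measurable.comp ((measurable_snd.comp measurable_fst).prodMk
        measurable_snd))
  have hkp : ∀ g : E 2 → E 3 → ℝ≥0∞, (∀ x, HPeriodic (g x)) → ∀ x y n,
      k g x (y + intVec n) = k g x y := by
    intro g hg x y n
    refine lintegral_congr fun s => ?_
    have e : join (y + intVec n) s = join y s + join (intVec n) 0 := by
      rw [← join_add, add_zero]
    rw [e]
    by_cases hs : join y s ∈ layer f₁ f₂
    · rw [Set.indicator_of_mem hs, Set.indicator_of_mem ((add_mem_layer_iff p₁ p₂ _ n).2 hs), hg]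
    · rw [Set.indicator_of_notMem hs,
        Set.indicator_of_notMem fun h' => hs ((add_mem_layer_iff p₁ p₂ _ n).1 h')]
  have hvol : volume unitSquare = 1 := by
    have h1 := (EuclideanSpace.volume_preserving_symm_measurableEquiv_toLp
      (Fin 2)).measure_preimage_equiv (Set.univ.pi fun _ => Set.Ioo (0 : ℝ) 1)
    rw [volume_pi_pi] at h1
    simp only [Real.volume_Ioo, sub_zero, ENNReal.ofReal_one, Finset.prod_const_one] at h1
    rw [← h1]
    congr 1
    ext y
    simp [unitSquare]
  calc ∫⁻ x in film f₁ f₂ ω ε, h (plane x) (rescale ε x)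
      ≤ ∫⁻ x, (layer f₁ f₂).indicator (h (plane x)) (rescale ε x) := by
        have hms : MeasurableSet (rescale ε ⁻¹' layer f₁ f₂) := measurable_rescale ε hL
        refine (lintegral_mono_set (t := rescale ε ⁻¹' layer f₁ f₂) ?_).trans (le_of_eq ?_)
        · rw [film_eq]; exact Set.inter_subset_right
        · rw [← lintegral_indicator hms]
          rfl
    _ = ∫⁻ x' : E 2, k h x' (ε⁻¹ • x') := by
        rw [lintegral_split]
        · simp [k, rescale]
        · exact (hind h hm).comp (measurable_plane.prodMk (measurable_rescale ε))
    -- An idle average over t is inserted, the unit square having measure 1. Translating x' by εt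
    -- then shifts the fast variable by exactly t.
    _ = ∫⁻ _ in unitSquare, ∫⁻ x' : E 2, k h x' (ε⁻¹ • x') := by
        rw [setLIntegral_const, hvol, mul_one]
    _ = ∫⁻ t in unitSquare, ∫⁻ x' : E 2, k h (x' + ε • t) (ε⁻¹ • x' + t) := by
        refine lintegral_congr fun t => ?_
        rw [← lintegral_add_right_eq_self (fun x' : E 2 => k h x' (ε⁻¹ • x')) (ε • t)]
        simp only [smul_add, smul_smul, inv_mul_cancel₀ hε.ne', one_smul]
    -- The majorant H restores the slow variable to x', leaving t only in the fast variable.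
    _ ≤ ∫⁻ t in unitSquare, ∫⁻ x' : E 2, k H x' (ε⁻¹ • x' + t) := by
        refine setLIntegral_mono' isOpen_unitSquare.measurableSet fun t ht => ?_
        refine lintegral_mono fun x => lintegral_mono fun s => ?_
        exact Set.indicator_le_indicator (hH x t ht _)
    _ = ∫⁻ x' : E 2, ∫⁻ t in unitSquare, k H x' (ε⁻¹ • x' + t) := by
        refine lintegral_lintegral_swap (Measurable.aemeasurable ?_)
        exact (hkm H Hm).comp (f := fun q : E 2 × E 2 => (q.2, ε⁻¹ • q.2 + q.1))
          (by fun_prop)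
    -- With x' fixed, t sweeps a translate of the unit square, which periodicity replaces by the
    -- square itself.
    _ = ∫⁻ x' : E 2, ∫⁻ t in unitSquare, k H x' t := by
        refine lintegral_congr fun x => ?_
        exact lintegral_unitSquare_add (hkp H Hp x) _
    _ = ∫⁻ x' : E 2, ∫⁻ y in cell f₁ f₂, H x' y := by
        refine lintegral_congr fun x => ?_
        have hc := (isOpen_cell c₁ c₂).measurableSet
        have hHx : Measurable (H x) := Hm.comp measurable_prodMk_left
        rw [← lintegral_indicator hc, lintegral_split (hHx.indicator hc),
          ← lintegral_indicator isOpen_unitSquare.measurableSet]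
        refine lintegral_congr fun t => ?_
        by_cases ht : t ∈ unitSquare
        · rw [Set.indicator_of_mem ht]
          refine lintegral_congr fun s => ?_
          by_cases hs : join t s ∈ layer f₁ f₂
          · rw [Set.indicator_of_mem hs, Set.indicator_of_mem (show join t s ∈ cell f₁ f₂ from
              ⟨by simpa using ht, hs⟩)]
          · rw [Set.indicator_of_notMem hs, Set.indicator_of_notMem fun h' => hs h'.2]
        · rw [Set.indicator_of_notMem ht]
          symm
          rw [lintegral_eq_zero_iff' ]
          · refine Eventually.of_forall fun s => ?_
            refine Set.indicator_of_notMem (fun h' => ht ?_) _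
            simpa using h'.1
          · refine ((hHx.indicator hc).comp ?_).aemeasurable
            exact (continuous_join.comp (f := fun s : ℝ => (t, s)) (by fun_prop)).measurable

/-- Integrals over the film of functions of the slow variable. -/
lemma lintegral_film_comp_plane_le {M : ℝ}
    (h₁ : ∀ y, |f₁ y| ≤ M) (h₂ : ∀ y, |f₂ y| ≤ M) {ω : Set (E 2)} (ε : ℝ)
    {a : E 2 → ℝ≥0∞} (ha : AEMeasurable a (volume.restrict ω)) :
    ∫⁻ x in film f₁ f₂ ω ε, a (plane x) ≤ ENNReal.ofReal (2 * M) * ∫⁻ x' in ω, a x' := by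
  have hbox : film f₁ f₂ ω ε ⊆ splitEquiv ⁻¹' (ω ×ˢ Set.Ioo (-M) M) := by
    rintro x ⟨h1, h2, h3⟩
    exact ⟨h1, (abs_le.1 (h₁ _)).1.trans_lt h2, h3.trans_le (abs_le.1 (h₂ _)).2⟩
  calc ∫⁻ x in film f₁ f₂ ω ε, a (plane x)
      ≤ ∫⁻ x in splitEquiv ⁻¹' (ω ×ˢ Set.Ioo (-M) M), a (splitEquiv x).1 :=
        lintegral_mono_set hbox
    _ = ∫⁻ p in ω ×ˢ Set.Ioo (-M) M, a p.1 :=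
        measurePreserving_splitEquiv.setLIntegral_comp_preimage_emb
          splitEquiv.measurableEmbedding (fun p => a p.1) _
    _ = ENNReal.ofReal (2 * M) * ∫⁻ x' in ω, a x' := by
        rw [show (volume : Measure (E 2 × ℝ)) = volume.prod volume from rfl,
          ← Measure.prod_restrict, lintegral_prod _ (ha.comp_fst)]
        simp only [lintegral_const, Measure.restrict_apply MeasurableSet.univ, Set.univ_inter,
          Real.volume_Ioo]
        rw [lintegral_mul_const'' _ ha, mul_comm]
        congr 2
        ring

lemma volume_film_le {M : ℝ}
    (h₁ : ∀ y, |f₁ y| ≤ M) (h₂ : ∀ y, |f₂ y| ≤ M) (ω : Set (E 2)) (ε : ℝ) :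
    volume (film f₁ f₂ ω ε) ≤ ENNReal.ofReal (2 * M) * volume ω := by
  have := lintegral_film_comp_plane_le h₁ h₂ (ω := ω) ε (a := fun _ => 1) aemeasurable_const
  simpa using this

lemma volume_cell_lt_top (c₁ : Continuous f₁) (c₂ : Continuous f₂) (p₁ : IsQPeriodic f₁)
    (p₂ : IsQPeriodic f₂) : volume (cell f₁ f₂) < ∞ := by
  obtain ⟨M₁, -, h₁⟩ := exists_bound_of_periodic c₁ p₁
  obtain ⟨M₂, -, h₂⟩ := exists_bound_of_periodic c₂ p₂
  have hb : Bornology.IsBounded (cell f₁ f₂) := by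
    refine (Metric.isBounded_closedBall (x := (0 : E 3)) (r := 2 + M₁ + M₂)).subset fun y hy => ?_
    rw [mem_closedBall_zero_iff]
    have b1 := abs_le.1 (h₁ (plane y))
    have b2 := abs_le.1 (h₂ (plane y))
    have q0 := hy.1 0
    have q1 := hy.1 1
    have l1 := hy.2.1
    have l2 := hy.2.2
    simp only [plane_zero, plane_one, Set.mem_Ioo] at q0 q1
    have hy2 : |y 2| ≤ M₁ + M₂ := by
      rw [abs_le]; constructor <;> linarith
    refine le_of_sq_le_sq ?_ (by linarith)
    rw [EuclideanSpace.norm_sq_eq, Fin.sum_univ_three]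
    simp only [Real.norm_eq_abs, sq_abs]
    have := sq_le_sq' (a := y 2) (b := M₁ + M₂) (abs_le.1 hy2).1 (abs_le.1 hy2).2
    nlinarith
  exact hb.measure_lt_top

end

/-! ### Scalar correctors and their truncation. -/

section

variable {f₁ f₂ : E 2 → ℝ}

lemma enorm_sq_eq_ofReal {F : Type*} [NormedAddCommGroup F] (a : F) :
    ‖a‖ₑ ^ 2 = ENNReal.ofReal (‖a‖ ^ 2) := by
  rw [ENNReal.ofReal_pow (norm_nonneg _), ofReal_norm]

/-- Young's inequality 2ab ≤ δa² + δ⁻¹b². The leading term keeps a factor close to 1, and the error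
pays 1 + δ⁻¹. -/
lemma enorm_add_sq_le {F : Type*} [NormedAddCommGroup F] {δ : ℝ} (hδ : 0 < δ) (a b : F) :
    ‖a + b‖ₑ ^ 2 ≤ ENNReal.ofReal (1 + δ) * ‖a‖ₑ ^ 2 + ENNReal.ofReal (1 + δ⁻¹) * ‖b‖ₑ ^ 2 := by
  have hi : 0 < δ⁻¹ := inv_pos.2 hδ
  simp only [enorm_sq_eq_ofReal]
  rw [← ENNReal.ofReal_mul (by positivity), ← ENNReal.ofReal_mul (by positivity),
    ← ENNReal.ofReal_add (by positivity) (by positivity)]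
  apply ENNReal.ofReal_le_ofReal
  have h1 := norm_add_le a b
  have h2 : ‖a + b‖ ^ 2 ≤ (‖a‖ + ‖b‖) ^ 2 := by gcongr
  have h3 : 0 ≤ δ⁻¹ * (δ * ‖a‖ - ‖b‖) ^ 2 := by positivity
  have h4 : δ⁻¹ * (δ * ‖a‖ - ‖b‖) ^ 2 = δ * ‖a‖ ^ 2 - 2 * ‖a‖ * ‖b‖ + δ⁻¹ * ‖b‖ ^ 2 := by
    field_simp
    ring
  nlinarith

/-- `χ` is a scalar periodic function of class `H¹` on the cell, with weak gradient `g`; the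
representatives are measurable. -/
structure IsCorrector (f₁ f₂ : E 2 → ℝ) (χ : E 3 → ℝ) (g : E 3 → E 3) : Prop where
  meas : StronglyMeasurable χ
  meas_grad : StronglyMeasurable g
  periodic : HPeriodic χ
  periodic_grad : HPeriodic g
  memLp : MemLp χ 2 (volume.restrict (cell f₁ f₂))
  memLp_grad : MemLp g 2 (volume.restrict (cell f₁ f₂))
  weakGrad : WeakGrad (layer f₁ f₂) χ g

namespace IsCorrector

variable {χ χ' : E 3 → ℝ} {g g' : E 3 → E 3}

lemma add (h : IsCorrector f₁ f₂ χ g) (h' : IsCorrector f₁ f₂ χ' g') :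
    IsCorrector f₁ f₂ (fun y => χ y + χ' y) (fun y => g y + g' y) :=
  ⟨h.meas.add h'.meas, h.meas_grad.add h'.meas_grad,
    fun y n => by simp only [h.periodic y n, h'.periodic y n],
    fun y n => by simp only [h.periodic_grad y n, h'.periodic_grad y n],
    h.memLp.add h'.memLp, h.memLp_grad.add h'.memLp_grad, h.weakGrad.add h'.weakGrad⟩

lemma const_mul (h : IsCorrector f₁ f₂ χ g) (c : ℝ) :
    IsCorrector f₁ f₂ (fun y => c * χ y) (fun y => c • g y) :=
  ⟨h.meas.const_mul c, h.meas_grad.const_smul c,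
    fun y n => by simp only [h.periodic y n],
    fun y n => by simp only [h.periodic_grad y n],
    h.memLp.const_mul c, h.memLp_grad.const_smul c, h.weakGrad.const_mul c⟩

lemma zero : IsCorrector f₁ f₂ (fun _ => 0) (fun _ => 0) :=
  ⟨stronglyMeasurable_const, stronglyMeasurable_const, fun _ _ => rfl, fun _ _ => rfl,
    MemLp.zero, MemLp.zero, WeakGrad.zero⟩

end IsCorrector

lemma memLp_of_coord {α : Type*} [MeasurableSpace α] {μ : Measure α} {n : ℕ} {p : ℝ≥0∞}
    {f : α → E n} (h : ∀ j, MemLp (fun x => f x j) p μ) : MemLp f p μ := by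
  have h2 : f = fun x => ∑ j, (f x j) • (basisVec j : E n) := by
    ext x i
    simp [Finset.sum_apply, Pi.single_apply]
  rw [h2]
  refine memLp_finsetSum _ fun j _ => ?_
  exact (ContinuousLinearMap.toSpanSingleton ℝ (basisVec j : E n)).comp_memLp' (h j)

lemma _root_.MeasureTheory.MemLp.coord {α : Type*} [MeasurableSpace α] {μ : Measure α} {n : ℕ}
    {p : ℝ≥0∞} {f : α → E n} (h : MemLp f p μ) (j : Fin n) : MemLp (fun x => f x j) p μ :=
  (EuclideanSpace.proj (𝕜 := ℝ) j : E n →L[ℝ] ℝ).comp_memLp' h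

/-- The components of a vector competitor are, after a change on a null set, scalar correctors. This
is how the cell problem decouples into rows. -/
lemma IsH1Periodic.exists_isCorrector (c₁ : Continuous f₁) (c₂ : Continuous f₂)
    (p₁ : IsQPeriodic f₁) (p₂ : IsQPeriodic f₂) {φ : E 3 → E 3} {G : E 3 → Matrix (Fin 3) (Fin 3) ℝ}
    (h : IsH1Periodic f₁ f₂ φ G) (i : Fin 3) :
    ∃ χ g, IsCorrector f₁ f₂ χ g ∧ g =ᵐ[volume.restrict (cell f₁ f₂)] rowVec G i := by
  have hfin : IsFiniteMeasure (volume.restrict (cell f₁ f₂)) :=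
    ⟨by simpa using volume_cell_lt_top c₁ c₂ p₁ p₂⟩
  have pφ : HPeriodic fun y => φ y i := fun y n => by
    simp only [hPeriodic_of_basis h.periodic y n]
  have pG : HPeriodic (rowVec G i) := fun y n => by
    simp only [rowVec, hPeriodic_of_basis h.periodic_grad y n]
  have mφ : MemLp (fun y => φ y i) 2 (volume.restrict (cell f₁ f₂)) := h.memLp.coord i
  have mG : MemLp (rowVec G i) 2 (volume.restrict (cell f₁ f₂)) :=
    memLp_of_coord fun j => h.memLp_grad i j
  have lφ := locallyIntegrableOn_layer p₁ p₂ pφ (mφ.integrable (by norm_num))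
  have lG := locallyIntegrableOn_layer p₁ p₂ pG (mG.integrable (by norm_num))
  obtain ⟨χ, sχ, pχ, eχ⟩ := exists_measurable_periodic c₁ c₂ p₁ p₂ pφ mφ.aestronglyMeasurable
  obtain ⟨g, sg, pg, eg⟩ := exists_measurable_periodic c₁ c₂ p₁ p₂ pG mG.aestronglyMeasurable
  have hsub : cell f₁ f₂ ⊆ layer f₁ f₂ := Set.inter_subset_right
  have eχ' : (fun y => φ y i) =ᵐ[volume.restrict (cell f₁ f₂)] χ :=
    ae_mono (Measure.restrict_mono hsub le_rfl) eχ
  have eg' : rowVec G i =ᵐ[volume.restrict (cell f₁ f₂)] g :=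
    ae_mono (Measure.restrict_mono hsub le_rfl) eg
  refine ⟨χ, g, ⟨sχ, sg, pχ, pg, mφ.ae_eq eχ', mG.ae_eq eg', ?_⟩, eg'.symm⟩
  exact (h.hasWeakGradient.weakGrad i lφ lG).congr_ae (isOpen_layer c₁ c₂).measurableSet eχ eg

/-- Truncation of a corrector. -/
lemma IsCorrector.exists_bounded (c₁ : Continuous f₁) (c₂ : Continuous f₂)
    {χ : E 3 → ℝ} {g : E 3 → E 3} (h : IsCorrector f₁ f₂ χ g) {δ : ℝ≥0∞} (hδ : 0 < δ) :
    ∃ χ' g', IsCorrector f₁ f₂ χ' g' ∧ (∃ B : ℝ, ∀ y, |χ' y| ≤ B) ∧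
      ∫⁻ y in cell f₁ f₂, ‖g' y - g y‖ₑ ^ 2 ≤ δ := by
  -- The truncation is the map z ↦ (n+1) arctan(z/(n+1)), with derivative a n. It is bounded,
  -- 1-Lipschitz and, unlike clipping, of class C¹, so the chain rule above applies.
  let a : ℕ → ℝ → ℝ := fun n z => (1 + (z / (n + 1)) ^ 2)⁻¹
  have ha : ∀ n z, 0 < 1 + (z / ((n : ℝ) + 1)) ^ 2 := fun n z => by positivity
  have ha0 : ∀ n z, 0 ≤ a n z := fun n z => (inv_pos.2 (ha n z)).le
  have ha1 : ∀ n z, a n z ≤ 1 := fun n z => inv_le_one_of_one_le₀ (by nlinarith [sq_nonneg (z / ((n : ℝ) + 1))])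
  have hac : ∀ n, Continuous (a n) := fun n =>
    Continuous.inv₀ (by fun_prop) fun z => (ha n z).ne'
  have hlim : ∀ z, Tendsto (fun n => a n z) atTop (𝓝 1) := by
    intro z
    have h1 : Tendsto (fun n : ℕ => z / ((n : ℝ) + 1)) atTop (𝓝 0) := by
      simpa [div_eq_mul_inv] using tendsto_one_div_add_atTop_nhds_zero_nat.const_mul z
    simpa [a] using ((h1.pow 2).const_add 1).inv₀ (by norm_num)
  let θ : ℕ → ℝ → ℝ := fun n z => (n + 1) * Real.arctan (z / (n + 1))
  have hn1 : ∀ n : ℕ, ((n : ℝ) + 1) ≠ 0 := fun n => by positivity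
  have hθd : ∀ n z, HasDerivAt (θ n) (a n z) z := by
    intro n z
    have h1 : HasDerivAt (fun z : ℝ => z / ((n : ℝ) + 1)) (1 / ((n : ℝ) + 1)) z :=
      (hasDerivAt_id z).div_const _
    have h2 := (h1.arctan).const_mul ((n : ℝ) + 1)
    refine h2.congr_deriv ?_
    have h3 := hn1 n
    have h4 := (ha n z).ne'
    change _ = (1 + (z / ((n : ℝ) + 1)) ^ 2)⁻¹
    field_simp
  -- Dominated convergence with majorant |g|²: the factors a n (χ y) lie in [0, 1] and tend to 1.
  have hlimg : Tendsto (fun n => ∫⁻ y in cell f₁ f₂, ‖a n (χ y) • g y - g y‖ₑ ^ 2) atTop (𝓝 0) := by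
    have hg2 : ∫⁻ y in cell f₁ f₂, ‖g y‖ₑ ^ 2 ≠ ∞ := by
      have := lintegral_rpow_enorm_lt_top_of_eLpNorm_lt_top (by norm_num) (by norm_num)
        h.memLp_grad.eLpNorm_lt_top
      simpa using this.ne
    have e0 : (0 : ℝ≥0∞) = ∫⁻ y in cell f₁ f₂, 0 := by simp
    rw [e0]
    refine tendsto_lintegral_of_dominated_convergence (fun y => ‖g y‖ₑ ^ 2) (fun n => ?_)
      (fun n => Eventually.of_forall fun y => ?_) hg2 (Eventually.of_forall fun y => ?_)
    · have : StronglyMeasurable fun y => a n (χ y) • g y - g y :=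
        (((hac n).comp_stronglyMeasurable h.meas).smul h.meas_grad).sub h.meas_grad
      exact this.enorm.pow_const 2
    · have e : a n (χ y) • g y - g y = (a n (χ y) - 1) • g y := by rw [sub_smul, one_smul]
      dsimp only
      gcongr
      rw [e, enorm_smul]
      refine mul_le_of_le_one_left zero_le ?_
      rw [← ofReal_norm, Real.norm_eq_abs]
      rw [show (1 : ℝ≥0∞) = ENNReal.ofReal 1 by simp]
      refine ENNReal.ofReal_le_ofReal (abs_le.2 ⟨?_, ?_⟩) <;> linarith [ha0 n (χ y), ha1 n (χ y)]
    · have h1 : Tendsto (fun n => a n (χ y) • g y - g y) atTop (𝓝 0) := by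
        simpa using ((hlim (χ y)).smul_const (g y)).sub_const (g y)
      have h2 := ENNReal.Tendsto.pow (n := 2) h1.enorm
      simpa using h2
  obtain ⟨n, hn⟩ := ((ENNReal.tendsto_nhds_zero.1 hlimg) δ hδ).exists
  have hθc : Continuous (θ n) := by fun_prop
  have hbd : ∀ z, |θ n z| ≤ (n + 1) * (Real.pi / 2) := by
    intro z
    rw [abs_mul, abs_of_pos (by positivity : (0 : ℝ) < n + 1)]
    gcongr
    rw [abs_le]
    exact ⟨(Real.neg_pi_div_two_lt_arctan _).le, (Real.arctan_lt_pi_div_two _).le⟩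
  have hfin : ∀ z, |θ n z| ≤ |z| := by
    intro z
    have hL : LipschitzWith 1 (θ n) := by
      refine lipschitzWith_of_nnnorm_deriv_le (fun z => (hθd n z).differentiableAt) fun z => ?_
      rw [(hθd n z).deriv, ← NNReal.coe_le_coe, coe_nnnorm, Real.norm_of_nonneg (ha0 n z)]
      exact ha1 n z
    have := hL.dist_le_mul z 0
    simpa [θ, Real.dist_eq] using this
  refine ⟨fun y => θ n (χ y), fun y => a n (χ y) • g y,
    ⟨hθc.comp_stronglyMeasurable h.meas,
      ((hac n).comp_stronglyMeasurable h.meas).smul h.meas_grad,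
      fun y k => by simp only [h.periodic y k],
      fun y k => by simp only [h.periodic y k, h.periodic_grad y k], ?_, ?_, ?_⟩,
    ⟨_, fun y => hbd _⟩, hn⟩
  · exact h.memLp.of_le (hθc.comp_stronglyMeasurable h.meas).aestronglyMeasurable
      (Eventually.of_forall fun y => hfin _)
  · refine h.memLp_grad.of_le
      (((hac n).comp_stronglyMeasurable h.meas).smul h.meas_grad).aestronglyMeasurable
      (Eventually.of_forall fun y => ?_)
    rw [norm_smul, Real.norm_of_nonneg (ha0 n _)]
    exact mul_le_of_le_one_left (norm_nonneg _) (ha1 n _)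
  -- The scalar corrector is viewed as a vector field with one component to fit the vector-valued
  -- chain rule.
  · let F : E 1 → ℝ := fun z => θ n (z 0)
    have hFd : ∀ z, HasFDerivAt F (a n (z 0) • (EuclideanSpace.proj (𝕜 := ℝ) 0 : E 1 →L[ℝ] ℝ)) z :=
      fun z => HasDerivAt.comp_hasFDerivAt (h₂ := θ n) (f := fun z : E 1 => z 0) z (hθd n (z 0))
        (EuclideanSpace.proj (𝕜 := ℝ) 0 : E 1 →L[ℝ] ℝ).hasFDerivAt
    have hFe : fderiv ℝ F = fun z => a n (z 0) • (EuclideanSpace.proj (𝕜 := ℝ) 0 : E 1 →L[ℝ] ℝ) :=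
      funext fun z => (hFd z).fderiv
    have hF1 : ContDiff ℝ 1 F := by
      rw [contDiff_one_iff_fderiv]
      refine ⟨fun z => (hFd z).differentiableAt, ?_⟩
      rw [hFe]
      exact ((hac n).comp (EuclideanSpace.proj (𝕜 := ℝ) (0 : Fin 1)).continuous).smul
        continuous_const
    have hC : ∀ z, ‖fderiv ℝ F z‖ ≤ (1 : ℝ≥0) := by
      intro z
      rw [hFe]
      refine ContinuousLinearMap.opNorm_le_bound _ (by simp) fun w => ?_
      simp only [smul_apply, PiLp.proj_apply, norm_smul, NNReal.coe_one,
        Real.norm_of_nonneg (ha0 n _)]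
      exact mul_le_mul (ha1 n _) (PiLp.norm_apply_le w 0) (norm_nonneg _) zero_le_one
    have key := WeakGrad.comp (isOpen_layer c₁ c₂) (u := fun y => (WithLp.toLp 2 fun _ => χ y : E 1))
      (g := fun _ => g) (fun _ => h.weakGrad) hF1 hC
    convert key using 1
    ext1 y
    simp [hFe]

end

/-! ### The cell problem: almost optimal linear correctors and stability of `gHom`. -/

section

variable {f₁ f₂ : E 2 → ℝ}

lemma enorm_toLp_sq {α F : Type*} [MeasurableSpace α] {μ : Measure α} [NormedAddCommGroup F]
    {f : α → F} (hf : MemLp f 2 μ) : ‖hf.toLp f‖ₑ ^ 2 = ∫⁻ x, ‖f x‖ₑ ^ 2 ∂μ := by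
  rw [Lp.enorm_toLp, eLpNorm_eq_lintegral_rpow_enorm_toReal (by norm_num) (by norm_num)]
  simp only [ENNReal.toReal_ofNat, ENNReal.rpow_ofNat, one_div]
  rw [← ENNReal.rpow_ofNat, ← ENNReal.rpow_mul]
  norm_num

/-- Almost optimal approximation of vectors by a subspace, linearly in the vector. -/
lemma exists_linear_near_projection {H : Type*} [NormedAddCommGroup H] [InnerProductSpace ℝ H]
    [CompleteSpace H] (V : Submodule ℝ H) (c : Fin 2 → H) {η : ℝ} (hη : 0 < η) :
    ∃ G : Fin 2 → H, (∀ k, G k ∈ V) ∧ ∀ (v : E 2), ∀ F ∈ V,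
      ‖∑ k, v k • (c k + G k)‖ ≤ ‖∑ k, v k • c k + F‖ + η * (|v 0| + |v 1|) := by
  set K := V.topologicalClosure
  have hcl : IsClosed (K : Set H) := V.isClosed_topologicalClosure
  have : CompleteSpace K := hcl.completeSpace_coe
  have hVK : V ≤ K := V.le_topologicalClosure
  -- Projection is onto the closure of V, where the minimizing element may fail to lie in V; it is
  -- approximated from V within η for each basis vector.
  have hex : ∀ k, ∃ g ∈ V, ‖g + K.starProjection (c k)‖ ≤ η := by
    intro k
    have hm : -K.starProjection (c k) ∈ closure (V : Set H) := by
      rw [← Submodule.topologicalClosure_coe]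
      exact K.neg_mem (K.starProjection_apply_mem _)
    obtain ⟨g, hg, hd⟩ := Metric.mem_closure_iff.1 hm η hη
    refine ⟨g, hg, ?_⟩
    rw [dist_comm, dist_eq_norm, sub_neg_eq_add] at hd
    exact hd.le
  choose G hG hGd using hex
  refine ⟨G, hG, fun v F hF => ?_⟩
  -- The component of ∑ₖ vₖcₖ orthogonal to the closure: its norm is the distance to V, hence a
  -- lower bound for every competitor.
  set q := ∑ k, v k • (c k - K.starProjection (c k)) with hq
  have hqo : q ∈ Kᗮ := Submodule.sum_mem _ fun k _ =>
    Submodule.smul_mem _ _ (Submodule.sub_starProjection_mem_orthogonal _)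
  have h1 : ‖q‖ ≤ ‖∑ k, v k • c k + F‖ := by
    set w := ∑ k, v k • K.starProjection (c k) + F with hw
    have hwK : w ∈ K := K.add_mem (Submodule.sum_mem _ fun k _ =>
      Submodule.smul_mem _ _ (K.starProjection_apply_mem _)) (hVK hF)
    have e : ∑ k, v k • c k + F = q + w := by
      simp only [hq, hw, smul_sub, Finset.sum_sub_distrib]
      abel
    rw [e]
    have h0 : inner ℝ q w = 0 := by
      rw [real_inner_comm]
      exact hqo w hwK
    have h2 := norm_add_sq_eq_norm_sq_add_norm_sq_real h0
    nlinarith [norm_nonneg q, norm_nonneg (q + w), mul_self_nonneg ‖w‖]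
  have e2 : ∑ k, v k • (c k + G k) = q + ∑ k, v k • (G k + K.starProjection (c k)) := by
    rw [hq, ← Finset.sum_add_distrib]
    refine Finset.sum_congr rfl fun k _ => ?_
    rw [← smul_add]
    congr 1
    abel
  rw [e2]
  refine (norm_add_le _ _).trans (add_le_add h1 ?_)
  refine (norm_sum_le _ _).trans ?_
  rw [Fin.sum_univ_two, norm_smul, norm_smul, Real.norm_eq_abs, Real.norm_eq_abs]
  nlinarith [mul_le_mul_of_nonneg_left (hGd 0) (abs_nonneg (v 0)),
    mul_le_mul_of_nonneg_left (hGd 1) (abs_nonneg (v 1))]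

/-- The gradients of correctors, as a subspace of `L²`. -/
def correctorSpace (f₁ f₂ : E 2 → ℝ) :
    Submodule ℝ (Lp (E 3) 2 (volume.restrict (cell f₁ f₂))) where
  carrier := {F | ∃ χ g, ∃ h : IsCorrector f₁ f₂ χ g, F = h.memLp_grad.toLp g}
  add_mem' := by
    rintro _ _ ⟨χ, g, h, rfl⟩ ⟨χ', g', h', rfl⟩
    exact ⟨_, _, h.add h', (MemLp.toLp_add _ _).symm⟩
  zero_mem' := ⟨_, _, IsCorrector.zero, by
    symm
    exact MemLp.toLp_zero _⟩
  smul_mem' := by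
    rintro c _ ⟨χ, g, h, rfl⟩
    exact ⟨_, _, h.const_mul c, (MemLp.toLp_const_smul _ _).symm⟩

/-- For one row v the cell energy is a squared distance in L² to the corrector gradients, so the
near-projections of the two basis vectors serve every v. Truncating them gives the uniform bound B.
The additive error scales with |v|², which keeps it integrable when v is the gradient of a field. -/
lemma exists_correctors (c₁ : Continuous f₁) (c₂ : Continuous f₂)
    (p₁ : IsQPeriodic f₁) (p₂ : IsQPeriodic f₂) {δ : ℝ} (hδ : 0 < δ) :
    ∃ (χ : Fin 2 → E 3 → ℝ) (g : Fin 2 → E 3 → E 3), (∀ k, IsCorrector f₁ f₂ (χ k) (g k)) ∧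
      (∃ B : ℝ, ∀ k y, |χ k y| ≤ B) ∧
      ∀ (v : E 2) (χ' : E 3 → ℝ) (g' : E 3 → E 3), IsCorrector f₁ f₂ χ' g' →
        ∫⁻ y in cell f₁ f₂, ‖join v 0 + ∑ k, v k • g k y‖ₑ ^ 2
          ≤ ENNReal.ofReal (1 + δ) * (∫⁻ y in cell f₁ f₂, ‖join v 0 + g' y‖ₑ ^ 2)
            + ENNReal.ofReal δ * ‖v‖ₑ ^ 2 := by
  have hfin : IsFiniteMeasure (volume.restrict (cell f₁ f₂)) :=
    ⟨by simpa using volume_cell_lt_top c₁ c₂ p₁ p₂⟩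
  set μ := volume.restrict (cell f₁ f₂)
  have hconst : ∀ a : E 3, MemLp (fun _ : E 3 => a) 2 μ := fun a => memLp_const a
  -- Projection and truncation each cost η(|v₀| + |v₁|). The squared total is at most 8η²|v|², and
  -- Young's inequality multiplies it by 1 + δ⁻¹.
  obtain ⟨η, hη, hηδ⟩ : ∃ η : ℝ, 0 < η ∧ (1 + δ⁻¹) * (8 * η ^ 2) ≤ δ := by
    refine ⟨Real.sqrt (δ / (8 * (1 + δ⁻¹))), by positivity, ?_⟩
    rw [Real.sq_sqrt (by positivity)]
    apply le_of_eq
    field_simp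
  let c : Fin 2 → Lp (E 3) 2 μ := fun k => (hconst (join (basisVec k) 0)).toLp _
  obtain ⟨G, hG, hGopt⟩ := exists_linear_near_projection (correctorSpace f₁ f₂) c hη
  have hex : ∀ k, ∃ χ g, ∃ h : IsCorrector f₁ f₂ χ g, (∃ B : ℝ, ∀ y, |χ y| ≤ B) ∧
      ‖h.memLp_grad.toLp g - G k‖ ≤ η := by
    intro k
    obtain ⟨χ, g, h, hk⟩ := hG k
    obtain ⟨χ', g', h', hB, hd⟩ := h.exists_bounded c₁ c₂ (δ := ENNReal.ofReal (η ^ 2))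
      (by simpa using by positivity)
    refine ⟨χ', g', h', hB, ?_⟩
    have e : ∫⁻ y in cell f₁ f₂, ‖g' y - g y‖ₑ ^ 2
        = ‖(h'.memLp_grad.sub h.memLp_grad).toLp _‖ₑ ^ 2 := (enorm_toLp_sq _).symm
    rw [e, MemLp.toLp_sub h'.memLp_grad h.memLp_grad, enorm_sq_eq_ofReal, ENNReal.ofReal_le_ofReal_iff (by positivity)] at hd
    rw [hk]
    exact le_of_sq_le_sq hd hη.le
  choose χ g h hB hd using hex
  choose B hB using hB
  refine ⟨χ, g, h, ⟨max (B 0) (B 1), fun k y => ?_⟩, fun v χ' g' h' => ?_⟩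
  · fin_cases k
    · exact (hB 0 y).trans (le_max_left _ _)
    · exact (hB 1 y).trans (le_max_right _ _)
  · have hX : MemLp (fun y => join v 0 + ∑ k, v k • g k y) 2 μ :=
      (hconst _).add (memLp_finsetSum _ fun k _ => (h k).memLp_grad.const_smul (v k))
    have hY : MemLp (fun y => join v 0 + g' y) 2 μ := (hconst _).add h'.memLp_grad
    have hjv : join v 0 = ∑ k, v k • (join (basisVec k) 0) := by
      ext i; fin_cases i <;> simp [Fin.sum_univ_two]
    have eX : hX.toLp _ = ∑ k, v k • (c k + (h k).memLp_grad.toLp (g k)) := by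
      rw [Fin.sum_univ_two]
      simp only [c, ← MemLp.toLp_add, ← MemLp.toLp_const_smul]
      refine MemLp.toLp_congr _ _ (Eventually.of_forall fun y => ?_)
      simp only [hjv, Fin.sum_univ_two, Pi.add_apply, Pi.smul_apply, smul_add]
      abel
    have eY : hY.toLp _ = ∑ k, v k • c k + h'.memLp_grad.toLp g' := by
      rw [Fin.sum_univ_two]
      simp only [c, ← MemLp.toLp_add, ← MemLp.toLp_const_smul]
      refine MemLp.toLp_congr _ _ (Eventually.of_forall fun y => ?_)
      simp only [hjv, Fin.sum_univ_two, Pi.add_apply, Pi.smul_apply]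
    have h1 : ‖hX.toLp _‖ ≤ ‖hY.toLp _‖ + 2 * η * (|v 0| + |v 1|) := by
      have h2 := hGopt v _ ⟨χ', g', h', rfl⟩
      rw [← eY] at h2
      have h3 : hX.toLp _ = ∑ k, v k • (c k + G k)
          + ∑ k, v k • ((h k).memLp_grad.toLp (g k) - G k) := by
        rw [eX, ← Finset.sum_add_distrib]
        refine Finset.sum_congr rfl fun k _ => ?_
        rw [← smul_add]
        congr 1
        abel
      have h4 : ‖∑ k, v k • ((h k).memLp_grad.toLp (g k) - G k)‖ ≤ η * (|v 0| + |v 1|) := by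
        refine (norm_sum_le _ _).trans ?_
        rw [Fin.sum_univ_two, norm_smul, norm_smul, Real.norm_eq_abs, Real.norm_eq_abs]
        nlinarith [mul_le_mul_of_nonneg_left (hd 0) (abs_nonneg (v 0)),
          mul_le_mul_of_nonneg_left (hd 1) (abs_nonneg (v 1))]
      rw [h3]
      refine (norm_add_le _ _).trans ?_
      linarith
    rw [← enorm_toLp_sq hX, ← enorm_toLp_sq hY]
    simp only [enorm_sq_eq_ofReal]
    rw [← ENNReal.ofReal_mul (by positivity), ← ENNReal.ofReal_mul (by positivity),
      ← ENNReal.ofReal_add (by positivity) (by positivity)]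
    apply ENNReal.ofReal_le_ofReal
    set a := ‖hY.toLp _‖ with ha
    set b := 2 * η * (|v 0| + |v 1|) with hb
    have ha0 : 0 ≤ a := norm_nonneg _
    have hb0 : 0 ≤ b := by positivity
    have h5 : ‖hX.toLp _‖ ^ 2 ≤ (a + b) ^ 2 := by gcongr
    have h6 : (a + b) ^ 2 ≤ (1 + δ) * a ^ 2 + (1 + δ⁻¹) * b ^ 2 := by
      have h3 : 0 ≤ δ⁻¹ * (δ * a - b) ^ 2 := by positivity
      have h4 : δ⁻¹ * (δ * a - b) ^ 2 = δ * a ^ 2 - 2 * a * b + δ⁻¹ * b ^ 2 := by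
        field_simp
        ring
      nlinarith
    have h7 : b ^ 2 ≤ 8 * η ^ 2 * ‖v‖ ^ 2 := by
      rw [hb, EuclideanSpace.norm_sq_eq, Fin.sum_univ_two]
      simp only [Real.norm_eq_abs]
      nlinarith [mul_nonneg (sq_nonneg η) (sq_nonneg (|v 0| - |v 1|))]
    have h8 : (1 + δ⁻¹) * b ^ 2 ≤ δ * ‖v‖ ^ 2 := by
      calc (1 + δ⁻¹) * b ^ 2 ≤ (1 + δ⁻¹) * (8 * η ^ 2 * ‖v‖ ^ 2) := by gcongr
        _ = (1 + δ⁻¹) * (8 * η ^ 2) * ‖v‖ ^ 2 := by ring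
        _ ≤ _ := by gcongr
    linarith

/-- The energy density appearing in `gHom`, as a sum over the components. -/
lemma ofReal_cell_density (ξ : Matrix (Fin 3) (Fin 2) ℝ) (G : E 3 → Matrix (Fin 3) (Fin 3) ℝ)
    (y : E 3) :
    ENNReal.ofReal ((∑ i : Fin 3, ∑ j : Fin 2, (ξ i j + G y i j.castSucc) ^ 2)
      + ∑ i : Fin 3, (G y i 2) ^ 2)
      = ∑ i, ‖join (WithLp.toLp 2 (ξ i)) 0 + rowVec G i y‖ₑ ^ 2 := by
  simp only [enorm_sq_eq_ofReal]
  rw [← ENNReal.ofReal_sum_of_nonneg fun _ _ => by positivity, ← Finset.sum_add_distrib]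
  congr 1
  refine Finset.sum_congr rfl fun i _ => ?_
  simp [EuclideanSpace.norm_sq_eq, Fin.sum_univ_three, Fin.sum_univ_two]

lemma gHom_le {ξ : Matrix (Fin 3) (Fin 2) ℝ} {φ : E 3 → E 3} {G : E 3 → Matrix (Fin 3) (Fin 3) ℝ}
    (h : IsH1Periodic f₁ f₂ φ G) :
    gHom f₁ f₂ ξ ≤ ∫⁻ y in cell f₁ f₂,
      ∑ i, ‖join (WithLp.toLp 2 (ξ i)) 0 + rowVec G i y‖ₑ ^ 2 := by
  simp only [← ofReal_cell_density]
  exact iInf_le_of_le φ (iInf_le_of_le G (iInf_le_of_le h le_rfl))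

lemma le_gHom {ξ : Matrix (Fin 3) (Fin 2) ℝ} {a : ℝ≥0∞}
    (h : ∀ φ G, IsH1Periodic f₁ f₂ φ G → a ≤ ∫⁻ y in cell f₁ f₂,
      ∑ i, ‖join (WithLp.toLp 2 (ξ i)) 0 + rowVec G i y‖ₑ ^ 2) :
    a ≤ gHom f₁ f₂ ξ := by
  simp only [← ofReal_cell_density] at h
  exact le_iInf fun φ => le_iInf fun G => le_iInf fun hG => h φ G hG

/-- An affine bound valid for all competitors passes to the infimum once it is solved for the cell
energy, which is legitimate because κ is positive and finite. -/
lemma le_mul_gHom_add {ξ : Matrix (Fin 3) (Fin 2) ℝ} {a b : ℝ≥0∞} {κ : ℝ} (hκ : 0 < κ)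
    (h : ∀ φ G, IsH1Periodic f₁ f₂ φ G →
      a ≤ ENNReal.ofReal κ * (∫⁻ y in cell f₁ f₂,
        ∑ i, ‖join (WithLp.toLp 2 (ξ i)) 0 + rowVec G i y‖ₑ ^ 2) + b) :
    a ≤ ENNReal.ofReal κ * gHom f₁ f₂ ξ + b := by
  have hk0 : ENNReal.ofReal κ ≠ 0 := by simpa using hκ
  rw [← tsub_le_iff_right, mul_comm, ← ENNReal.div_le_iff_le_mul (Or.inl hk0) (Or.inl ENNReal.ofReal_ne_top)]
  refine le_gHom fun φ G hG => ?_
  rw [ENNReal.div_le_iff_le_mul (Or.inl hk0) (Or.inl ENNReal.ofReal_ne_top), mul_comm, tsub_le_iff_right]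
  exact h φ G hG

lemma aemeasurable_density (ξ : Matrix (Fin 3) (Fin 2) ℝ) {φ : E 3 → E 3}
    {G : E 3 → Matrix (Fin 3) (Fin 3) ℝ} (h : IsH1Periodic f₁ f₂ φ G) (i : Fin 3) :
    AEMeasurable (fun y => ‖join (WithLp.toLp 2 (ξ i)) 0 + rowVec G i y‖ₑ ^ 2)
      (volume.restrict (cell f₁ f₂)) := by
  have : AEStronglyMeasurable (rowVec G i) (volume.restrict (cell f₁ f₂)) :=
    (memLp_of_coord fun j => h.memLp_grad i j).aestronglyMeasurable
  exact (aestronglyMeasurable_const.add this).enorm.pow_const 2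

/-- The linear correctors are almost optimal in the cell problem, uniformly in `ξ`. -/
lemma sum_lintegral_correctors_le (c₁ : Continuous f₁) (c₂ : Continuous f₂)
    (p₁ : IsQPeriodic f₁) (p₂ : IsQPeriodic f₂) {δ : ℝ} (hδ : 0 < δ) {g : Fin 2 → E 3 → E 3}
    (hg : ∀ (v : E 2) (χ' : E 3 → ℝ) (g' : E 3 → E 3), IsCorrector f₁ f₂ χ' g' →
        ∫⁻ y in cell f₁ f₂, ‖join v 0 + ∑ k, v k • g k y‖ₑ ^ 2
          ≤ ENNReal.ofReal (1 + δ) * (∫⁻ y in cell f₁ f₂, ‖join v 0 + g' y‖ₑ ^ 2)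
            + ENNReal.ofReal δ * ‖v‖ₑ ^ 2) (w : Fin 3 → E 2) :
    ∑ i, ∫⁻ y in cell f₁ f₂, ‖join (w i) 0 + ∑ k, w i k • g k y‖ₑ ^ 2
      ≤ ENNReal.ofReal (1 + δ) * gHom f₁ f₂ (fun i => w i)
        + ENNReal.ofReal δ * ∑ i, ‖w i‖ₑ ^ 2 := by
  refine le_mul_gHom_add (by linarith) fun φ G hG => ?_
  · have hs := lintegral_finsetSum' Finset.univ fun i _ =>
      aemeasurable_density (fun i => (w i).ofLp) hG i
    simp only [WithLp.toLp_ofLp] at hs ⊢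
    rw [hs, Finset.mul_sum,
      Finset.mul_sum, ← Finset.sum_add_distrib]
    refine Finset.sum_le_sum fun i _ => ?_
    obtain ⟨χ', g', h', e⟩ := hG.exists_isCorrector c₁ c₂ p₁ p₂ i
    refine (hg (w i) χ' g' h').trans (le_of_eq ?_)
    congr 2
    refine lintegral_congr_ae ?_
    filter_upwards [e] with y hy
    simp only [hy]

/-- Any competitor for z is used for w. The gradients then differ by a constant over the cell, hence
the volume factor after Young's inequality. No minimizer is needed. -/
lemma gHom_le_add {δ : ℝ} (hδ : 0 < δ) (w z : Fin 3 → E 2) :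
    gHom f₁ f₂ (fun i => w i) ≤ ENNReal.ofReal (1 + δ) * gHom f₁ f₂ (fun i => z i)
      + ENNReal.ofReal (1 + δ⁻¹) * volume (cell f₁ f₂) * ∑ i, ‖w i - z i‖ₑ ^ 2 := by
  refine le_mul_gHom_add (by linarith) fun φ G hG => ?_
  · refine (gHom_le hG).trans ?_
    rw [← lintegral_const_mul' _ _ ENNReal.ofReal_ne_top]
    have e : ENNReal.ofReal (1 + δ⁻¹) * volume (cell f₁ f₂) * ∑ i, ‖w i - z i‖ₑ ^ 2
        = ∫⁻ _ in cell f₁ f₂, ENNReal.ofReal (1 + δ⁻¹) * ∑ i, ‖w i - z i‖ₑ ^ 2 := by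
      rw [setLIntegral_const]; ring
    rw [e, ← lintegral_add_right _ measurable_const]
    refine lintegral_mono fun y => ?_
    simp only [Finset.mul_sum]
    rw [← Finset.sum_add_distrib]
    refine Finset.sum_le_sum fun i _ => ?_
    have h1 : join (w i) 0 + rowVec G i y
        = (join (z i) 0 + rowVec G i y) + join (w i - z i) 0 := by
      have : join (w i) 0 = join (z i) 0 + join (w i - z i) 0 := by
        rw [← join_add]; simp
      rw [this]; abel
    have h2 : ‖join (w i - z i) 0‖ₑ ^ 2 = ‖w i - z i‖ₑ ^ 2 := by
      rw [enorm_sq_eq_ofReal, enorm_sq_eq_ofReal, norm_sq_join]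
      simp
    have := enorm_add_sq_le hδ (join (z i) 0 + rowVec G i y) (join (w i - z i) 0)
    rw [← h1, h2] at this
    exact this

/-- Extending ∇m₀ by zero outside ω therefore adds nothing to the limit energy. -/
lemma gHom_zero : gHom f₁ f₂ 0 = 0 := by
  have h : IsH1Periodic f₁ f₂ (fun _ => 0) (fun _ => 0) :=
    ⟨fun _ _ => rfl, fun _ _ => rfl, MemLp.zero, fun _ _ => MemLp.zero, by
      intro ψ _ _ _ i j; simp⟩
  refine le_antisymm (iInf_le_of_le _ (iInf_le_of_le _ (iInf_le_of_le h ?_))) zero_le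
  simp

end

/-! ### Radial projection onto the sphere. -/

section

/-- A smooth extension of the radial projection `v ↦ v / |v|` to all of `ℝ³`. -/
noncomputable def sphereProj (v : E 3) : E 3 :=
  (1 - (⟨1 / 4, 1 / 2, by norm_num, by norm_num⟩ : ContDiffBump (0 : E 3)) v) • (‖v‖⁻¹ • v)

lemma sphereProj_of_le {v : E 3} (hv : 1 / 2 ≤ ‖v‖) : sphereProj v = ‖v‖⁻¹ • v := by
  rw [sphereProj, ContDiffBump.zero_of_le_dist _ (by simpa using hv), sub_zero, one_smul]

lemma norm_sphereProj {v : E 3} (hv : 1 / 2 ≤ ‖v‖) : ‖sphereProj v‖ = 1 := by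
  rw [sphereProj_of_le hv, norm_smul, norm_inv, norm_norm]
  exact inv_mul_cancel₀ (by positivity)

lemma sphereProj_of_norm_eq_one {v : E 3} (hv : ‖v‖ = 1) : sphereProj v = v := by
  rw [sphereProj_of_le (by rw [hv]; norm_num), hv, inv_one, one_smul]

lemma contDiff_sphereProj : ContDiff ℝ 1 sphereProj := by
  rw [contDiff_iff_contDiffAt]
  intro v
  let b : ContDiffBump (0 : E 3) := ⟨1 / 4, 1 / 2, by norm_num, by norm_num⟩
  have hs : sphereProj = fun v => (1 - b v) • (‖v‖⁻¹ • v) := rfl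
  by_cases hv : v = 0
  · subst hv
    have : sphereProj =ᶠ[𝓝 0] fun _ => 0 := by
      filter_upwards [b.eventuallyEq_one] with w hw
      rw [hs]
      simp [hw]
    exact contDiffAt_const.congr_of_eventuallyEq this
  · rw [hs]
    refine (contDiffAt_const.sub b.contDiffAt).smul ?_
    exact ((contDiffAt_norm ℝ hv).inv (by simpa using hv)).smul contDiffAt_id

/-- The squared distance of the projections equals (|v - w|² - (|v| - |w|)²) / (|v||w|), hence is at
most |v - w|² / r². The exterior of a ball is not convex, so this is obtained by algebra instead of
integrating a derivative bound along segments. The constant tends to 1 with r, and so no energy is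
lost in the limit. -/
lemma norm_sphereProj_sub_le {r : ℝ} (hr : 1 / 2 ≤ r) {v w : E 3} (hv : r ≤ ‖v‖) (hw : r ≤ ‖w‖) :
    ‖sphereProj v - sphereProj w‖ ≤ r⁻¹ * ‖v - w‖ := by
  rw [sphereProj_of_le (hr.trans hv), sphereProj_of_le (hr.trans hw)]
  have hr0 : 0 < r := by linarith
  have hv0 : 0 < ‖v‖ := hr0.trans_le hv
  have hw0 : 0 < ‖w‖ := hr0.trans_le hw
  refine le_of_sq_le_sq ?_ (by positivity)
  have e1 : ‖‖v‖⁻¹ • v - ‖w‖⁻¹ • w‖ ^ 2 = 2 - 2 * (‖v‖⁻¹ * ‖w‖⁻¹ * inner ℝ v w) := by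
    rw [norm_sub_sq_real, norm_smul, norm_smul, inner_smul_left, inner_smul_right]
    simp only [norm_inv, norm_norm, inv_mul_cancel₀ hv0.ne', inv_mul_cancel₀ hw0.ne',
      RCLike.conj_to_real]
    ring
  have e2 : (‖v‖⁻¹ * ‖w‖⁻¹) * ‖v - w‖ ^ 2
      = (‖v‖⁻¹ * ‖w‖⁻¹) * (‖v‖ ^ 2 + ‖w‖ ^ 2) - 2 * (‖v‖⁻¹ * ‖w‖⁻¹ * inner ℝ v w) := by
    rw [norm_sub_sq_real]; ring
  have e3 : 2 ≤ (‖v‖⁻¹ * ‖w‖⁻¹) * (‖v‖ ^ 2 + ‖w‖ ^ 2) := by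
    rw [← mul_inv, inv_mul_eq_div, le_div_iff₀ (by positivity)]
    nlinarith [sq_nonneg (‖v‖ - ‖w‖)]
  have e4 : ‖v‖⁻¹ * ‖w‖⁻¹ ≤ r⁻¹ * r⁻¹ := by gcongr
  have e5 : (‖v‖⁻¹ * ‖w‖⁻¹) * ‖v - w‖ ^ 2 ≤ (r⁻¹ * r⁻¹) * ‖v - w‖ ^ 2 := by gcongr
  rw [e1, mul_pow, sq r⁻¹]
  linarith

lemma norm_fderiv_sphereProj_le {r : ℝ} (hr : 1 / 2 ≤ r) {v : E 3} (hv : r < ‖v‖) :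
    ‖fderiv ℝ sphereProj v‖ ≤ r⁻¹ := by
  have hr0 : 0 < r := by linarith
  have hL : LipschitzOnWith (Real.toNNReal r⁻¹) sphereProj {w | r < ‖w‖} := by
    refine LipschitzOnWith.of_dist_le_mul fun x hx y hy => ?_
    rw [dist_eq_norm, dist_eq_norm, Real.coe_toNNReal _ (by positivity)]
    exact norm_sphereProj_sub_le hr (le_of_lt hx) (le_of_lt hy)
  have := norm_fderiv_le_of_lipschitzOn ℝ ((isOpen_lt continuous_const continuous_norm).mem_nhds hv) hL
  rwa [Real.coe_toNNReal _ (by positivity)] at this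

/-- A crude global bound, needed only to apply the chain rule; the energy estimate uses the sharp
constant 1/r. -/
lemma exists_bound_fderiv_sphereProj : ∃ C : ℝ≥0, ∀ v, ‖fderiv ℝ sphereProj v‖ ≤ C := by
  obtain ⟨C, hC⟩ := (isCompact_closedBall (0 : E 3) 1).exists_bound_of_continuousOn
    (contDiff_sphereProj.continuous_fderiv one_ne_zero).continuousOn
  refine ⟨Real.toNNReal (max C 2), fun v => ?_⟩
  rw [Real.coe_toNNReal _ (by positivity)]
  by_cases hv : ‖v‖ ≤ 1
  · exact (hC v (by simpa using hv)).trans (le_max_left _ _)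
  · refine (norm_fderiv_sphereProj_le le_rfl (by linarith)).trans ?_
    rw [one_div, inv_inv]
    exact le_max_right _ _

/-- The gradient of `sphereProj ∘ v` in terms of the gradients of the components of `v`. -/
noncomputable def projGrad (v : E 3 → E 3) (g : Fin 3 → E 3 → E 3) (x : E 3) :
    Matrix (Fin 3) (Fin 3) ℝ :=
  fun i j => ∑ k, fderiv ℝ sphereProj (v x) (basisVec k) i * g k x j

lemma projGrad_col (v : E 3 → E 3) (g : Fin 3 → E 3 → E 3) (x : E 3) (i j : Fin 3) :
    projGrad v g x i j
      = fderiv ℝ sphereProj (v x) (WithLp.toLp 2 fun k => g k x j) i := by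
  have : (WithLp.toLp 2 fun k => g k x j : E 3) = ∑ k, g k x j • (basisVec k : E 3) := by
    ext l; simp [Finset.sum_apply, Pi.single_apply]
  rw [this, map_sum]
  simp [projGrad, mul_comm]

lemma sum_projGrad_sq_le {v : E 3 → E 3} {g : Fin 3 → E 3 → E 3} {x : E 3} {C : ℝ}
    (h : ‖fderiv ℝ sphereProj (v x)‖ ≤ C) (j : Fin 3) :
    ∑ i, projGrad v g x i j ^ 2 ≤ C ^ 2 * ∑ k, g k x j ^ 2 := by
  simp only [projGrad_col]
  set z : E 3 := WithLp.toLp 2 fun k => g k x j with hz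
  have e1 : ∑ i, (fderiv ℝ sphereProj (v x) z i) ^ 2 = ‖fderiv ℝ sphereProj (v x) z‖ ^ 2 := by
    simp [EuclideanSpace.norm_sq_eq]
  have e2 : ∑ k, g k x j ^ 2 = ‖z‖ ^ 2 := by
    simp [EuclideanSpace.norm_sq_eq, hz]
  rw [e1, e2, ← mul_pow]
  have : ‖fderiv ℝ sphereProj (v x) z‖ ≤ C * ‖z‖ :=
    (ContinuousLinearMap.le_opNorm _ _).trans (by gcongr)
  gcongr

/-- Multiplication of the third coordinate by `ε⁻¹`. -/
noncomputable def stretch (ε : ℝ) (z : E 3) : E 3 := join (plane z) (ε⁻¹ * z 2)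

/-- The differential of the projection acts on each partial derivative separately, so it does not
mix the vertical one, weighted by ε⁻², with the others. -/
lemma energy_density_projGrad_le {v : E 3 → E 3} {g : Fin 3 → E 3 → E 3} {x : E 3} {C : ℝ}
    (h : ‖fderiv ℝ sphereProj (v x)‖ ≤ C) (ε : ℝ) :
    ENNReal.ofReal ((∑ i : Fin 3, ∑ j : Fin 2, (projGrad v g x i j.castSucc) ^ 2)
      + (1 / ε ^ 2) * ∑ i : Fin 3, (projGrad v g x i 2) ^ 2)
      ≤ ENNReal.ofReal (C ^ 2) * ∑ k, ‖stretch ε (g k x)‖ₑ ^ 2 := by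
  simp only [enorm_sq_eq_ofReal]
  rw [← ENNReal.ofReal_sum_of_nonneg fun _ _ => by positivity,
    ← ENNReal.ofReal_mul (by positivity)]
  apply ENNReal.ofReal_le_ofReal
  rw [Finset.sum_comm, Fin.sum_univ_two]
  have h0 := sum_projGrad_sq_le h (g := g) 0
  have h1 := sum_projGrad_sq_le h (g := g) 1
  have h2 := sum_projGrad_sq_le h (g := g) 2
  have e : ∑ k, ‖stretch ε (g k x)‖ ^ 2 = ∑ k, g k x 0 ^ 2 + ∑ k, g k x 1 ^ 2
      + (1 / ε ^ 2) * ∑ k, g k x 2 ^ 2 := by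
    rw [Finset.mul_sum, ← Finset.sum_add_distrib, ← Finset.sum_add_distrib]
    refine Finset.sum_congr rfl fun k _ => ?_
    rw [stretch, norm_sq_join]
    simp [EuclideanSpace.norm_sq_eq, Fin.sum_univ_two, mul_pow]
  rw [e]
  have h3 : (1 / ε ^ 2) * ∑ i, projGrad v g x i 2 ^ 2
      ≤ (1 / ε ^ 2) * (C ^ 2 * ∑ k, g k x 2 ^ 2) := by gcongr
  simp only [Fin.castSucc_zero, Fin.castSucc_one] at *
  linarith

lemma WeakGrad.sphereProj {U : Set (E 3)} (hU : IsOpen U) {v : E 3 → E 3}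
    {g : Fin 3 → E 3 → E 3} (h : ∀ k, WeakGrad U (fun x => v x k) (g k)) (i : Fin 3) :
    WeakGrad U (fun x => sphereProj (v x) i) (rowVec (projGrad v g) i) := by
  obtain ⟨C, hC⟩ := exists_bound_fderiv_sphereProj
  let p : E 3 →L[ℝ] ℝ := EuclideanSpace.proj (𝕜 := ℝ) i
  have hp : ‖p‖ ≤ 1 := ContinuousLinearMap.opNorm_le_bound _ zero_le_one fun w => by
    rw [one_mul]; exact PiLp.norm_apply_le w i
  have hF : ContDiff ℝ 1 fun z => RoughFilm.sphereProj z i := p.contDiff.comp contDiff_sphereProj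
  have hd : ∀ z, fderiv ℝ (fun z => RoughFilm.sphereProj z i) z
      = p.comp (fderiv ℝ RoughFilm.sphereProj z) := fun z =>
    (p.hasFDerivAt.comp z
      (contDiff_sphereProj.differentiable one_ne_zero z).hasFDerivAt).fderiv
  have hb : ∀ z, ‖fderiv ℝ (fun z => RoughFilm.sphereProj z i) z‖ ≤ C := fun z => by
    rw [hd]
    refine (ContinuousLinearMap.opNorm_comp_le _ _).trans ?_
    nlinarith [hC z, norm_nonneg p, norm_nonneg (fderiv ℝ RoughFilm.sphereProj z)]
  convert WeakGrad.comp hU h hF hb using 1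
  ext x j
  simp [projGrad, hd, p, Finset.sum_apply]

end

/-! ### The perturbed field and its rescaled gradient. -/

section

variable {f₁ f₂ : E 2 → ℝ}

/-- `rescale ε` as a continuous linear equivalence. -/
noncomputable def rescaleEquiv {ε : ℝ} (hε : 0 < ε) : E 3 ≃L[ℝ] E 3 :=
  LinearEquiv.toContinuousLinearEquiv
    { toFun := rescale ε
      invFun := rescale ε⁻¹
      map_add' := fun x y => by
        simp only [rescale, plane_add, smul_add, PiLp.add_apply, join_add]
      map_smul' := fun c x => by
        simp only [rescale, plane_smul, PiLp.smul_apply, smul_eq_mul, RingHom.id_apply]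
        rw [smul_comm, join_smul]
      left_inv := fun x => by
        simp [rescale, smul_smul, mul_inv_cancel₀ hε.ne']
      right_inv := fun x => by
        simp [rescale, smul_smul, inv_mul_cancel₀ hε.ne'] }

@[simp] lemma rescaleEquiv_apply {ε : ℝ} (hε : 0 < ε) (x : E 3) :
    rescaleEquiv hε x = rescale ε x := rfl

/-- A diagonal map is its own transpose, so `rescale` acts on the gradient as well. -/
lemma WeakGrad.comp_rescale {ε : ℝ} (hε : 0 < ε) {U : Set (E 3)} {χ : E 3 → ℝ} {g : E 3 → E 3}
    (h : WeakGrad U χ g) :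
    WeakGrad (rescale ε ⁻¹' U) (fun x => χ (rescale ε x))
      (fun x => rescale ε (g (rescale ε x))) := by
  have := h.comp_diagonal (rescaleEquiv hε) (c := ![ε⁻¹, ε⁻¹, 1]) (by
    intro j
    ext i
    fin_cases j <;> fin_cases i <;> simp [rescale])
  have e : (fun x => rescale ε (g (rescale ε x)))
      = fun x => WithLp.toLp 2 fun j => (![ε⁻¹, ε⁻¹, 1] : Fin 3 → ℝ) j * g (rescale ε x) j := by
    ext x j
    fin_cases j <;> simp [rescale]
  rw [e]
  exact this

lemma classicalGrad_comp_plane {η : E 2 → ℝ} (hη : Differentiable ℝ η) (x : E 3) :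
    classicalGrad (fun x => η (plane x)) x = join (classicalGrad η (plane x)) 0 := by
  have h : HasFDerivAt (fun x => η (plane x)) ((fderiv ℝ η (plane x)).comp planeL) x :=
    (hη (plane x)).hasFDerivAt.comp x planeL.hasFDerivAt
  ext j
  rw [classicalGrad_apply, h.fderiv, ContinuousLinearMap.comp_apply, planeL_apply]
  rcases Fin.eq_castSucc_or_eq_last j with ⟨k, rfl⟩ | rfl
  · rw [plane_single, join_castSucc, classicalGrad_apply]
  · have : plane (basisVec (Fin.last 2)) = 0 := by
      ext i; fin_cases i <;> simp [Fin.last]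
    rw [this, map_zero]
    rfl

lemma memLp_film_comp_plane {M : ℝ} (h₁ : ∀ y, |f₁ y| ≤ M) (h₂ : ∀ y, |f₂ y| ≤ M) {ω : Set (E 2)} (ε : ℝ)
    {F : Type*} [NormedAddCommGroup F] {f : E 2 → F} (hf : MemLp f 2 (volume.restrict ω)) :
    MemLp (fun x => f (plane x)) 2 (volume.restrict (film f₁ f₂ ω ε)) := by
  have hq : Measure.QuasiMeasurePreserving plane (volume.restrict (film f₁ f₂ ω ε))
      (volume.restrict ω) := quasiMeasurePreserving_plane.restrict fun x hx => hx.1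
  refine ⟨hf.aestronglyMeasurable.comp_quasiMeasurePreserving hq, ?_⟩
  rw [eLpNorm_lt_top_iff_lintegral_rpow_enorm_lt_top (by norm_num) (by norm_num)]
  have h3 := lintegral_rpow_enorm_lt_top_of_eLpNorm_lt_top (by norm_num) (by norm_num)
    hf.eLpNorm_lt_top
  refine lt_of_le_of_lt (lintegral_film_comp_plane_le h₁ h₂ ε
    (a := fun x => ‖f x‖ₑ ^ (2 : ℝ≥0∞).toReal) (hf.aestronglyMeasurable.enorm.pow_const _)) ?_
  exact ENNReal.mul_lt_top ENNReal.ofReal_lt_top h3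

lemma norm_le_two_of_mem_unitSquare {t : E 2} (ht : t ∈ unitSquare) : ‖t‖ ≤ 2 := by
  refine le_of_sq_le_sq ?_ (by norm_num)
  rw [EuclideanSpace.norm_sq_eq, Fin.sum_univ_two]
  have h0 := ht 0
  have h1 := ht 1
  simp only [Real.norm_eq_abs, sq_abs]
  nlinarith [h0.1, h0.2, h1.1, h1.2]

lemma memLp_film_comp_rescale (c₁ : Continuous f₁) (c₂ : Continuous f₂) (p₁ : IsQPeriodic f₁)
    (p₂ : IsQPeriodic f₂) {ω : Set (E 2)} (hb : Bornology.IsBounded ω)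
    (hω : MeasurableSet ω) {ε : ℝ} (hε : 0 < ε) {F : Type*} [NormedAddCommGroup F]
    {g : E 3 → F} (hm : StronglyMeasurable g) (hp : HPeriodic g)
    (hg : MemLp g 2 (volume.restrict (cell f₁ f₂))) :
    MemLp (fun x => g (rescale ε x)) 2 (volume.restrict (film f₁ f₂ ω ε)) := by
  refine ⟨(hm.comp_measurable (measurable_rescale ε)).aestronglyMeasurable, ?_⟩
  rw [eLpNorm_lt_top_iff_lintegral_rpow_enorm_lt_top (by norm_num) (by norm_num)]
  have h3 := lintegral_rpow_enorm_lt_top_of_eLpNorm_lt_top (by norm_num) (by norm_num)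
    hg.eLpNorm_lt_top
  obtain ⟨R, hR⟩ := hb.subset_closedBall 0
  -- The averaging inequality integrates over the whole plane, so a cutoff around ω is needed for
  -- finiteness. Shifts εt have length at most 2ε, which is the enlargement of the ball in the
  -- majorant.
  let ind : ℝ → E 2 → ℝ≥0∞ := fun R => (Metric.closedBall (0 : E 2) R).indicator fun _ => 1
  have hind : ∀ R, Measurable (ind R) := fun R =>
    measurable_const.indicator Metric.isClosed_closedBall.measurableSet
  have hgm : Measurable fun y => ‖g y‖ₑ ^ (2 : ℝ≥0∞).toReal := hm.enorm.pow_const _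
  have hmm : ∀ R, Measurable (Function.uncurry fun x y => ind R x * ‖g y‖ₑ ^ (2 : ℝ≥0∞).toReal) :=
    fun R => ((hind R).comp measurable_fst).mul (hgm.comp measurable_snd)
  have key := lintegral_film_le c₁ c₂ p₁ p₂ ω hε
    (h := fun x y => ind R x * ‖g y‖ₑ ^ (2 : ℝ≥0∞).toReal)
    (H := fun x y => ind (R + ε * 2) x * ‖g y‖ₑ ^ (2 : ℝ≥0∞).toReal)
    (hmm _) (hmm _) (fun x y n => by simp only [hp y n]) (by
      intro x t ht y
      gcongr
      by_cases hx : x + ε • t ∈ Metric.closedBall (0 : E 2) R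
      · have hx' : x ∈ Metric.closedBall (0 : E 2) (R + ε * 2) := by
          rw [mem_closedBall_zero_iff] at hx ⊢
          have ht2 := norm_le_two_of_mem_unitSquare ht
          have : x = (x + ε • t) - ε • t := by abel
          rw [this]
          refine (norm_sub_le _ _).trans (add_le_add hx ?_)
          rw [norm_smul, Real.norm_of_nonneg hε.le]
          gcongr
        simp only [ind, Set.indicator_of_mem hx, Set.indicator_of_mem hx', le_refl]
      · simp only [ind, Set.indicator_of_notMem hx, zero_le])
  have e1 : ∫⁻ x in film f₁ f₂ ω ε, ‖g (rescale ε x)‖ₑ ^ (2 : ℝ≥0∞).toReal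
      = ∫⁻ x in film f₁ f₂ ω ε, ind R (plane x) * ‖g (rescale ε x)‖ₑ ^ (2 : ℝ≥0∞).toReal := by
    refine setLIntegral_congr_fun (measurableSet_film c₁ c₂ hω ε) fun x hx => ?_
    simp only [ind, Set.indicator_of_mem (hR hx.1), one_mul]
  rw [e1]
  refine lt_of_le_of_lt key ?_
  simp only [lintegral_const_mul _ hgm]
  rw [lintegral_mul_const _ (hind _)]
  refine ENNReal.mul_lt_top ?_ h3
  rw [lintegral_indicator Metric.isClosed_closedBall.measurableSet]
  have hfin : volume (Metric.closedBall (0 : E 2) (R + ε * 2)) < ∞ :=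
    (isCompact_closedBall _ _).measure_lt_top
  simpa using hfin

/-- The perturbation of `m₀` by oscillating correctors. -/
noncomputable def perturb (ε : ℝ) (m₀ : E 2 → E 3) (χ : Fin 2 → E 3 → ℝ) (W : Fin 3 → E 2 → E 2)
    (x : E 3) : E 3 :=
  WithLp.toLp 2 fun i =>
    m₀ (plane x) i + ε * ∑ k, χ k (rescale ε x) * W i (plane x) k

/-- The gradients of the components of `perturb`. -/
noncomputable def perturbGrad (ε : ℝ) (D : E 2 → Matrix (Fin 3) (Fin 2) ℝ) (χ : Fin 2 → E 3 → ℝ)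
    (g : Fin 2 → E 3 → E 3) (W : Fin 3 → E 2 → E 2) (i : Fin 3) (x : E 3) : E 3 :=
  join (rowVec D i (plane x)) 0 + ε • ∑ k, (W i (plane x) k • rescale ε (g k (rescale ε x))
    + χ k (rescale ε x) • join (classicalGrad (fun x' => W i x' k) (plane x)) 0)

lemma _root_.ContDiff.coord {d m : ℕ} {n : ℕ∞} {W : E d → E m} (hW : ContDiff ℝ n W) (k : Fin m) :
    ContDiff ℝ n fun x => W x k :=
  (EuclideanSpace.proj (𝕜 := ℝ) k : E m →L[ℝ] ℝ).contDiff.comp hW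

lemma weakGrad_perturb {ω : Set (E 2)} (hω : IsOpen ω)
    (c₁ : Continuous f₁) (c₂ : Continuous f₂) {ε : ℝ} (hε : 0 < ε)
    {m₀ : E 2 → E 3} {D : E 2 → Matrix (Fin 3) (Fin 2) ℝ}
    (hm : ∀ i, WeakGrad ω (fun x => m₀ x i) (rowVec D i))
    {χ : Fin 2 → E 3 → ℝ} {g : Fin 2 → E 3 → E 3} (hχ : ∀ k, WeakGrad (layer f₁ f₂) (χ k) (g k))
    {W : Fin 3 → E 2 → E 2} (hW : ∀ i, ContDiff ℝ (⊤ : ℕ∞) (W i)) (i : Fin 3) :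
    WeakGrad (film f₁ f₂ ω ε) (fun x => perturb ε m₀ χ W x i) (perturbGrad ε D χ g W i) := by
  have hfilm := isOpen_film c₁ c₂ hω ε
  rw [film_eq] at hfilm ⊢
  have h1 := ((hm i).comp_plane hω).mono (V := plane ⁻¹' ω ∩ rescale ε ⁻¹' layer f₁ f₂)
    Set.inter_subset_left
  have h2 : ∀ k, WeakGrad (plane ⁻¹' ω ∩ rescale ε ⁻¹' layer f₁ f₂)
      (fun x => χ k (rescale ε x) * W i (plane x) k)
      (fun x => W i (plane x) k • rescale ε (g k (rescale ε x))
        + χ k (rescale ε x) • join (classicalGrad (fun x' => W i x' k) (plane x)) 0) := by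
    intro k
    have h3 := (((hχ k).comp_rescale hε).mono
      (V := plane ⁻¹' ω ∩ rescale ε ⁻¹' layer f₁ f₂) Set.inter_subset_right).mul_smooth hfilm
      (η := fun x => W i (plane x) k) (((hW i).coord k).comp contDiff_plane)
    simpa only [classicalGrad_comp_plane (((hW i).coord k).differentiable (by simp))] using h3
  exact h1.add ((WeakGrad.sum Finset.univ fun k _ => h2 k).const_mul ε)

lemma stretch_add (ε : ℝ) (a b : E 3) : stretch ε (a + b) = stretch ε a + stretch ε b := by
  ext i; fin_cases i <;> simp [stretch, mul_add]

lemma stretch_smul (ε c : ℝ) (a : E 3) : stretch ε (c • a) = c • stretch ε a := by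
  ext i
  fin_cases i <;> simp [stretch]
  ring

lemma stretch_join_zero (ε : ℝ) (a : E 2) : stretch ε (join a 0) = join a 0 := by
  ext i; fin_cases i <;> simp [stretch]

lemma smul_stretch_rescale {ε : ℝ} (hε : 0 < ε) (a : E 3) : ε • stretch ε (rescale ε a) = a := by
  ext i; fin_cases i <;> simp [stretch, rescale, hε.ne']

/-- Because ε • `stretch ε` inverts `rescale ε`, the fast derivatives have order one in all three
directions. The first bracket carries the energy; the rest is small in L² or of order ε. -/
lemma stretch_perturbGrad {ε : ℝ} (hε : 0 < ε) (D : E 2 → Matrix (Fin 3) (Fin 2) ℝ)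
    (χ : Fin 2 → E 3 → ℝ) (g : Fin 2 → E 3 → E 3) (W : Fin 3 → E 2 → E 2) (i : Fin 3) (x : E 3) :
    stretch ε (perturbGrad ε D χ g W i x)
      = (join (W i (plane x)) 0 + ∑ k, W i (plane x) k • g k (rescale ε x))
        + (join (rowVec D i (plane x) - W i (plane x)) 0
          + ε • ∑ k, χ k (rescale ε x) •
            join (classicalGrad (fun x' => W i x' k) (plane x)) 0) := by
  have h1 : join (rowVec D i (plane x)) 0
      = join (W i (plane x)) 0 + join (rowVec D i (plane x) - W i (plane x)) 0 := by
    rw [← join_add]; simp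
  have h2 : ∀ k, ε • stretch ε (W i (plane x) k • rescale ε (g k (rescale ε x)))
      = W i (plane x) k • g k (rescale ε x) := fun k => by
    rw [stretch_smul, smul_comm, smul_stretch_rescale hε]
  have h3 : ∀ k, stretch ε (χ k (rescale ε x) •
      join (classicalGrad (fun x' => W i x' k) (plane x)) 0)
      = χ k (rescale ε x) • join (classicalGrad (fun x' => W i x' k) (plane x)) 0 := fun k => by
    rw [stretch_smul, stretch_join_zero]
  simp only [perturbGrad, stretch_add, stretch_smul ε ε, stretch_join_zero, Fin.sum_univ_two,
    smul_add, h2, h3, h1]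
  abel

end

/-! ### Energy of the oscillating part on the film. -/

section

variable {f₁ f₂ : E 2 → ℝ}

lemma measurable_join_left : Measurable fun v : E 2 => join v 0 := joinL.continuous.measurable

lemma norm_join_zero (v : E 2) : ‖join v 0‖ = ‖v‖ := by
  have := norm_sq_join v 0
  simp only [ne_eq, OfNat.ofNat_ne_zero, not_false_eq_true, zero_pow, add_zero] at this
  exact (sq_eq_sq₀ (norm_nonneg _) (norm_nonneg _)).1 this

/-- The corrected gradient `w + ∑ₖ wₖ gₖ`. -/
noncomputable def corrected (g : Fin 2 → E 3 → E 3) (w : E 2) (y : E 3) : E 3 :=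
  join w 0 + ∑ k, w k • g k y

lemma corrected_add (g : Fin 2 → E 3 → E 3) (w z : E 2) (y : E 3) :
    corrected g (w + z) y = corrected g w y + corrected g z y := by
  have : join (w + z) 0 = join w 0 + join z 0 := by rw [← join_add]; simp
  simp only [corrected, this, PiLp.add_apply, add_smul, Fin.sum_univ_two]
  abel

/-- The bound separates slow and fast variables. It is applied to increments of W over a distance of
order ε. -/
lemma enorm_corrected_sq_le (g : Fin 2 → E 3 → E 3) (w : E 2) (y : E 3) :
    ‖corrected g w y‖ₑ ^ 2 ≤ 3 * ‖w‖ₑ ^ 2 * (1 + ∑ k, ‖g k y‖ₑ ^ 2) := by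
  have hr : ‖corrected g w y‖ ^ 2 ≤ 3 * ‖w‖ ^ 2 * (1 + ∑ k, ‖g k y‖ ^ 2) := by
    have h1 : ‖corrected g w y‖ ≤ ‖w‖ + ‖w‖ * ‖g 0 y‖ + ‖w‖ * ‖g 1 y‖ := by
      rw [corrected, Fin.sum_univ_two, ← add_assoc]
      refine (norm_add_le _ _).trans (add_le_add ((norm_add_le _ _).trans (add_le_add ?_ ?_)) ?_)
      · rw [norm_join_zero]
      · rw [norm_smul]
        exact mul_le_mul_of_nonneg_right (PiLp.norm_apply_le w 0) (norm_nonneg _)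
      · rw [norm_smul]
        exact mul_le_mul_of_nonneg_right (PiLp.norm_apply_le w 1) (norm_nonneg _)
    have h2 : ‖corrected g w y‖ ^ 2 ≤ (‖w‖ + ‖w‖ * ‖g 0 y‖ + ‖w‖ * ‖g 1 y‖) ^ 2 := by gcongr
    have h3 : (1 + ‖g 0 y‖ + ‖g 1 y‖) ^ 2 ≤ 3 * (1 + (‖g 0 y‖ ^ 2 + ‖g 1 y‖ ^ 2)) := by
      nlinarith [sq_nonneg (1 - ‖g 0 y‖), sq_nonneg (1 - ‖g 1 y‖),
        sq_nonneg (‖g 0 y‖ - ‖g 1 y‖)]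
    rw [Fin.sum_univ_two]
    calc _ ≤ _ := h2
      _ = ‖w‖ ^ 2 * (1 + ‖g 0 y‖ + ‖g 1 y‖) ^ 2 := by ring
      _ ≤ ‖w‖ ^ 2 * (3 * (1 + (‖g 0 y‖ ^ 2 + ‖g 1 y‖ ^ 2))) := by gcongr
      _ = _ := by ring
  simp only [enorm_sq_eq_ofReal]
  rw [← ENNReal.ofReal_sum_of_nonneg fun _ _ => by positivity, ← ENNReal.ofReal_one,
    ← ENNReal.ofReal_add zero_le_one (by positivity),
    show (3 : ℝ≥0∞) = ENNReal.ofReal 3 by simp, ← ENNReal.ofReal_mul (by norm_num),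
    ← ENNReal.ofReal_mul (by positivity)]
  exact ENNReal.ofReal_le_ofReal hr

lemma measurable_corrected {g : Fin 2 → E 3 → E 3} (hg : ∀ k, StronglyMeasurable (g k))
    {W : E 2 → E 2} (hW : Continuous W) :
    Measurable fun q : E 2 × E 3 => ‖corrected g (W q.1) q.2‖ₑ ^ 2 := by
  have h1 : Measurable fun q : E 2 × E 3 => join (W q.1) 0 :=
    measurable_join_left.comp (hW.measurable.comp measurable_fst)
  have h2 : ∀ k, Measurable fun q : E 2 × E 3 => W q.1 k • g k q.2 := fun k =>
    (((EuclideanSpace.proj (𝕜 := ℝ) k : E 2 →L[ℝ] ℝ).continuous.comp hW).measurable.comp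
      measurable_fst).smul ((hg k).measurable.comp measurable_snd)
  exact (h1.add (Finset.univ.measurable_fun_sum fun k _ => h2 k)).enorm.pow_const 2

/-- The energy of the oscillating part of the perturbed field is asymptotically at most its two-scale
limit. -/
lemma exists_lintegral_film_corrected_le (c₁ : Continuous f₁) (c₂ : Continuous f₂)
    (p₁ : IsQPeriodic f₁) (p₂ : IsQPeriodic f₂) (ω : Set (E 2)) {g : Fin 2 → E 3 → E 3}
    (hg : ∀ k, StronglyMeasurable (g k)) (hp : ∀ k, HPeriodic (g k))
    (hgL : ∀ k, MemLp (g k) 2 (volume.restrict (cell f₁ f₂))) {W : Fin 3 → E 2 → E 2}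
    (hW : ∀ i, ContDiff ℝ (⊤ : ℕ∞) (W i)) (hWc : ∀ i, HasCompactSupport (W i)) :
    ∃ C : ℝ≥0∞, C ≠ ∞ ∧ ∀ δ : ℝ, 0 < δ → ∀ ε : ℝ, 0 < ε → ε ≤ 1 →
      ∫⁻ x in film f₁ f₂ ω ε, ∑ i, ‖corrected g (W i (plane x)) (rescale ε x)‖ₑ ^ 2
        ≤ ENNReal.ofReal (1 + δ) *
            (∫⁻ x' : E 2, ∫⁻ y in cell f₁ f₂, ∑ i, ‖corrected g (W i x') y‖ₑ ^ 2)
          + ENNReal.ofReal (1 + δ⁻¹) * (ENNReal.ofReal (ε ^ 2) * C) := by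
  have hlip : ∀ i, ∃ L : ℝ≥0, LipschitzWith L (W i) := fun i =>
    ContDiff.lipschitzWith_of_hasCompactSupport (hWc i) ((hW i).of_le (by exact_mod_cast le_top))
      (one_ne_zero)
  choose L hL using hlip
  have hball : ∀ i, ∃ R : ℝ, tsupport (W i) ⊆ Metric.closedBall 0 R := fun i =>
    (hWc i).isCompact.isBounded.subset_closedBall 0
  choose R hR using hball
  -- For ε ≤ 1 the shifts εt have length at most 2, so outside this ball both W(x) and W(x + εt)
  -- vanish.
  let B : Fin 3 → Set (E 2) := fun i => Metric.closedBall 0 (R i + 2)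
  have hBm : ∀ i, MeasurableSet (B i) := fun i => Metric.isClosed_closedBall.measurableSet
  -- The Lipschitz bound gives increments of size at most 2εL; the factor 3 is that of
  -- `enorm_corrected_sq_le`, and ε² is kept outside.
  let c : Fin 3 → E 2 → ℝ≥0∞ := fun i =>
    (B i).indicator fun _ => 3 * ENNReal.ofReal ((L i * 2) ^ 2)
  have hcm : ∀ i, Measurable (c i) := fun i => measurable_const.indicator (hBm i)
  let γ : E 3 → ℝ≥0∞ := fun y => 1 + ∑ k, ‖g k y‖ₑ ^ 2
  have hγm : Measurable γ := measurable_const.add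
    (Finset.univ.measurable_fun_sum fun k _ => (hg k).enorm.pow_const 2)
  refine ⟨∫⁻ x' : E 2, ∫⁻ y in cell f₁ f₂, (∑ i, c i x') * γ y, ?_, fun δ hδ ε hε hε1 => ?_⟩
  · simp only [lintegral_const_mul _ hγm]
    rw [lintegral_mul_const _ (Finset.univ.measurable_fun_sum fun i _ => hcm i)]
    refine ENNReal.mul_ne_top ?_ ?_
    · rw [lintegral_finsetSum _ fun i _ => hcm i]
      refine ENNReal.sum_ne_top.2 fun i _ => ?_
      simp only [c]
      rw [lintegral_indicator (hBm i), setLIntegral_const]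
      exact ENNReal.mul_ne_top (ENNReal.mul_ne_top (by simp) ENNReal.ofReal_ne_top)
        (isCompact_closedBall _ _).measure_lt_top.ne
    · simp only [γ]
      rw [lintegral_add_left measurable_const, lintegral_finsetSum _ fun k _ =>
        (hg k).enorm.pow_const 2]
      refine ENNReal.add_ne_top.2 ⟨?_, ENNReal.sum_ne_top.2 fun k _ => ?_⟩
      · simpa using (volume_cell_lt_top c₁ c₂ p₁ p₂).ne
      · rw [← enorm_toLp_sq (hgL k)]
        exact ENNReal.pow_ne_top enorm_ne_top
  · have hAm : Measurable fun q : E 2 × E 3 => ∑ i, ‖corrected g (W i q.1) q.2‖ₑ ^ 2 :=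
      Finset.univ.measurable_fun_sum fun i _ => measurable_corrected hg (hW i).continuous
    have hsum : Measurable fun x => ∑ i, c i x := Finset.univ.measurable_fun_sum fun i _ => hcm i
    have hcγ : Measurable fun q : E 2 × E 3 => (∑ i, c i q.1) * γ q.2 :=
      (hsum.comp measurable_fst).mul (hγm.comp measurable_snd)
    have key := lintegral_film_le c₁ c₂ p₁ p₂ ω hε
      (h := fun x y => ∑ i, ‖corrected g (W i x) y‖ₑ ^ 2)
      -- The majorant freezes the slow variable: linearity in w splits off the increment of W, and
      -- Young's inequality absorbs the cross term.
      (H := fun x y => ENNReal.ofReal (1 + δ) * (∑ i, ‖corrected g (W i x) y‖ₑ ^ 2)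
        + ENNReal.ofReal (1 + δ⁻¹) * (ENNReal.ofReal (ε ^ 2) * ((∑ i, c i x) * γ y)))
      hAm ((hAm.const_mul _).add ((hcγ.const_mul _).const_mul _))
      (fun x y n => by simp only [corrected, γ, hp 0 y n, hp 1 y n, Fin.sum_univ_two])
      (fun x t ht y => by
        simp only [Finset.sum_mul, Finset.mul_sum]
        rw [← Finset.sum_add_distrib]
        refine Finset.sum_le_sum fun i _ => ?_
        have e : corrected g (W i (x + ε • t)) y
            = corrected g (W i x) y + corrected g (W i (x + ε • t) - W i x) y := by
          rw [← corrected_add]; congr 1; abel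
        rw [e]
        refine (enorm_add_sq_le hδ _ _).trans ?_
        gcongr
        refine (enorm_corrected_sq_le _ _ _).trans ?_
        suffices hmain : 3 * ‖W i (x + ε • t) - W i x‖ₑ ^ 2 ≤ ENNReal.ofReal (ε ^ 2) * c i x from
          (mul_le_mul_left hmain _).trans (mul_assoc _ _ _).le
        have hεt : ‖ε • t‖ ≤ ε * 2 := by
          rw [norm_smul, Real.norm_of_nonneg hε.le]
          exact mul_le_mul_of_nonneg_left (norm_le_two_of_mem_unitSquare ht) hε.le
        by_cases hx : x ∈ B i
        · simp only [c, Set.indicator_of_mem hx]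
          rw [enorm_sq_eq_ofReal, mul_left_comm, ← ENNReal.ofReal_mul (by positivity)]
          gcongr
          have h1 := (hL i).dist_le_mul (x + ε • t) x
          rw [dist_eq_norm, dist_eq_norm, add_sub_cancel_left] at h1
          calc ‖W i (x + ε • t) - W i x‖ ^ 2 ≤ (L i * (ε * 2)) ^ 2 := by
                gcongr
                exact h1.trans (by gcongr)
            _ = _ := by ring
        · have h1 : W i x = 0 := image_eq_zero_of_notMem_tsupport fun h' => hx (by
            have := hR i h'
            rw [mem_closedBall_zero_iff] at this
            simp only [B, mem_closedBall_zero_iff]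
            linarith)
          have h2 : W i (x + ε • t) = 0 := image_eq_zero_of_notMem_tsupport fun h' => hx (by
            have := hR i h'
            rw [mem_closedBall_zero_iff] at this
            simp only [B, mem_closedBall_zero_iff]
            have e2 : x = (x + ε • t) - ε • t := by abel
            rw [e2]
            refine (norm_sub_le _ _).trans ?_
            linarith)
          simp [h1, h2])
    refine key.trans (le_of_eq ?_)
    have e1 : ∀ x, ∫⁻ y in cell f₁ f₂, (ENNReal.ofReal (1 + δ) * (∑ i, ‖corrected g (W i x) y‖ₑ ^ 2)
        + ENNReal.ofReal (1 + δ⁻¹) * (ENNReal.ofReal (ε ^ 2) * ((∑ i, c i x) * γ y)))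
        = ENNReal.ofReal (1 + δ) * (∫⁻ y in cell f₁ f₂, ∑ i, ‖corrected g (W i x) y‖ₑ ^ 2)
          + ENNReal.ofReal (1 + δ⁻¹) * (ENNReal.ofReal (ε ^ 2) *
            ∫⁻ y in cell f₁ f₂, (∑ i, c i x) * γ y) := by
      intro x
      rw [lintegral_add_right _ (((hγm.const_mul _).const_mul _).const_mul _),
        lintegral_const_mul' _ _ ENNReal.ofReal_ne_top,
        lintegral_const_mul' _ _ ENNReal.ofReal_ne_top,
        lintegral_const_mul' _ _ ENNReal.ofReal_ne_top]
    simp only [e1]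
    rw [lintegral_add_right _ ((Measurable.lintegral_prod_right' hcγ).const_mul _ |>.const_mul _),
      lintegral_const_mul' _ _ ENNReal.ofReal_ne_top,
      lintegral_const_mul' _ _ ENNReal.ofReal_ne_top,
      lintegral_const_mul' _ _ ENNReal.ofReal_ne_top]

end

/-! ### Comparison with the homogenized energy. -/

section

variable {f₁ f₂ : E 2 → ℝ}

lemma measurable_corrected_right {g : Fin 2 → E 3 → E 3} (hg : ∀ k, StronglyMeasurable (g k))
    (w : E 2) : Measurable fun y => ‖corrected g w y‖ₑ ^ 2 :=
  (measurable_const.add (Finset.univ.measurable_fun_sum fun k _ =>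
    (hg k).measurable.const_smul (w k))).enorm.pow_const 2

/-- The two-scale limit of the energy of the oscillating part, compared with the homogenized one. -/
lemma lintegral_corrected_le (c₁ : Continuous f₁) (c₂ : Continuous f₂)
    (p₁ : IsQPeriodic f₁) (p₂ : IsQPeriodic f₂) {δ : ℝ} (hδ : 0 < δ) {g : Fin 2 → E 3 → E 3}
    (hgm : ∀ k, StronglyMeasurable (g k))
    (hg : ∀ (v : E 2) (χ' : E 3 → ℝ) (g' : E 3 → E 3), IsCorrector f₁ f₂ χ' g' →
        ∫⁻ y in cell f₁ f₂, ‖join v 0 + ∑ k, v k • g k y‖ₑ ^ 2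
          ≤ ENNReal.ofReal (1 + δ) * (∫⁻ y in cell f₁ f₂, ‖join v 0 + g' y‖ₑ ^ 2)
            + ENNReal.ofReal δ * ‖v‖ₑ ^ 2)
    {W Z : Fin 3 → E 2 → E 2} (hW : ∀ i, Continuous (W i)) (hZ : ∀ i, AEMeasurable (Z i)) :
    ∫⁻ x' : E 2, ∫⁻ y in cell f₁ f₂, ∑ i, ‖corrected g (W i x') y‖ₑ ^ 2
      ≤ ENNReal.ofReal (1 + δ) * (ENNReal.ofReal (1 + δ) *
            (∫⁻ x', gHom f₁ f₂ fun i => (Z i x').ofLp)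
          + ENNReal.ofReal (1 + δ⁻¹) * volume (cell f₁ f₂) * ∑ i, ∫⁻ x', ‖W i x' - Z i x'‖ₑ ^ 2)
        + ENNReal.ofReal δ * ∑ i, ∫⁻ x', ‖W i x'‖ₑ ^ 2 := by
  have hWm : ∀ i, Measurable fun x' => ‖W i x'‖ₑ ^ 2 := fun i => (hW i).enorm.measurable.pow_const 2
  have hdm : ∀ i, AEMeasurable fun x' => ‖W i x' - Z i x'‖ₑ ^ 2 := fun i =>
    ((hW i).measurable.aemeasurable.sub (hZ i)).enorm.pow_const 2
  have hcellfin := (volume_cell_lt_top c₁ c₂ p₁ p₂).ne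
  calc ∫⁻ x' : E 2, ∫⁻ y in cell f₁ f₂, ∑ i, ‖corrected g (W i x') y‖ₑ ^ 2
      = ∫⁻ x' : E 2, ∑ i, ∫⁻ y in cell f₁ f₂, ‖corrected g (W i x') y‖ₑ ^ 2 := by
        refine lintegral_congr fun x => lintegral_finsetSum _ fun i _ => ?_
        exact measurable_corrected_right hgm _
    _ ≤ ∫⁻ x' : E 2, (ENNReal.ofReal (1 + δ) * (ENNReal.ofReal (1 + δ) *
          (gHom f₁ f₂ fun i => (Z i x').ofLp)
          + ENNReal.ofReal (1 + δ⁻¹) * volume (cell f₁ f₂) * ∑ i, ‖W i x' - Z i x'‖ₑ ^ 2)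
          + ENNReal.ofReal δ * ∑ i, ‖W i x'‖ₑ ^ 2) := by
        refine lintegral_mono fun x => ?_
        have h1 := sum_lintegral_correctors_le c₁ c₂ p₁ p₂ hδ hg fun i => W i x
        have h2 := gHom_le_add (f₁ := f₁) (f₂ := f₂) hδ (fun i => W i x) fun i => Z i x
        refine le_trans h1 ?_
        gcongr
    _ = _ := by
        -- The sums are split with measurability of the error terms only, and the constants pulled
        -- out are finite; measurability of `gHom` along Z is never required.
        rw [lintegral_add_right, lintegral_const_mul' _ _ ENNReal.ofReal_ne_top,
          lintegral_add_right', lintegral_const_mul' _ _ ENNReal.ofReal_ne_top,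
          lintegral_const_mul' _ _ (ENNReal.mul_ne_top ENNReal.ofReal_ne_top hcellfin),
          lintegral_const_mul' _ _ ENNReal.ofReal_ne_top,
          lintegral_finsetSum' _ fun i _ => hdm i, lintegral_finsetSum _ fun i _ => hWm i]
        · exact (Finset.univ.aemeasurable_fun_sum fun i _ => hdm i).const_mul _
        · exact (Finset.univ.measurable_fun_sum fun i _ => hWm i).const_mul _

lemma lintegral_gHom_indicator {ω : Set (E 2)} (hω : MeasurableSet ω)
    (D : E 2 → Matrix (Fin 3) (Fin 2) ℝ) :
    ∫⁻ x', (gHom f₁ f₂ fun i => (ω.indicator (rowVec D i) x').ofLp)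
      = ∫⁻ x' in ω, gHom f₁ f₂ (D x') := by
  rw [← lintegral_indicator hω]
  refine lintegral_congr fun x => ?_
  by_cases hx : x ∈ ω
  · simp only [Set.indicator_of_mem hx]
    rfl
  · simp only [Set.indicator_of_notMem hx]
    exact gHom_zero

end

/-! ### Admissibility of the competitors. -/

section

variable {f₁ f₂ : E 2 → ℝ}

lemma memLp_smul_of_bound {α F : Type*} [MeasurableSpace α] [NormedAddCommGroup F] [NormedSpace ℝ F]
    {μ : Measure α} {p : ℝ≥0∞} {c : α → ℝ} {f : α → F} {C : ℝ} (hc : AEStronglyMeasurable c μ)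
    (hb : ∀ x, |c x| ≤ C) (hf : MemLp f p μ) : MemLp (fun x => c x • f x) p μ :=
  MemLp.of_le_mul (c := C) hf (hc.smul hf.aestronglyMeasurable) (.of_forall fun x => by
    rw [norm_smul, Real.norm_eq_abs]
    exact mul_le_mul_of_nonneg_right (hb x) (norm_nonneg _))

lemma exists_bound_of_hasCompactSupport {α ι F : Type*} [TopologicalSpace α] [Finite ι]
    [NormedAddCommGroup F] {u : ι → α → F} (hu : ∀ i, Continuous (u i))
    (hc : ∀ i, HasCompactSupport (u i)) : ∃ C : ℝ, 0 ≤ C ∧ ∀ i x, ‖u i x‖ ≤ C := by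
  choose C hC using fun i => (hu i).bounded_above_of_compact_support (hc i)
  obtain ⟨M, hM⟩ := Finite.bddAbove_range C
  refine ⟨max M 0, le_max_right _ _, fun i x => (hC i x).trans ?_⟩
  exact (hM ⟨i, rfl⟩).trans (le_max_left _ _)

lemma exists_bound_apply {W : Fin 3 → E 2 → E 2} (hW : ∀ i, ContDiff ℝ (⊤ : ℕ∞) (W i))
    (hc : ∀ i, HasCompactSupport (W i)) : ∃ C : ℝ, 0 ≤ C ∧ ∀ i x k, |W i x k| ≤ C := by
  obtain ⟨C, h0, hC⟩ := exists_bound_of_hasCompactSupport (fun i => (hW i).continuous) hc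
  exact ⟨C, h0, fun i x k => (PiLp.norm_apply_le (W i x) k).trans (hC i x)⟩

lemma exists_bound_classicalGrad {W : Fin 3 → E 2 → E 2} (hW : ∀ i, ContDiff ℝ (⊤ : ℕ∞) (W i))
    (hc : ∀ i, HasCompactSupport (W i)) :
    ∃ C : ℝ, 0 ≤ C ∧ ∀ i x k, ‖classicalGrad (fun x' => W i x' k) x‖ ≤ C := by
  have hk : ∀ (i : Fin 3) (k : Fin 2), HasCompactSupport fun x => W i x k := fun i k =>
    (hc i).comp_left (g := fun z : E 2 => z k) rfl
  obtain ⟨C, h0, hC⟩ := exists_bound_of_hasCompactSupport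
    (u := fun (q : Fin 3 × Fin 2) => fderiv ℝ fun x' => W q.1 x' q.2)
    (fun q => ((hW q.1).coord q.2).continuous_fderiv (by simp)) (fun q => (hk q.1 q.2).fderiv ℝ)
  refine ⟨C + C, by positivity, fun i x k => ?_⟩
  have h1 : ∀ j, |classicalGrad (fun x' => W i x' k) x j| ≤ C := fun j => by
    rw [classicalGrad_apply, ← Real.norm_eq_abs]
    refine (ContinuousLinearMap.le_opNorm _ _).trans ?_
    simpa [basisVec] using hC (i, k) x
  refine le_of_sq_le_sq ?_ (by positivity)
  rw [EuclideanSpace.norm_sq_eq, Fin.sum_univ_two]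
  have a0 := sq_le_sq' (neg_le_of_abs_le (h1 0)) (le_of_abs_le (h1 0))
  have a1 := sq_le_sq' (neg_le_of_abs_le (h1 1)) (le_of_abs_le (h1 1))
  simp only [Real.norm_eq_abs, sq_abs]
  nlinarith

/-- This is what bounded correctors are for: the perturbation is uniformly O(ε), so the field stays
away from the singularity of the projection. -/
lemma exists_norm_perturb_sub_le {χ : Fin 2 → E 3 → ℝ} {B : ℝ} (hB : ∀ k y, |χ k y| ≤ B)
    {W : Fin 3 → E 2 → E 2} (hW : ∀ i, ContDiff ℝ (⊤ : ℕ∞) (W i))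
    (hc : ∀ i, HasCompactSupport (W i)) (m₀ : E 2 → E 3) :
    ∃ K : ℝ, 0 ≤ K ∧ ∀ ε : ℝ, 0 < ε → ∀ x, ‖perturb ε m₀ χ W x - m₀ (plane x)‖ ≤ ε * K := by
  obtain ⟨C, h0, hC⟩ := exists_bound_apply hW hc
  have hB0 : 0 ≤ B := (abs_nonneg _).trans (hB 0 0)
  -- Each of the three components is at most 2BC, and 2√3 ≤ 4.
  refine ⟨4 * (B * C), by positivity, fun ε hε x => ?_⟩
  have h1 : ∀ i, |∑ k, χ k (rescale ε x) * W i (plane x) k| ≤ 2 * (B * C) := fun i => by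
    rw [Fin.sum_univ_two, two_mul]
    refine (abs_add_le _ _).trans (add_le_add ?_ ?_) <;>
    · rw [abs_mul]
      exact mul_le_mul (hB _ _) (hC _ _ _) (abs_nonneg _) hB0
  have h2 : ∀ i, (∑ k, χ k (rescale ε x) * W i (plane x) k) ^ 2 ≤ (2 * (B * C)) ^ 2 := fun i =>
    sq_le_sq' (neg_le_of_abs_le (h1 i)) (le_of_abs_le (h1 i))
  refine le_of_sq_le_sq ?_ (by positivity)
  rw [EuclideanSpace.norm_sq_eq]
  simp only [perturb, PiLp.sub_apply, add_sub_cancel_left, Real.norm_eq_abs, sq_abs, mul_pow ε]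
  rw [← Finset.mul_sum]
  refine mul_le_mul_of_nonneg_left ?_ (by positivity)
  have h3 := Finset.sum_le_sum fun i (_ : i ∈ Finset.univ) => h2 i
  refine h3.trans ?_
  simp only [Finset.sum_const, Finset.card_univ, Fintype.card_fin, nsmul_eq_mul]
  push_cast
  nlinarith [sq_nonneg (B * C)]

lemma aestronglyMeasurable_of_weakGrad {U : Set (E 3)} (hU : IsOpen U) {v : E 3 → E 3}
    {g : Fin 3 → E 3 → E 3} (h : ∀ k, WeakGrad U (fun x => v x k) (g k)) :
    AEStronglyMeasurable v (volume.restrict U) :=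
  (locallyIntegrableOn_of_coord hU fun k => (h k).locInt).aestronglyMeasurable

lemma IsH1Sphere.weakGrad {ω : Set (E 2)} {m₀ : E 2 → E 3}
    {D : E 2 → Matrix (Fin 3) (Fin 2) ℝ} (h : IsH1Sphere ω m₀ D) (i : Fin 3) :
    WeakGrad ω (fun x => m₀ x i) (rowVec D i) :=
  h.hasWeakGradient.weakGrad i
    (locallyIntegrableOn_of_locallyIntegrable_restrict
      ((h.memLp.coord i).locallyIntegrable (by norm_num)))
    (locallyIntegrableOn_of_locallyIntegrable_restrict
      ((memLp_of_coord (f := rowVec D i) fun j => h.memLp_grad i j).locallyIntegrable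
        (by norm_num)))

lemma exists_common_bound (c₁ : Continuous f₁) (c₂ : Continuous f₂)
    (p₁ : IsQPeriodic f₁) (p₂ : IsQPeriodic f₂) :
    ∃ M : ℝ, (∀ y, |f₁ y| ≤ M) ∧ ∀ y, |f₂ y| ≤ M := by
  obtain ⟨M₁, -, h₁⟩ := exists_bound_of_periodic c₁ p₁
  obtain ⟨M₂, -, h₂⟩ := exists_bound_of_periodic c₂ p₂
  exact ⟨max M₁ M₂, fun y => (h₁ y).trans (le_max_left _ _),
    fun y => (h₂ y).trans (le_max_right _ _)⟩

lemma isFiniteMeasure_film {M : ℝ} (h₁ : ∀ y, |f₁ y| ≤ M) (h₂ : ∀ y, |f₂ y| ≤ M) {ω : Set (E 2)}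
    (hb : Bornology.IsBounded ω) (ε : ℝ) : IsFiniteMeasure (volume.restrict (film f₁ f₂ ω ε)) := by
  refine ⟨?_⟩
  rw [Measure.restrict_apply_univ]
  exact (volume_film_le h₁ h₂ ω ε).trans_lt
    (ENNReal.mul_lt_top ENNReal.ofReal_lt_top hb.measure_lt_top)

lemma memLp_perturbGrad (c₁ : Continuous f₁) (c₂ : Continuous f₂)
    (p₁ : IsQPeriodic f₁) (p₂ : IsQPeriodic f₂) {ω : Set (E 2)} (hω : IsOpen ω)
    (hb : Bornology.IsBounded ω) {ε : ℝ} (hε : 0 < ε) {D : E 2 → Matrix (Fin 3) (Fin 2) ℝ}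
    {χ : Fin 2 → E 3 → ℝ} {g : Fin 2 → E 3 → E 3}
    (hχ : ∀ k, IsCorrector f₁ f₂ (χ k) (g k)) {B : ℝ} (hB : ∀ k y, |χ k y| ≤ B)
    {W : Fin 3 → E 2 → E 2} (hW : ∀ i, ContDiff ℝ (⊤ : ℕ∞) (W i))
    (hc : ∀ i, HasCompactSupport (W i)) {i : Fin 3}
    (hD : MemLp (rowVec D i) 2 (volume.restrict ω)) :
    MemLp (perturbGrad ε D χ g W i) 2 (volume.restrict (film f₁ f₂ ω ε)) := by
  obtain ⟨M, h₁, h₂⟩ := exists_common_bound c₁ c₂ p₁ p₂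
  obtain ⟨C, hC0, hC⟩ := exists_bound_apply hW hc
  obtain ⟨C', hC0', hC'⟩ := exists_bound_classicalGrad hW hc
  have hWk : ∀ k, Continuous fun x : E 3 => W i (plane x) k := fun k =>
    ((hW i).coord k).continuous.comp continuous_plane
  have hdW : ∀ k, Continuous fun x : E 3 => classicalGrad (fun x' => W i x' k) (plane x) := fun k =>
    (continuous_classicalGrad (((hW i).coord k).of_le (by exact_mod_cast le_top))).comp
      continuous_plane
  have hfin := isFiniteMeasure_film h₁ h₂ hb ε
  have t1 : MemLp (fun x => join (rowVec D i (plane x)) 0) 2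
      (volume.restrict (film f₁ f₂ ω ε)) :=
    joinL.comp_memLp' (memLp_film_comp_plane h₁ h₂ ε hD)
  have t2 : ∀ k, MemLp (fun x => W i (plane x) k • rescale ε (g k (rescale ε x))) 2
      (volume.restrict (film f₁ f₂ ω ε)) := fun k => by
    have h := memLp_film_comp_rescale c₁ c₂ p₁ p₂ hb hω.measurableSet hε (hχ k).meas_grad
        (hχ k).periodic_grad (hχ k).memLp_grad
    have h' : MemLp (fun x => rescale ε (g k (rescale ε x))) 2
      (volume.restrict (film f₁ f₂ ω ε)) := (rescaleEquiv hε : E 3 →L[ℝ] E 3).comp_memLp' h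
    exact memLp_smul_of_bound (hWk k).aestronglyMeasurable (fun x => hC i (plane x) k) h'
  have t3 : ∀ k, MemLp (fun x => χ k (rescale ε x) •
      join (classicalGrad (fun x' => W i x' k) (plane x)) 0) 2
      (volume.restrict (film f₁ f₂ ω ε)) := fun k => by
    have h : MemLp (fun x => join (classicalGrad (fun x' => W i x' k) (plane x)) 0) 2
        (volume.restrict (film f₁ f₂ ω ε)) :=
      MemLp.of_bound (joinL.continuous.comp (hdW k)).aestronglyMeasurable C'
        (.of_forall fun x => (norm_join_zero _).trans_le (hC' i (plane x) k))
    exact memLp_smul_of_bound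
      ((hχ k).meas.comp_measurable (measurable_rescale ε)).aestronglyMeasurable
      (fun x => hB k _) h
  have t4 := memLp_finsetSum Finset.univ fun k _ => (t2 k).add (t3 k)
  exact t1.add (t4.const_smul ε)

/-- The lower bound 1/2 on the modulus is where `sphereProj` agrees with the true radial projection
and so takes values in the sphere. -/
lemma isH1Sphere_sphereProj_perturb (c₁ : Continuous f₁) (c₂ : Continuous f₂)
    (p₁ : IsQPeriodic f₁) (p₂ : IsQPeriodic f₂) {ω : Set (E 2)} (hω : IsOpen ω)
    (hb : Bornology.IsBounded ω) {ε : ℝ} (hε : 0 < ε) {m₀ : E 2 → E 3}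
    {D : E 2 → Matrix (Fin 3) (Fin 2) ℝ} (hm : IsH1Sphere ω m₀ D)
    {χ : Fin 2 → E 3 → ℝ} {g : Fin 2 → E 3 → E 3}
    (hχ : ∀ k, IsCorrector f₁ f₂ (χ k) (g k)) {B : ℝ} (hB : ∀ k y, |χ k y| ≤ B)
    {W : Fin 3 → E 2 → E 2} (hW : ∀ i, ContDiff ℝ (⊤ : ℕ∞) (W i))
    (hc : ∀ i, HasCompactSupport (W i))
    (hv : ∀ᵐ x ∂volume.restrict (film f₁ f₂ ω ε), 1 / 2 ≤ ‖perturb ε m₀ χ W x‖) :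
    IsH1Sphere (film f₁ f₂ ω ε) (fun x => sphereProj (perturb ε m₀ χ W x))
      (projGrad (perturb ε m₀ χ W) (perturbGrad ε D χ g W)) := by
  obtain ⟨M, h₁, h₂⟩ := exists_common_bound c₁ c₂ p₁ p₂
  have hfilm := isOpen_film c₁ c₂ hω ε
  have hfin : IsFiniteMeasure (volume.restrict (film f₁ f₂ ω ε)) :=
      isFiniteMeasure_film h₁ h₂ hb ε
  have hgrad := weakGrad_perturb hω c₁ c₂ hε (fun i => hm.weakGrad i)
    (fun k => (hχ k).weakGrad) hW
  have hvm := aestronglyMeasurable_of_weakGrad hfilm hgrad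
  obtain ⟨C, hC⟩ := exists_bound_fderiv_sphereProj
  have hsph : ∀ᵐ x ∂volume.restrict (film f₁ f₂ ω ε), ‖sphereProj (perturb ε m₀ χ W x)‖ = 1 :=
    hv.mono fun x hx => norm_sphereProj hx
  refine ⟨⟨?_, fun i j => ?_, WeakGrad.hasWeakGradient fun i => WeakGrad.sphereProj hfilm hgrad i⟩,
    hsph.mono fun x hx => by simpa using hx⟩
  · exact MemLp.of_bound (contDiff_sphereProj.continuous.comp_aestronglyMeasurable hvm) 1
      (hsph.mono fun x hx => hx.le)
  · refine memLp_finsetSum _ fun k _ => ?_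
    have hcont : Continuous fun v : E 3 => fderiv ℝ sphereProj v (basisVec k) i :=
      (EuclideanSpace.proj (𝕜 := ℝ) i : E 3 →L[ℝ] ℝ).continuous.comp
        ((contDiff_sphereProj.continuous_fderiv one_ne_zero).clm_apply continuous_const)
    refine memLp_smul_of_bound (C := C) (hcont.comp_aestronglyMeasurable hvm) (fun x => ?_)
      ((memLp_perturbGrad c₁ c₂ p₁ p₂ hω hb hε hχ hB hW hc
        (memLp_of_coord fun j => hm.memLp_grad k j)).coord j)
    refine (PiLp.norm_apply_le (fderiv ℝ sphereProj (perturb ε m₀ χ W x) (basisVec k)) i).trans ?_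
    refine (ContinuousLinearMap.le_opNorm _ _).trans ?_
    simpa [basisVec] using hC (perturb ε m₀ χ W x)

end

/-! ### Energy estimate for the projected field. -/

section

variable {f₁ f₂ : E 2 → ℝ}

lemma exists_norm_sum_smul_classicalGrad_le {χ : Fin 2 → E 3 → ℝ} {B : ℝ}
    (hB : ∀ k y, |χ k y| ≤ B) {W : Fin 3 → E 2 → E 2} (hW : ∀ i, ContDiff ℝ (⊤ : ℕ∞) (W i))
    (hc : ∀ i, HasCompactSupport (W i)) :
    ∃ K : ℝ, 0 ≤ K ∧ ∀ (i : Fin 3) (x' : E 2) (y : E 3),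
      ‖∑ k, χ k y • join (classicalGrad (fun x' => W i x' k) x') 0‖ ≤ K := by
  obtain ⟨C, hC0, hC⟩ := exists_bound_classicalGrad hW hc
  have hB0 : 0 ≤ B := (abs_nonneg _).trans (hB 0 0)
  refine ⟨B * C + B * C, by positivity, fun i x' y => ?_⟩
  have h : ∀ k, ‖χ k y • join (classicalGrad (fun x' => W i x' k) x') 0‖ ≤ B * C := fun k => by
    rw [norm_smul, norm_join_zero]
    exact mul_le_mul (hB k y) (hC i x' k) (norm_nonneg _) hB0
  rw [Fin.sum_univ_two]
  exact (norm_add_le _ _).trans (add_le_add (h 0) (h 1))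

/-- Young's inequality is applied twice: with weight δ to isolate the oscillating part, then with
weight 1 to separate the two remainders. The constant 6 is 2 for each of three components. -/
lemma sum_enorm_stretch_perturbGrad_sq_le {ε δ K : ℝ} (hε : 0 < ε) (hδ : 0 < δ)
    {D : E 2 → Matrix (Fin 3) (Fin 2) ℝ} {χ : Fin 2 → E 3 → ℝ} {g : Fin 2 → E 3 → E 3}
    {W : Fin 3 → E 2 → E 2}
    (hK : ∀ (i : Fin 3) (x' : E 2) (y : E 3),
      ‖∑ k, χ k y • join (classicalGrad (fun x' => W i x' k) x') 0‖ ≤ K) (x : E 3) :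
    ∑ i, ‖stretch ε (perturbGrad ε D χ g W i x)‖ₑ ^ 2
      ≤ ENNReal.ofReal (1 + δ) * (∑ i, ‖corrected g (W i (plane x)) (rescale ε x)‖ₑ ^ 2)
        + ENNReal.ofReal (1 + δ⁻¹) * (2 * (∑ i, ‖W i (plane x) - rowVec D i (plane x)‖ₑ ^ 2)
          + 6 * (ENNReal.ofReal (ε ^ 2) * ENNReal.ofReal (K ^ 2))) := by
  have h2 : ENNReal.ofReal (1 + 1) = 2 := by norm_num
  have key : ∀ i, ‖stretch ε (perturbGrad ε D χ g W i x)‖ₑ ^ 2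
      ≤ ENNReal.ofReal (1 + δ) * ‖corrected g (W i (plane x)) (rescale ε x)‖ₑ ^ 2
        + ENNReal.ofReal (1 + δ⁻¹) * (2 * ‖W i (plane x) - rowVec D i (plane x)‖ₑ ^ 2
          + 2 * (ENNReal.ofReal (ε ^ 2) * ENNReal.ofReal (K ^ 2))) := fun i => by
    rw [stretch_perturbGrad hε]
    refine (enorm_add_sq_le hδ _ _).trans ?_
    rw [← corrected]
    gcongr
    refine (enorm_add_sq_le one_pos _ _).trans ?_
    rw [inv_one, h2]
    gcongr
    · refine le_of_eq ?_
      rw [← ofReal_norm, norm_join_zero, norm_sub_rev, ofReal_norm]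
    · rw [enorm_sq_eq_ofReal, ← ENNReal.ofReal_mul (by positivity), ← mul_pow]
      refine ENNReal.ofReal_le_ofReal ?_
      rw [norm_smul, Real.norm_of_nonneg hε.le]
      have := hK i (plane x) (rescale ε x)
      gcongr
  refine (Finset.sum_le_sum fun i _ => key i).trans (le_of_eq ?_)
  simp only [Fin.sum_univ_three]
  ring

lemma measurable_sum_corrected {g : Fin 2 → E 3 → E 3} (hg : ∀ k, StronglyMeasurable (g k))
    {W : Fin 3 → E 2 → E 2} (hW : ∀ i, Continuous (W i)) (ε : ℝ) :
    Measurable fun x => ∑ i, ‖corrected g (W i (plane x)) (rescale ε x)‖ₑ ^ 2 := by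
  have hpr : Measurable fun x : E 3 => (plane x, rescale ε x) :=
    measurable_plane.prodMk (measurable_rescale ε)
  have h : ∀ i, Measurable fun x => ‖corrected g (W i (plane x)) (rescale ε x)‖ₑ ^ 2 := fun i => by
    have h' := (measurable_corrected hg (hW i)).comp hpr
    simpa only [Function.comp_def] using h'
  exact Finset.univ.measurable_fun_sum fun i _ => h i

/-- The outer factor 1 + δ is the price of the projection, whose differential has squared norm at
most r⁻². -/
lemma exchangeEnergy_projGrad_le_lintegral {Ω : Set (E 3)} {ε δ K r : ℝ} (hε : 0 < ε) (hδ : 0 < δ)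
    {m₀ : E 2 → E 3} {D : E 2 → Matrix (Fin 3) (Fin 2) ℝ} {χ : Fin 2 → E 3 → ℝ}
    {g : Fin 2 → E 3 → E 3} {W : Fin 3 → E 2 → E 2}
    (hK : ∀ (i : Fin 3) (x' : E 2) (y : E 3),
      ‖∑ k, χ k y • join (classicalGrad (fun x' => W i x' k) x') 0‖ ≤ K)
    (hr : 1 / 2 ≤ r) (hrδ : r⁻¹ ^ 2 ≤ 1 + δ)
    (hv : ∀ᵐ x ∂volume.restrict Ω, r < ‖perturb ε m₀ χ W x‖) :
    exchangeEnergy Ω ε (projGrad (perturb ε m₀ χ W) (perturbGrad ε D χ g W))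
      ≤ ∫⁻ x in Ω, ENNReal.ofReal (1 + δ) *
          (ENNReal.ofReal (1 + δ) * (∑ i, ‖corrected g (W i (plane x)) (rescale ε x)‖ₑ ^ 2)
          + ENNReal.ofReal (1 + δ⁻¹) * (2 * (∑ i, ‖W i (plane x) - rowVec D i (plane x)‖ₑ ^ 2)
            + 6 * (ENNReal.ofReal (ε ^ 2) * ENNReal.ofReal (K ^ 2)))) := by
  unfold exchangeEnergy
  refine lintegral_mono_ae (hv.mono fun x hx => ?_)
  refine (energy_density_projGrad_le (norm_fderiv_sphereProj_le hr hx) ε).trans ?_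
  exact mul_le_mul' (ENNReal.ofReal_le_ofReal hrδ) (sum_enorm_stretch_perturbGrad_sq_le hε hδ hK x)

lemma exchangeEnergy_projGrad_le {M : ℝ}
    (h₁ : ∀ y, |f₁ y| ≤ M) (h₂ : ∀ y, |f₂ y| ≤ M) {ω : Set (E 2)}
    {ε δ K r : ℝ} (hε : 0 < ε) (hδ : 0 < δ)
    {m₀ : E 2 → E 3} {D : E 2 → Matrix (Fin 3) (Fin 2) ℝ}
    (hD : ∀ i, AEStronglyMeasurable (rowVec D i) (volume.restrict ω))
    {χ : Fin 2 → E 3 → ℝ} {g : Fin 2 → E 3 → E 3} (hg : ∀ k, StronglyMeasurable (g k))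
    {W : Fin 3 → E 2 → E 2} (hW : ∀ i, Continuous (W i))
    (hK : ∀ (i : Fin 3) (x' : E 2) (y : E 3),
      ‖∑ k, χ k y • join (classicalGrad (fun x' => W i x' k) x') 0‖ ≤ K)
    (hr : 1 / 2 ≤ r) (hrδ : r⁻¹ ^ 2 ≤ 1 + δ)
    (hv : ∀ᵐ x ∂volume.restrict (film f₁ f₂ ω ε), r < ‖perturb ε m₀ χ W x‖) :
    exchangeEnergy (film f₁ f₂ ω ε) ε (projGrad (perturb ε m₀ χ W) (perturbGrad ε D χ g W))
      ≤ ENNReal.ofReal (1 + δ) * (ENNReal.ofReal (1 + δ) *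
            (∫⁻ x in film f₁ f₂ ω ε, ∑ i, ‖corrected g (W i (plane x)) (rescale ε x)‖ₑ ^ 2)
          + ENNReal.ofReal (1 + δ⁻¹) *
            (2 * (ENNReal.ofReal (2 * M) * ∑ i, ∫⁻ x' in ω, ‖W i x' - rowVec D i x'‖ₑ ^ 2)
              + 6 * (ENNReal.ofReal (ε ^ 2) * ENNReal.ofReal (K ^ 2))
                * (ENNReal.ofReal (2 * M) * volume ω))) := by
  have hd : ∀ i, AEMeasurable (fun x' => ‖W i x' - rowVec D i x'‖ₑ ^ 2) (volume.restrict ω) :=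
    fun i => ((hW i).aestronglyMeasurable.sub (hD i)).enorm.pow_const 2
  have hA := measurable_sum_corrected hg hW ε
  calc exchangeEnergy (film f₁ f₂ ω ε) ε (projGrad (perturb ε m₀ χ W) (perturbGrad ε D χ g W))
      ≤ ∫⁻ x in film f₁ f₂ ω ε, ENNReal.ofReal (1 + δ) *
          (ENNReal.ofReal (1 + δ) * (∑ i, ‖corrected g (W i (plane x)) (rescale ε x)‖ₑ ^ 2)
          + ENNReal.ofReal (1 + δ⁻¹) * (2 * (∑ i, ‖W i (plane x) - rowVec D i (plane x)‖ₑ ^ 2)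
            + 6 * (ENNReal.ofReal (ε ^ 2) * ENNReal.ofReal (K ^ 2)))) :=
        exchangeEnergy_projGrad_le_lintegral hε hδ hK hr hrδ hv
    _ = ENNReal.ofReal (1 + δ) * (ENNReal.ofReal (1 + δ) *
            (∫⁻ x in film f₁ f₂ ω ε, ∑ i, ‖corrected g (W i (plane x)) (rescale ε x)‖ₑ ^ 2)
          + ENNReal.ofReal (1 + δ⁻¹) *
            (2 * (∫⁻ x in film f₁ f₂ ω ε, ∑ i, ‖W i (plane x) - rowVec D i (plane x)‖ₑ ^ 2)
              + 6 * (ENNReal.ofReal (ε ^ 2) * ENNReal.ofReal (K ^ 2))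
                * volume (film f₁ f₂ ω ε))) := by
        rw [lintegral_const_mul' _ _ ENNReal.ofReal_ne_top, lintegral_add_left (hA.const_mul _),
          lintegral_const_mul' _ _ ENNReal.ofReal_ne_top,
          lintegral_const_mul' _ _ ENNReal.ofReal_ne_top, lintegral_add_right _ measurable_const,
          lintegral_const_mul' _ _ ENNReal.ofNat_ne_top, setLIntegral_const]
    _ ≤ _ := by
        have e := lintegral_film_comp_plane_le h₁ h₂ ε
          (a := fun x' => ∑ i, ‖W i x' - rowVec D i x'‖ₑ ^ 2)
          (Finset.univ.aemeasurable_fun_sum fun i _ => hd i)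
        rw [lintegral_finsetSum' _ fun i _ => hd i] at e
        have e' := volume_film_le h₁ h₂ ω ε
        gcongr

lemma exists_contDiff_near {d n : ℕ} {Z : Fin 3 → E d → E n} (hZ : ∀ i, MemLp (Z i) 2)
    {η : ℝ} (hη : 0 < η) : ∃ W : Fin 3 → E d → E n, (∀ i, ContDiff ℝ (⊤ : ℕ∞) (W i)) ∧
      (∀ i, HasCompactSupport (W i)) ∧ ∑ i, ∫⁻ x, ‖W i x - Z i x‖ₑ ^ 2 ≤ ENNReal.ofReal η := by
  have hex : ∀ i, ∃ W : E d → E n, HasCompactSupport W ∧ ContDiff ℝ (⊤ : ℕ∞) W ∧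
      ∫⁻ x, ‖W x - Z i x‖ₑ ^ 2 ≤ ENNReal.ofReal (η / 3) := fun i => by
    obtain ⟨W, hc, hs, hW⟩ := (hZ i).exist_eLpNorm_sub_le (by norm_num) (by norm_num)
      (ε := √(η / 3)) (by positivity)
    refine ⟨W, hc, hs, ?_⟩
    have hm : MemLp (W - Z i) 2 := (hs.continuous.memLp_of_hasCompactSupport hc).sub (hZ i)
    have h := enorm_toLp_sq hm
    simp only [Pi.sub_apply] at h
    rw [← h, Lp.enorm_toLp, eLpNorm_sub_comm, ← Real.sq_sqrt (show 0 ≤ η / 3 by positivity),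
      ENNReal.ofReal_pow (by positivity)]
    gcongr
  choose W hc hs hW using hex
  refine ⟨W, hs, hc, (Finset.sum_le_sum fun i _ => hW i).trans (le_of_eq ?_)⟩
  rw [← ENNReal.ofReal_sum_of_nonneg fun _ _ => by positivity]
  congr 1
  simp only [Finset.sum_const, Finset.card_univ, Fintype.card_fin, nsmul_eq_mul]
  push_cast
  ring

lemma lintegral_enorm_sq_lt_top {α F : Type*} [MeasurableSpace α] [NormedAddCommGroup F]
    {μ : Measure α} {f : α → F} (hf : MemLp f 2 μ) : ∫⁻ x, ‖f x‖ₑ ^ 2 ∂μ < ∞ := by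
  have := lintegral_rpow_enorm_lt_top_of_eLpNorm_lt_top (by norm_num) (by norm_num)
    hf.eLpNorm_lt_top
  simpa using this

end

/-! ### Competitors for a fixed tolerance. -/

section

variable {f₁ f₂ : E 2 → ℝ}

lemma eventually_ofReal_sq_mul_le {C b : ℝ≥0∞} (hC : C ≠ ∞) (hb : b ≠ 0) :
    ∀ᶠ ε : ℝ in 𝓝[>] 0, ENNReal.ofReal (ε ^ 2) * C ≤ b := by
  have h1 : Tendsto (fun ε : ℝ => ENNReal.ofReal (ε ^ 2)) (𝓝[>] 0) (𝓝 0) := by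
    have h : Tendsto (fun ε : ℝ => ENNReal.ofReal (ε ^ 2)) (𝓝 0) (𝓝 (ENNReal.ofReal (0 ^ 2))) :=
      (ENNReal.continuous_ofReal.comp (continuous_pow 2)).tendsto 0
    simp only [ne_eq, OfNat.ofNat_ne_zero, not_false_eq_true, zero_pow, ENNReal.ofReal_zero] at h
    exact h.mono_left nhdsWithin_le_nhds
  have h2 : Tendsto (fun ε : ℝ => ENNReal.ofReal (ε ^ 2) * C) (𝓝[>] 0) (𝓝 (0 * C)) :=
    ENNReal.Tendsto.mul_const h1 (Or.inr hC)
  rw [zero_mul] at h2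
  exact h2.eventually_le_const (pos_iff_ne_zero.2 hb)

lemma exists_radius {δ : ℝ} (hδ : 0 < δ) :
    ∃ r : ℝ, 1 / 2 ≤ r ∧ r < 1 ∧ r⁻¹ ^ 2 ≤ 1 + δ := by
  have h : ContinuousAt (fun r : ℝ => r⁻¹ ^ 2) 1 := (continuousAt_inv₀ one_ne_zero).pow 2
  have h1 : ∀ᶠ r : ℝ in 𝓝 1, r⁻¹ ^ 2 < 1 + δ :=
    h.eventually_lt_const (by simpa using hδ)
  have h2 : ∀ᶠ r : ℝ in 𝓝 1, 1 / 2 < r := lt_mem_nhds (by norm_num)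
  obtain ⟨r, ⟨h3, h4⟩, h5⟩ :=
    (((h1.and h2).filter_mono nhdsWithin_le_nhds).and (self_mem_nhdsWithin (s := Set.Iio (1 : ℝ)))).exists
  exact ⟨r, h4.le, h5, h3.le⟩

/-- Here d, a, e stand for δ, 1 + δ⁻¹, ε². The five factors 1 + d come from the projection, the
splitting of the gradient, freezing the slow variable, the almost optimal correctors, and the
passage from W to ∇m₀. As a blows up when d is small, H must be chosen small relative to a, and e
afterwards relative to C₁ and C₂, which depend on that choice. -/
lemma combine_bounds {d I V S R C₁ C₂ T X L H : ℝ≥0∞} {a e : ℝ≥0∞} (hd : d ≤ 1)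
    (hT : T ≤ (1 + d) * L + a * (e * C₁)) (hL : L ≤ (1 + d) * ((1 + d) * I + V * d) + d * S)
    (hX : X ≤ (1 + d) * ((1 + d) * T + a * (2 * (R * H) + 6 * (e * C₂))))
    (hH : a * H ≤ d) (he : e * (a * (4 * C₁ + 12 * C₂)) ≤ d) :
    X ≤ (1 + d) ^ 5 * I + d * (16 * V + 8 * S + 4 * R + 1) := by
  have h2 : 1 + d ≤ 2 := by
    calc 1 + d ≤ 1 + 1 := by gcongr
      _ = 2 := one_add_one_eq_two
  calc X ≤ (1 + d) * ((1 + d) * ((1 + d) * ((1 + d) * ((1 + d) * I + V * d) + d * S)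
          + a * (e * C₁)) + a * (2 * (R * H) + 6 * (e * C₂))) := by
        refine hX.trans ?_
        gcongr
        refine hT.trans ?_
        gcongr
    _ = (1 + d) ^ 5 * I + (d * ((1 + d) ^ 4 * V + (1 + d) ^ 3 * S)
          + (1 + d) * 2 * R * (a * H)
          + e * (a * ((1 + d) ^ 2 * C₁ + (1 + d) * 6 * C₂))) := by ring
    _ ≤ (1 + d) ^ 5 * I + (d * (2 ^ 4 * V + 2 ^ 3 * S) + 2 * 2 * R * d
          + e * (a * (2 ^ 2 * C₁ + 2 * 6 * C₂))) := by gcongr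
    _ = (1 + d) ^ 5 * I + (d * (2 ^ 4 * V + 2 ^ 3 * S) + 2 * 2 * R * d
          + e * (a * (4 * C₁ + 12 * C₂))) := by norm_num
    _ ≤ (1 + d) ^ 5 * I + (d * (2 ^ 4 * V + 2 ^ 3 * S) + 2 * 2 * R * d + d) := by gcongr
    _ = _ := by ring

/-- For each tolerance, competitors exist on all sufficiently thin films. -/
lemma eventually_exists_competitor (c₁ : Continuous f₁) (c₂ : Continuous f₂)
    (p₁ : IsQPeriodic f₁) (p₂ : IsQPeriodic f₂) {ω : Set (E 2)} (hω : IsOpen ω)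
    (hb : Bornology.IsBounded ω) {m₀ : E 2 → E 3}
    {D : E 2 → Matrix (Fin 3) (Fin 2) ℝ} (hm : IsH1Sphere ω m₀ D) :
    ∃ C : ℝ≥0∞, C ≠ ∞ ∧ ∀ δ : ℝ, 0 < δ → δ ≤ 1 → ∀ᶠ ε : ℝ in 𝓝[>] 0,
      ∃ (m : E 3 → E 3) (Dm : E 3 → Matrix (Fin 3) (Fin 3) ℝ),
        IsH1Sphere (film f₁ f₂ ω ε) m Dm ∧
        ∫⁻ x in film f₁ f₂ ω ε, ‖m x - m₀ (plane x)‖ₑ ^ 2 ≤ ENNReal.ofReal δ ∧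
        exchangeEnergy (film f₁ f₂ ω ε) ε Dm
          ≤ (1 + ENNReal.ofReal δ) ^ 5 * (∫⁻ x in ω, gHom f₁ f₂ (D x))
            + ENNReal.ofReal δ * C := by
  obtain ⟨M, h₁, h₂⟩ := exists_common_bound c₁ c₂ p₁ p₂
  have hωm := hω.measurableSet
  have hvol : ENNReal.ofReal (2 * M) * volume ω ≠ ∞ :=
    ENNReal.mul_ne_top ENNReal.ofReal_ne_top hb.measure_lt_top.ne
  have hDL : ∀ i, MemLp (rowVec D i) 2 (volume.restrict ω) := fun i =>
    memLp_of_coord fun j => hm.memLp_grad i j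
  have hZ : ∀ i, MemLp (ω.indicator (rowVec D i)) 2 := fun i =>
    (memLp_indicator_iff_restrict hωm).2 (hDL i)
  have hS : ∑ i, ∫⁻ x, ‖ω.indicator (rowVec D i) x‖ₑ ^ 2 ≠ ∞ :=
    ENNReal.sum_ne_top.2 fun i _ => (lintegral_enorm_sq_lt_top (hZ i)).ne
  -- The constant must not depend on δ, so ∫|W|² enters through the bound of `hWS`, in terms of ∇m₀
  -- alone.
  refine ⟨16 * volume (cell f₁ f₂)
    + 8 * (2 * 1 + 2 * ∑ i, ∫⁻ x, ‖ω.indicator (rowVec D i) x‖ₑ ^ 2)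
    + 4 * ENNReal.ofReal (2 * M) + 1, ?_, fun δ hδ hδ1 => ?_⟩
  · have := (volume_cell_lt_top c₁ c₂ p₁ p₂).ne
    finiteness
  obtain ⟨χ, g, hχ, ⟨B, hB⟩, hopt⟩ := exists_correctors c₁ c₂ p₁ p₂ hδ
  obtain ⟨W, hW, hWc, hWZ⟩ := exists_contDiff_near hZ
    -- The bound 1 controls the norm of W independently of δ; the second bound compensates the
    -- factor 1 + δ⁻¹.
    (η := min 1 (δ / (1 + δ⁻¹))) (by positivity)
  set H := ∑ i, ∫⁻ x, ‖W i x - ω.indicator (rowVec D i) x‖ₑ ^ 2 with hHdef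
  have hH1 : H ≤ 1 := hWZ.trans (by
    rw [← ENNReal.ofReal_one]; exact ENNReal.ofReal_le_ofReal (min_le_left _ _))
  have hHd : ENNReal.ofReal (1 + δ⁻¹) * H ≤ ENNReal.ofReal δ := by
    calc ENNReal.ofReal (1 + δ⁻¹) * H
        ≤ ENNReal.ofReal (1 + δ⁻¹) * ENNReal.ofReal (δ / (1 + δ⁻¹)) := by
          gcongr
          exact hWZ.trans (ENNReal.ofReal_le_ofReal (min_le_right _ _))
      _ = ENNReal.ofReal δ := by
          rw [← ENNReal.ofReal_mul (by positivity), mul_div_cancel₀ _ (by positivity)]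
  have hWS : ∑ i, ∫⁻ x, ‖W i x‖ₑ ^ 2
      ≤ 2 * 1 + 2 * ∑ i, ∫⁻ x, ‖ω.indicator (rowVec D i) x‖ₑ ^ 2 := by
    have h22 : ENNReal.ofReal (1 + 1) = 2 := by norm_num
    have h : ∀ i, ∫⁻ x, ‖W i x‖ₑ ^ 2 ≤ 2 * (∫⁻ x, ‖W i x - ω.indicator (rowVec D i) x‖ₑ ^ 2)
        + 2 * ∫⁻ x, ‖ω.indicator (rowVec D i) x‖ₑ ^ 2 := fun i => by
      rw [← lintegral_const_mul' _ _ ENNReal.ofNat_ne_top,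
        ← lintegral_const_mul' _ _ ENNReal.ofNat_ne_top,
        ← lintegral_add_right' _ (((hZ i).aestronglyMeasurable.enorm.pow_const 2).const_mul _)]
      refine lintegral_mono fun x => ?_
      have h3 := enorm_add_sq_le one_pos (W i x - ω.indicator (rowVec D i) x)
        (ω.indicator (rowVec D i) x)
      rwa [sub_add_cancel, inv_one, h22] at h3
    refine (Finset.sum_le_sum fun i _ => h i).trans ?_
    rw [Finset.sum_add_distrib, ← Finset.mul_sum, ← Finset.mul_sum]
    gcongr
  have hg := fun k => (hχ k).meas_grad
  obtain ⟨C₁, hC₁, hT⟩ := exists_lintegral_film_corrected_le c₁ c₂ p₁ p₂ ω hg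
    (fun k => (hχ k).periodic_grad) (fun k => (hχ k).memLp_grad) hW hWc
  have hL := lintegral_corrected_le c₁ c₂ p₁ p₂ hδ hg hopt (fun i => (hW i).continuous)
    (fun i => (hZ i).aestronglyMeasurable.aemeasurable)
  rw [lintegral_gHom_indicator hωm] at hL
  obtain ⟨K, hK0, hK⟩ := exists_norm_perturb_sub_le hB hW hWc m₀
  obtain ⟨K', hK0', hK'⟩ := exists_norm_sum_smul_classicalGrad_le hB hW hWc
  obtain ⟨r, hr, hr1, hrδ⟩ := exists_radius hδ
  have hdel : ENNReal.ofReal δ ≠ 0 := by simpa using hδ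
  -- Since |m₀| = 1, this keeps the modulus of the perturbed field above r.
  have hsmall : ∀ᶠ ε : ℝ in 𝓝[>] 0, ε * K < 1 - r := by
    have : Tendsto (fun ε : ℝ => ε * K) (𝓝[>] 0) (𝓝 (0 * K)) :=
      ((continuous_id.mul continuous_const).tendsto 0).mono_left nhdsWithin_le_nhds
    exact this.eventually_lt_const (by linarith)
  have he1 := eventually_ofReal_sq_mul_le (C := ENNReal.ofReal ((2 * K) ^ 2) *
    (ENNReal.ofReal (2 * M) * volume ω)) (by finiteness) hdel
  have he2 := eventually_ofReal_sq_mul_le (C := ENNReal.ofReal (1 + δ⁻¹) * (4 * C₁ + 12 *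
    (ENNReal.ofReal (K' ^ 2) * (ENNReal.ofReal (2 * M) * volume ω)))) (by finiteness) hdel
  have hle1 : ∀ᶠ ε : ℝ in 𝓝[>] 0, ε ≤ 1 :=
    (eventually_le_nhds zero_lt_one).filter_mono nhdsWithin_le_nhds
  filter_upwards [hsmall, he1, he2, hle1, self_mem_nhdsWithin] with ε hs e1 e2 hε1 hε
  replace hε : 0 < ε := hε
  have hsph : ∀ᵐ x ∂volume.restrict (film f₁ f₂ ω ε), ‖m₀ (plane x)‖ = 1 := by
    have hq : Measure.QuasiMeasurePreserving plane (volume.restrict (film f₁ f₂ ω ε))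
      (volume.restrict ω) := quasiMeasurePreserving_plane.restrict fun x hx => hx.1
    exact hq.ae (hm.sphere.mono fun x hx => by simpa using hx)
  have hv : ∀ᵐ x ∂volume.restrict (film f₁ f₂ ω ε), r < ‖perturb ε m₀ χ W x‖ :=
    hsph.mono fun x hx => by
      have := norm_sub_norm_le (m₀ (plane x)) (perturb ε m₀ χ W x)
      rw [norm_sub_rev] at this
      linarith [hK ε hε x]
  refine ⟨_, _, isH1Sphere_sphereProj_perturb c₁ c₂ p₁ p₂ hω hb hε hm hχ hB hW hWc
    (hv.mono fun x hx => hr.trans hx.le), ?_, ?_⟩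
  · calc ∫⁻ x in film f₁ f₂ ω ε, ‖sphereProj (perturb ε m₀ χ W x) - m₀ (plane x)‖ₑ ^ 2
        ≤ ∫⁻ _ in film f₁ f₂ ω ε, ENNReal.ofReal (ε ^ 2) * ENNReal.ofReal ((2 * K) ^ 2) := by
          refine lintegral_mono_ae ((hsph.and hv).mono fun x hx => ?_)
          rw [enorm_sq_eq_ofReal, ← ENNReal.ofReal_mul (by positivity), ← mul_pow]
          refine ENNReal.ofReal_le_ofReal ?_
          have h3 := norm_sphereProj_sub_le (r := 1 / 2) le_rfl (hr.trans hx.2.le)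
            (w := m₀ (plane x)) (by rw [hx.1]; norm_num)
          rw [sphereProj_of_norm_eq_one hx.1] at h3
          have h4 := hK ε hε x
          gcongr
          refine h3.trans ?_
          norm_num
          linarith
      _ ≤ ENNReal.ofReal (ε ^ 2) * ENNReal.ofReal ((2 * K) ^ 2)
            * (ENNReal.ofReal (2 * M) * volume ω) := by
          rw [setLIntegral_const]
          gcongr
          exact volume_film_le h₁ h₂ ω ε
      _ ≤ _ := by rwa [mul_assoc]
  · have hX := exchangeEnergy_projGrad_le h₁ h₂ hε hδ (fun i => (hDL i).aestronglyMeasurable)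
      hg (fun i => (hW i).continuous) hK' hr hrδ hv
    have hHω : ∑ i, ∫⁻ x' in ω, ‖W i x' - rowVec D i x'‖ₑ ^ 2 ≤ H := by
      refine Finset.sum_le_sum fun i _ => ?_
      rw [setLIntegral_congr_fun hωm fun x hx => by
        rw [← Set.indicator_of_mem hx (rowVec D i)]]
      exact setLIntegral_le_lintegral _ _
    have h1d : ENNReal.ofReal (1 + δ) = 1 + ENNReal.ofReal δ := by
      rw [ENNReal.ofReal_add zero_le_one hδ.le, ENNReal.ofReal_one]
    have hTε := hT δ hδ ε hε hε1
    rw [h1d] at hX hTε hL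
    refine combine_bounds (by simpa using hδ1) hTε (hL.trans ?_) (hX.trans ?_) hHd e2
    · rw [← hHdef]
      have hVH : ENNReal.ofReal (1 + δ⁻¹) * volume (cell f₁ f₂) * H
          ≤ volume (cell f₁ f₂) * ENNReal.ofReal δ := by
        rw [mul_right_comm, mul_comm]
        exact mul_le_mul' le_rfl hHd
      exact add_le_add (mul_le_mul' le_rfl (add_le_add le_rfl hVH)) (mul_le_mul' le_rfl hWS)
    · have e : ∀ a b c : ℝ≥0∞, 6 * (a * b) * c = 6 * (a * (b * c)) := fun a b c => by ring
      rw [e]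
      exact mul_le_mul' le_rfl (add_le_add le_rfl (mul_le_mul' le_rfl (add_le_add
        (mul_le_mul' le_rfl (mul_le_mul' le_rfl hHω)) le_rfl)))

end

/-! ### Diagonal selection and conclusion. -/

section

variable {f₁ f₂ : E 2 → ℝ}

/-- Extended constantly in the vertical direction, `m₀` is a field on the film. -/
lemma IsH1Sphere.comp_plane (c₁ : Continuous f₁) (c₂ : Continuous f₂)
    (p₁ : IsQPeriodic f₁) (p₂ : IsQPeriodic f₂) {ω : Set (E 2)} (hω : IsOpen ω)
    {m₀ : E 2 → E 3} {D : E 2 → Matrix (Fin 3) (Fin 2) ℝ} (hm : IsH1Sphere ω m₀ D) (ε : ℝ) :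
    IsH1Sphere (film f₁ f₂ ω ε) (fun x => m₀ (plane x))
      (fun x i => join (rowVec D i (plane x)) 0) := by
  obtain ⟨M, h₁, h₂⟩ := exists_common_bound c₁ c₂ p₁ p₂
  have hq : Measure.QuasiMeasurePreserving plane (volume.restrict (film f₁ f₂ ω ε))
    (volume.restrict ω) := quasiMeasurePreserving_plane.restrict fun x hx => hx.1
  refine ⟨⟨memLp_film_comp_plane h₁ h₂ ε hm.memLp, fun i j => ?_,
    WeakGrad.hasWeakGradient fun i => ?_⟩, hq.ae hm.sphere⟩
  · have hD : MemLp (rowVec D i) 2 (volume.restrict ω) := memLp_of_coord fun j => hm.memLp_grad i j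
    have h := joinL.comp_memLp' (memLp_film_comp_plane h₁ h₂ ε hD)
    exact MemLp.coord h j
  · exact ((hm.weakGrad i).comp_plane hω).mono fun x hx => hx.1

lemma exists_ofReal_mul_le {C η : ℝ≥0∞} (hC : C ≠ ∞) (hη : 0 < η) {I : ℝ≥0∞} (hI : I ≠ ∞) :
    ∃ δ : ℝ, 0 < δ ∧ δ ≤ 1 ∧ ENNReal.ofReal δ ≤ η ∧
      (1 + ENNReal.ofReal δ) ^ 5 * I + ENNReal.ofReal δ * C ≤ I + η := by
  have h0 : Tendsto (fun δ : ℝ => ENNReal.ofReal δ) (𝓝[>] 0) (𝓝 0) := by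
    have := (ENNReal.continuous_ofReal.tendsto 0).mono_left
      (nhdsWithin_le_nhds (a := (0 : ℝ)) (s := Set.Ioi 0))
    rwa [ENNReal.ofReal_zero] at this
  have h1 : Tendsto (fun δ : ℝ => (1 + ENNReal.ofReal δ) ^ 5 * I + ENNReal.ofReal δ * C)
      (𝓝[>] 0) (𝓝 ((1 + 0) ^ 5 * I + 0 * C)) :=
    (ENNReal.Tendsto.mul_const (((ENNReal.continuous_pow 5).tendsto _).comp
      (tendsto_const_nhds.add h0)) (Or.inr hI)).add (ENNReal.Tendsto.mul_const h0 (Or.inr hC))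
  rw [add_zero, one_pow, one_mul, zero_mul, add_zero] at h1
  have h2 := h1.eventually_lt_const (ENNReal.lt_add_right hI hη.ne')
  have h3 := h0.eventually_lt_const hη
  have h4 : ∀ᶠ δ : ℝ in 𝓝[>] 0, δ ≤ 1 :=
    (eventually_le_nhds zero_lt_one).filter_mono nhdsWithin_le_nhds
  obtain ⟨δ, ⟨⟨⟨a, b⟩, c⟩, d⟩⟩ := (((h2.and h3).and h4).and self_mem_nhdsWithin).exists
  exact ⟨δ, d, c, b.le, a.le⟩

/-- Diagonal selection: competitors that are available with every tolerance can be chosen so that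
both errors vanish in the limit. -/
lemma exists_diagonal_family {α : Type*} {A : ℝ → Set α} (hne : ∀ ε, 0 < ε → (A ε).Nonempty)
    {err en : ℝ → α → ℝ≥0∞} {I : ℝ≥0∞}
    (h : ∀ η : ℝ≥0∞, 0 < η → ∀ᶠ ε : ℝ in 𝓝[>] 0, ∃ a ∈ A ε, err ε a ≤ η ∧ en ε a ≤ I + η) :
    ∃ a : ℝ → α, (∀ ε, 0 < ε → a ε ∈ A ε) ∧
      Tendsto (fun ε => err ε (a ε)) (𝓝[>] 0) (𝓝 0) ∧
      limsup (fun ε => en ε (a ε)) (𝓝[>] 0) ≤ I := by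
  classical
  -- The best joint error at scale ε. It tends to zero by hypothesis, so choosing an element within
  -- ε of it for each ε separately replaces an explicit dependence of the tolerance on ε.
  let c : ℝ → ℝ≥0∞ := fun ε => ⨅ a ∈ A ε, max (err ε a) (en ε a - I)
  have hc : ∀ ε, 0 < ε → ∃ a ∈ A ε, max (err ε a) (en ε a - I) ≤ c ε + ENNReal.ofReal ε := by
    intro ε hε
    obtain ⟨a₀, ha₀⟩ := hne ε hε
    by_cases hce : c ε = ∞
    · exact ⟨a₀, ha₀, by simp [hce]⟩
    · have hlt : c ε < c ε + ENNReal.ofReal ε :=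
        ENNReal.lt_add_right hce (by simpa using hε)
      obtain ⟨a, ha⟩ := iInf_lt_iff.1 hlt
      obtain ⟨ha, hl⟩ := iInf_lt_iff.1 ha
      exact ⟨a, ha, hl.le⟩
  have hinh : Nonempty α := ⟨(hne 1 one_pos).some⟩
  choose! a haA ha using hc
  have hc0 : Tendsto c (𝓝[>] 0) (𝓝 0) := by
    rw [ENNReal.tendsto_nhds_zero]
    intro η hη
    filter_upwards [h η hη] with ε ⟨b, hb, h1, h2⟩
    exact (iInf₂_le b hb).trans (max_le h1 (tsub_le_iff_left.2 h2))
  have h0 : Tendsto (fun δ : ℝ => ENNReal.ofReal δ) (𝓝[>] 0) (𝓝 0) := by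
    have := (ENNReal.continuous_ofReal.tendsto 0).mono_left
      (nhdsWithin_le_nhds (a := (0 : ℝ)) (s := Set.Ioi 0))
    rwa [ENNReal.ofReal_zero] at this
  have hsum : Tendsto (fun ε => c ε + ENNReal.ofReal ε) (𝓝[>] 0) (𝓝 0) := by
    simpa using hc0.add h0
  have hpos : ∀ᶠ ε : ℝ in 𝓝[>] 0, 0 < ε := self_mem_nhdsWithin
  refine ⟨a, haA, ?_, ?_⟩
  · exact tendsto_of_tendsto_of_tendsto_of_le_of_le' tendsto_const_nhds hsum
      (.of_forall fun _ => zero_le) (hpos.mono fun ε hε => (le_max_left _ _).trans (ha ε hε))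
  · have hlim : Tendsto (fun ε => I + (c ε + ENNReal.ofReal ε)) (𝓝[>] 0) (𝓝 I) := by
      simpa using tendsto_const_nhds.add hsum
    rw [← hlim.limsup_eq]
    refine limsup_le_limsup (hpos.mono fun ε hε => ?_)
    exact tsub_le_iff_left.1 ((le_max_right _ _).trans (ha ε hε))

/-- Recovery families for the homogenized exchange energy. -/
theorem exists_recovery_family (c₁ : Continuous f₁) (c₂ : Continuous f₂)
    (p₁ : IsQPeriodic f₁) (p₂ : IsQPeriodic f₂) {ω : Set (E 2)} (hω : IsOpen ω)
    (hb : Bornology.IsBounded ω) {m₀ : E 2 → E 3}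
    {D : E 2 → Matrix (Fin 3) (Fin 2) ℝ} (hm : IsH1Sphere ω m₀ D) :
    ∃ (m : ℝ → E 3 → E 3) (Dm : ℝ → E 3 → Matrix (Fin 3) (Fin 3) ℝ),
      (∀ ε : ℝ, 0 < ε → IsH1Sphere (film f₁ f₂ ω ε) (m ε) (Dm ε)) ∧
      Tendsto (fun ε : ℝ => ∫⁻ x in film f₁ f₂ ω ε, ‖m ε x - m₀ (plane x)‖ₑ ^ 2)
        (𝓝[>] 0) (𝓝 0) ∧
      limsup (fun ε : ℝ => exchangeEnergy (film f₁ f₂ ω ε) ε (Dm ε)) (𝓝[>] 0)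
        ≤ ∫⁻ x in ω, gHom f₁ f₂ (D x) := by
  obtain ⟨C, hC, hstep⟩ :=
    eventually_exists_competitor c₁ c₂ p₁ p₂ hω hb hm
  obtain ⟨a, haA, herr, hen⟩ := exists_diagonal_family
    (A := fun ε => {a : (E 3 → E 3) × (E 3 → Matrix (Fin 3) (Fin 3) ℝ) |
      IsH1Sphere (film f₁ f₂ ω ε) a.1 a.2})
    (err := fun ε a => ∫⁻ x in film f₁ f₂ ω ε, ‖a.1 x - m₀ (plane x)‖ₑ ^ 2)
    (en := fun ε a => exchangeEnergy (film f₁ f₂ ω ε) ε a.2)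
    (I := ∫⁻ x in ω, gHom f₁ f₂ (D x))
    -- Competitors with small error exist only for small ε; for the others the vertically constant
    -- extension of m₀ guarantees an admissible field.
    (fun ε _ => ⟨(_, _), hm.comp_plane c₁ c₂ p₁ p₂ hω ε⟩) (by
      intro η hη
      -- When the right-hand side is infinite the energy bound is empty and only convergence to m₀
      -- has to be ensured.
      by_cases hI : ∫⁻ x in ω, gHom f₁ f₂ (D x) = ∞
      · obtain ⟨δ, hδ, hδ1, hδη, -⟩ := exists_ofReal_mul_le hC hη ENNReal.zero_ne_top
        filter_upwards [hstep δ hδ hδ1] with ε ⟨m, Dm, h1, h2, _⟩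
        exact ⟨(m, Dm), h1, h2.trans hδη, by simp [hI]⟩
      · obtain ⟨δ, hδ, hδ1, hδη, hδI⟩ := exists_ofReal_mul_le hC hη hI
        filter_upwards [hstep δ hδ hδ1] with ε ⟨m, Dm, h1, h2, h3⟩
        exact ⟨(m, Dm), h1, h2.trans hδη, h3.trans hδI⟩)
  exact ⟨fun ε => (a ε).1, fun ε => (a ε).2, haA, herr, hen⟩

end

end RoughFilm

theorem proposition3p19
    (f₁ f₂ : RoughFilm.E 2 → ℝ)
    (hf₁_lip : ∃ K : ℝ≥0, LipschitzWith K f₁) (hf₂_lip : ∃ K : ℝ≥0, LipschitzWith K f₂)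
    (hf₁_per : RoughFilm.IsQPeriodic f₁) (hf₂_per : RoughFilm.IsQPeriodic f₂)
    (hf₁_pos : ∀ y, 0 < f₁ y) (hf_lt : ∀ y, f₁ y < f₂ y)
    (ω : Set (RoughFilm.E 2)) (hω_open : IsOpen ω) (hω_bdd : Bornology.IsBounded ω)
    (hω_lip : RoughFilm.HasLipschitzBoundary ω)
    (m₀ : RoughFilm.E 2 → RoughFilm.E 3) (Dm₀ : RoughFilm.E 2 → Matrix (Fin 3) (Fin 2) ℝ)
    (hm₀ : RoughFilm.IsH1Sphere ω m₀ Dm₀) :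
    ∃ (m : ℝ → RoughFilm.E 3 → RoughFilm.E 3)
      (Dm : ℝ → RoughFilm.E 3 → Matrix (Fin 3) (Fin 3) ℝ),
      (∀ ε : ℝ, 0 < ε → RoughFilm.IsH1Sphere (RoughFilm.film f₁ f₂ ω ε) (m ε) (Dm ε)) ∧
      Tendsto (fun ε : ℝ => ∫⁻ x in RoughFilm.film f₁ f₂ ω ε,
          ‖m ε x - m₀ (RoughFilm.plane x)‖ₑ ^ 2) (𝓝[>] 0) (𝓝 0) ∧
      limsup (fun ε : ℝ =>
          RoughFilm.exchangeEnergy (RoughFilm.film f₁ f₂ ω ε) ε (Dm ε)) (𝓝[>] 0)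
        ≤ ∫⁻ x in ω, RoughFilm.gHom f₁ f₂ (Dm₀ x) := by
  obtain ⟨K₁, hK₁⟩ := hf₁_lip
  obtain ⟨K₂, hK₂⟩ := hf₂_lip
  exact RoughFilm.exists_recovery_family hK₁.continuous hK₂.continuous hf₁_per hf₂_per hω_open
    hω_bdd hm₀
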